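/- Let $k$ be a field with a valuation $|\cdot|\colon k\to\Gamma\cup\{0\}$ ($\Gamma$ a totally ordered abelian group, of arbitrary height; the trivial valuation is allowed), with valuation ring $k^\circ$ and residue field $\tilde k$, and let $p\ge 1$ be the characteristic exponent of $\tilde k$. Suppose that $k$ is $p$-closed: every algebraic extension $l/k$ such that all finite subextensions have degree a power of $p$ (a $p$-extension; it is not assumed to be Galois) is trivial. Then the valued field $k$ is tame: $k^a=k^t$, and every algebraic extension of valued fields $l/k$ is tame. Here the notions are as follows. For a valued field $k$, fix an extension of the valuation to an algebraic closure $k^a$. The henselization $k^h\subseteq k^a$ is the smallest henselian valued subfield containing $k$, and $k^u\subseteq k^a$ is the smallest henselian valued subfield containing $k$ with separably closed residue field (its valuation ring is the strict henselization of $k^\circ$). If $k$ is henselian, an algebraic extension of $k$ is unramified if it lies in $k^u$, and totally ramified if it is linearly disjoint from $k^u$ over $k$; an algebraic extension $l/k$ is tame if it decomposes as $l/m/k$ with $m/k$ unramified, $l/m$ totally ramified, and all finite subextensions of $l/m$ of degree prime to $p$. For arbitrary $k$, an algebraic extension of valued fields $l/k$ is tame if $l^h/k^h$ is tame. Finally,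 $k^t$ is the compositum in $k^a$ of all tame extensions of $k^h$. -/

import Mathlib

open IsLocalRing

universe u v w x

noncomputable section

namespace ValuedTame

/-! ### Extensions with prescribed primes in the degree -/

/-- The set of prime divisors of `n`. -/
def primesOf (n : ℕ) : Set ℕ := {q | q.Prime ∧ q ∣ n}

/-- The set of primes outside `P`. -/
def primeCompl (P : Set ℕ) : Set ℕ := {q | q.Prime ∧ q ∉ P}

/-- All prime divisors of `n` lie in `P`. -/
def IsPNumber (P : Set ℕ) (n : ℕ) : Prop := ∀ q : ℕ, q.Prime → q ∣ n → q ∈ P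

/-- `L / K` is a `P`-extension: it is algebraic and every finite subextension has as its degree
a `P`-number. -/
def IsPExtension (P : Set ℕ) (K : Type u) (L : Type v) [Field K] [Field L] [Algebra K L] : Prop :=
  Algebra.IsAlgebraic K L ∧
    ∀ F : IntermediateField K L, FiniteDimensional K F → IsPNumber P (Module.finrank K F)

/-- `K` has no non-trivial `P`-extension. (An algebraic extension of `K` is isomorphic to one
in the universe of `K`.) -/
def IsPClosed (P : Set ℕ) (K : Type u) [Field K] : Prop :=
  ∀ (L : Type u) [Field L] [Algebra K L],
    IsPExtension P K L → Function.Surjective (algebraMap K L)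

/-! ### The ramification tower inside a valued field `(Ω, O)`

In the applications `Ω` is an algebraic closure of `K`. Every field `E` with a map to `Ω` carries
the valuation ring `O.comap (algebraMap E Ω)`, written `O ∩ E` in the comments. -/

section Tower

variable (K : Type u) {Ω : Type v} [Field K] [Field Ω] [Algebra K Ω] (O : ValuationSubring Ω)

/-- The henselization `K^h` in `Ω`: the smallest henselian valued subfield of `Ω` over `K`. -/
def henselization : IntermediateField K Ω :=
  sInf {E | HenselianLocalRing (O.comap (algebraMap E Ω))}

/-- The field `K^u` whose valuation ring is the strict henselization in `Ω` of the valuation ring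
of `K`: the smallest henselian valued subfield of `Ω` over `K` whose residue field is separably
closed. -/
def strictHenselization : IntermediateField K Ω :=
  sInf {E | HenselianLocalRing (O.comap (algebraMap E Ω)) ∧
    IsSepClosed (ResidueField (O.comap (algebraMap E Ω)))}

/-- For `K` henselian: `L / K` is unramified, that is, contained in `K^u`. -/
def IsUnramifiedHenselian (L : IntermediateField K Ω) : Prop :=
  L ≤ strictHenselization K O

/-- For `K` henselian: `L / K` is totally ramified, that is, linearly disjoint from `K^u`. -/
def IsTotallyRamifiedHenselian (L : IntermediateField K Ω) : Prop :=
  L.LinearDisjoint (strictHenselization K O)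

/-- For `K` henselian with residual characteristic exponent `p`: the extension `L / K` is tame,
that is, in the decomposition `L / M / K` with `M / K` unramified and `L / M` totally ramified,
`L / M` is a `p'`-extension. -/
def IsTameHenselian (L : IntermediateField K Ω) : Prop :=
  ∃ (M : IntermediateField K Ω) (hM : M ≤ L),
    IsUnramifiedHenselian K O M ∧
    IsTotallyRamifiedHenselian M O (IntermediateField.extendScalars hM) ∧
    IsPExtension
      (primeCompl (primesOf (ringExpChar (ResidueField (O.comap (algebraMap K Ω))))))
      M (IntermediateField.extendScalars hM)

/-- The maximal tame extension `K^t = (K^h)^t` of `K` in `Ω`: the compositum of all tame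
extensions of `K^h` in `Ω`. -/
def tameClosure : IntermediateField K Ω :=
  (sSup {E : IntermediateField (henselization K O) Ω |
    IsTameHenselian (henselization K O) O E}).restrictScalars K

variable (L : Type w) [Field L] [Algebra K L] [Algebra L Ω] [IsScalarTower K L Ω]

/-- `K^h ⊆ L^h`. -/
theorem henselization_le :
    henselization K O ≤ (henselization L O).restrictScalars K := by
  intro x hx
  rw [IntermediateField.mem_restrictScalars]
  simp only [henselization, IntermediateField.mem_sInf] at hx ⊢
  intro E hE
  exact hx (E.restrictScalars K) hE

/-- For `K ⊆ L ⊆ Ω`: the extension `L / K` is tame for the valuations induced from `O`, that is,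
`L^h / K^h` is tame. -/
def IsTameIn : Prop :=
  IsTameHenselian (henselization K O) O
    (IntermediateField.extendScalars (henselization_le K O L))

end Tower

/-- Let `L / K` be an algebraic extension, `B` a valuation ring of `L`, and give `K` the induced
valuation. The extension `L / K` is tame. (Extensions `O` of `B` to the algebraic closure exist
and are conjugate over `L`, so the choice of `O` is irrelevant.) -/
def IsTameExtension (K : Type u) {L : Type v} [Field K] [Field L] [Algebra K L]
    (B : ValuationSubring L) : Prop :=
  ∀ O : ValuationSubring (AlgebraicClosure L),
    O.comap (algebraMap L (AlgebraicClosure L)) = B → IsTameIn K O L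

/-- The field `K` with the valuation ring `A` is tame: `K^a = K^t`. -/
def IsTameField {K : Type u} [Field K] (A : ValuationSubring K) : Prop :=
  ∀ O : ValuationSubring (AlgebraicClosure K),
    O.comap (algebraMap K (AlgebraicClosure K)) = A → tameClosure K O = ⊤

end ValuedTame

end

/-! Let D and I be the decomposition and inertia groups of `O` in Gal(Ω/K). Then K^h is the fixed
field of D and K^u that of I (`henselization_eq`, `strictHenselization_eq`), so tameness becomes a
statement about I: it has no p-part (`NoPInertia`). Indeed, for E over K^h put M = E ∩ K^u; then E
is linearly disjoint from M^u over M, and the degrees of finite subextensions of E/M divide orders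
of finite quotients of the inertia group (`isTameHenselian`). For p = 1 nothing else is needed. For
p prime, p-closedness enters as `NoPDegree`: no element of Ω has degree p^n over K with n > 0. In
particular elements of K have p-th roots in K, K is perfect and Ω/K is Galois.

Rank one (`noPInertia_of_isRankLeOne`). Suppose that the wild inertia W of a finite normal N acts
non-trivially on N, and let F be the subgroup of D fixing N. The finite p-group W/F has V = Hom(W/F,
F_p) ≠ 0. The group D acts on the residue field Λ of Ω, which is algebraically closed of
characteristic p; vanishing of additive cohomology and surjectivity of the Artin-Schreier map on Λ
extend the evaluation map W → V*, up to sign, to a 1-cocycle on D. Its kernel X has index |V*|, a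
non-trivial power of p (`exists_subgroup_index_prime_pow`). So K^h has an extension of that degree,
and since K is dense in K^h, a Krasner argument moves it down to K
(`exists_natDegree_minpoly_eq_card`), a contradiction.

Arbitrary rank. Density fails, so the valuation is climbed one step at a time. If T is the least
overring of S, then S induces a valuation of rank one on the residue field of T, and `NoPDegree`
passes to the residue field of T ∩ K. Hence an inertia element at S with trivial p-th power on N
acts trivially on the T-residues of N, and can be replaced by an inertia element at T with the same
action on N (`exists_inertia_of_lt`). The climb ends where p is a unit, because the value group of K
is p-divisible (`apply_eq_of_valuation_eq_one`), or at the trivial valuation. It is finite after K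
is replaced by the relative algebraic closure of a finitely generated subfield: there the
transcendence degree bounds the number of overrings in which p is not a unit (`card_le_trdeg`). -/

noncomputable section

namespace ValuedTame

open scoped Pointwise Polynomial

/-! ### Galois-stable subrings -/

section StableSubring

variable {K : Type u} {Ω : Type v} [Field K] [Field Ω] [Algebra K Ω]

/-- The action of the Galois group on a stable subring. -/
@[reducible] def stableAction (B : Subring Ω) (hB : ∀ (σ : Ω ≃ₐ[K] Ω), ∀ x ∈ B, σ x ∈ B) :
    MulSemiringAction (Ω ≃ₐ[K] Ω) B where
  smul σ x := ⟨σ x, hB σ x x.2⟩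
  one_smul _ := Subtype.ext rfl
  mul_smul _ _ _ := Subtype.ext rfl
  smul_zero σ := Subtype.ext (map_zero σ)
  smul_add σ x y := Subtype.ext (map_add σ (x : Ω) y)
  smul_one σ := Subtype.ext (map_one σ)
  smul_mul σ x y := Subtype.ext (map_mul σ (x : Ω) y)

/-- The algebra structure of a subring of `Ω` over its preimage in `K`. -/
@[reducible] def stableAlgebra (K : Type u) {Ω : Type v} [Field K] [Field Ω] [Algebra K Ω]
    (B : Subring Ω) : Algebra (B.comap (algebraMap K Ω)) B :=
  ((algebraMap K Ω).restrict (B.comap (algebraMap K Ω)) B fun _ h => h).toAlgebra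

theorem apply_eq_of_mem_adjoin (τ : Ω ≃ₐ[K] Ω) {s : Set Ω} (hs : ∀ x ∈ s, τ x = x) {x : Ω}
    (hx : x ∈ IntermediateField.adjoin K s) : τ x = x := by
  induction hx using IntermediateField.adjoin_induction with
  | mem z hz => exact hs z hz
  | algebraMap z => exact τ.commutes z
  | add y z _ _ h1 h2 => rw [map_add, h1, h2]
  | inv y _ h1 => rw [map_inv₀, h1]
  | mul y z _ _ h1 h2 => rw [map_mul, h1, h2]

theorem isOpen_stabilizer_apply [Algebra.IsAlgebraic K Ω] (x : Ω) :
    IsOpen {σ : Ω ≃ₐ[K] Ω | σ x = x} := by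
  have : FiniteDimensional K (IntermediateField.adjoin K {x}) :=
    IntermediateField.adjoin.finiteDimensional (Algebra.IsIntegral.isIntegral x)
  convert! (IntermediateField.adjoin K {x}).fixingSubgroup_isOpen using 1
  ext σ
  simp only [Set.mem_ofPred_eq, SetLike.mem_coe, IntermediateField.mem_fixingSubgroup_iff]
  constructor
  · intro h y hy
    exact apply_eq_of_mem_adjoin σ (by simpa using h) hy
  · intro h
    exact h x (IntermediateField.mem_adjoin_simple_self K x)

theorem stable_continuousSMul [Algebra.IsAlgebraic K Ω] (B : Subring Ω)
    (hB : ∀ (σ : Ω ≃ₐ[K] Ω), ∀ x ∈ B, σ x ∈ B) :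
    letI := stableAction B hB
    letI : TopologicalSpace B := ⊥
    ContinuousSMul (Ω ≃ₐ[K] Ω) B := by
  let := stableAction B hB
  let : TopologicalSpace B := ⊥
  have : DiscreteTopology B := ⟨rfl⟩
  rw [continuousSMul_iff_stabilizer_isOpen]
  intro x
  convert! isOpen_stabilizer_apply (K := K) (x : Ω) using 1
  ext σ
  exact Subtype.ext_iff

theorem stable_isInvariant [IsGalois K Ω] (B : Subring Ω)
    (hB : ∀ (σ : Ω ≃ₐ[K] Ω), ∀ x ∈ B, σ x ∈ B) :
    letI := stableAction B hB
    letI := stableAlgebra K B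
    Algebra.IsInvariant (B.comap (algebraMap K Ω)) B (Ω ≃ₐ[K] Ω) := by
  let := stableAction B hB
  let := stableAlgebra K B
  constructor
  intro b hb
  obtain ⟨a, ha⟩ := IntermediateField.mem_bot.mp
    ((InfiniteGalois.mem_bot_iff_fixed (k := K) (b : Ω)).mpr fun σ => congrArg Subtype.val (hb σ))
  exact ⟨⟨a, by rw [Subring.mem_comap, ha]; exact b.2⟩, Subtype.ext ha⟩

theorem stable_smulCommClass (B : Subring Ω) (hB : ∀ (σ : Ω ≃ₐ[K] Ω), ∀ x ∈ B, σ x ∈ B) :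
    letI := stableAction B hB
    letI := stableAlgebra K B
    SMulCommClass (Ω ≃ₐ[K] Ω) (B.comap (algebraMap K Ω)) B := by
  let := stableAction B hB
  let := stableAlgebra K B
  constructor
  intro σ a b
  rw [Algebra.smul_def, Algebra.smul_def, smul_mul']
  congr 1
  exact Subtype.ext (σ.commutes (a : K))

/-- The Galois group acts transitively on the primes of a stable subring with a given trace
on `K`. -/
theorem stable_exists_smul [IsGalois K Ω] (B : Subring Ω)
    (hB : ∀ (σ : Ω ≃ₐ[K] Ω), ∀ x ∈ B, σ x ∈ B) (P Q : Ideal B) [P.IsPrime] [Q.IsPrime]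
    (h : ∀ (a : K) (ha : algebraMap K Ω a ∈ B),
      (⟨_, ha⟩ : B) ∈ P ↔ (⟨_, ha⟩ : B) ∈ Q) :
    ∃ σ : Ω ≃ₐ[K] Ω, ∀ b : B, b ∈ P ↔ (⟨σ b, hB σ b b.2⟩ : B) ∈ Q := by
  let := stableAction B hB
  let := stableAlgebra K B
  let : TopologicalSpace B := ⊥
  have : DiscreteTopology B := ⟨rfl⟩
  have := stable_continuousSMul (K := K) B hB
  have := stable_isInvariant (K := K) B hB
  have := stable_smulCommClass (K := K) B hB
  obtain ⟨σ, hσ⟩ := Algebra.IsInvariant.exists_smul_of_under_eq_of_profinite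
    (A := B.comap (algebraMap K Ω)) (B := B) (G := Ω ≃ₐ[K] Ω) P Q
    (by ext ⟨a, ha⟩; exact h a ha)
  refine ⟨σ, fun b => ?_⟩
  rw [hσ]
  exact (Ideal.smul_mem_pointwise_smul_iff (a := σ) (S := P) (x := b)).symm

/-- Automorphisms of the residue ring of a stable subring at a prime lift to the Galois group. -/
theorem stable_exists_lift [IsGalois K Ω] (B : Subring Ω)
    (hB : ∀ (σ : Ω ≃ₐ[K] Ω), ∀ x ∈ B, σ x ∈ B) {Λ : Type w} [CommRing Λ] [IsDomain Λ]
    (φ : B →+* Λ) (hφ : Function.Surjective φ) (g : Λ ≃+* Λ)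
    (hg : ∀ (a : K) (ha : algebraMap K Ω a ∈ B), g (φ ⟨_, ha⟩) = φ ⟨_, ha⟩) :
    ∃ σ : Ω ≃ₐ[K] Ω, ∀ b : B, φ ⟨σ b, hB σ b b.2⟩ = g (φ b) := by
  let := stableAction B hB
  let := stableAlgebra K B
  let : TopologicalSpace B := ⊥
  have : DiscreteTopology B := ⟨rfl⟩
  have := stable_continuousSMul (K := K) B hB
  have := stable_isInvariant (K := K) B hB
  have := stable_smulCommClass (K := K) B hB
  let A := B.comap (algebraMap K Ω)
  let Q : Ideal B := RingHom.ker φ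
  have : Q.IsPrime := RingHom.ker_isPrime φ
  let P : Ideal A := Q.under A
  have : Q.LiesOver P := ⟨rfl⟩
  let e : B ⧸ Q ≃+* Λ := RingHom.quotientKerEquivOfSurjective hφ
  have he : ∀ b : B, e (Ideal.Quotient.mk Q b) = φ b := fun b => rfl
  let s : (B ⧸ Q) ≃+* (B ⧸ Q) := (e.trans g).trans e.symm
  have hs : ∀ r : A ⧸ P, s (algebraMap (A ⧸ P) (B ⧸ Q) r) = algebraMap (A ⧸ P) (B ⧸ Q) r := by
    intro r
    obtain ⟨⟨a, ha⟩, rfl⟩ := Ideal.Quotient.mk_surjective r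
    have ha' : algebraMap K Ω a ∈ B := ha
    change e.symm (g (φ ⟨_, ha'⟩)) = Ideal.Quotient.mk Q ⟨_, ha'⟩
    rw [hg a ha', RingEquiv.symm_apply_eq, he]
  obtain ⟨σ, hσ⟩ := Ideal.Quotient.stabilizerHom_surjective_of_profinite
    (G := Ω ≃ₐ[K] Ω) P Q (AlgEquiv.ofRingEquiv (f := s) hs)
  refine ⟨σ.1, fun b => ?_⟩
  have h1 := DFunLike.congr_fun hσ (Ideal.Quotient.mk Q b)
  have h2 : Ideal.Quotient.mk Q (⟨σ.1 b, hB σ.1 b b.2⟩ : B) = e.symm (g (φ b)) := h1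
  rw [← he, h2, RingEquiv.apply_symm_apply]

end StableSubring

/-! ### Decomposition and inertia groups -/

section Inertia

variable {K : Type u} {Ω : Type v} [Field K] [Field Ω] [Algebra K Ω] {O : ValuationSubring Ω}

theorem mem_decomposition_iff {σ : Ω ≃ₐ[K] Ω} :
    σ ∈ O.decompositionSubgroup K ↔ ∀ x, σ x ∈ O ↔ x ∈ O := by
  rw [MulAction.mem_stabilizer_iff]
  constructor
  · intro h x
    conv_lhs => rw [← h]
    exact ValuationSubring.smul_mem_pointwise_smul_iff (g := σ) (S := O)
  · intro h
    ext x
    rw [ValuationSubring.mem_pointwise_smul_iff_inv_smul_mem, ← h]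
    change σ (σ.symm x) ∈ O ↔ _
    rw [AlgEquiv.apply_symm_apply]

/-- A field automorphism preserving `O` preserves its maximal ideal. -/
theorem valuation_lt_one_of_preserves {g : Ω ≃+* Ω} (hg : ∀ x, g x ∈ O ↔ x ∈ O) (x : Ω) :
    O.valuation (g x) < 1 ↔ O.valuation x < 1 := by
  rw [← ValuationSubring.mem_nonunits_iff, ← ValuationSubring.mem_nonunits_iff,
    ValuationSubring.mem_nonunits_iff_or, ValuationSubring.mem_nonunits_iff_or, ← map_inv₀, hg,
    map_eq_zero_iff g g.injective]

theorem valuation_lt_one_of_mem_decomposition {σ : Ω ≃ₐ[K] Ω} (hσ : σ ∈ O.decompositionSubgroup K)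
    (x : Ω) : O.valuation (σ x) < 1 ↔ O.valuation x < 1 :=
  valuation_lt_one_of_preserves (g := (σ : Ω ≃+* Ω)) (mem_decomposition_iff.mp hσ) x

variable (K O) in
/-- The inertia group, as a subgroup of the Galois group. -/
def inertia : Subgroup (Ω ≃ₐ[K] Ω) where
  carrier := {σ | σ ∈ O.decompositionSubgroup K ∧ ∀ x ∈ O, O.valuation (σ x - x) < 1}
  one_mem' := ⟨one_mem _, fun x _ => by simp⟩
  mul_mem' := by
    rintro σ τ ⟨hσ, hσ'⟩ ⟨hτ, hτ'⟩
    refine ⟨mul_mem hσ hτ, fun x hx => ?_⟩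
    have := O.valuation.map_add_lt (hσ' (τ x) ((mem_decomposition_iff.mp hτ x).mpr hx)) (hτ' x hx)
    simpa using this
  inv_mem' := by
    rintro σ ⟨hσ, hσ'⟩
    refine ⟨inv_mem hσ, fun x hx => ?_⟩
    rw [← valuation_lt_one_of_mem_decomposition hσ, map_sub, ← O.valuation.map_neg, neg_sub]
    change O.valuation (σ x - σ (σ.symm x)) < 1
    rw [AlgEquiv.apply_symm_apply]
    exact hσ' x hx

theorem conj_mem_inertia {σ τ : Ω ≃ₐ[K] Ω} (hσ : σ ∈ inertia K O)
    (hτ : τ ∈ O.decompositionSubgroup K) : τ * σ * τ⁻¹ ∈ inertia K O := by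
  refine ⟨mul_mem (mul_mem hτ hσ.1) (inv_mem hτ), fun x hx => ?_⟩
  have hx' : τ⁻¹ x ∈ O := (mem_decomposition_iff.mp (inv_mem hτ) x).mpr hx
  have h : (τ * σ * τ⁻¹) x - x = τ (σ (τ⁻¹ x) - τ⁻¹ x) := by
    rw [map_sub]
    change _ = _ - τ (τ.symm x)
    rw [AlgEquiv.apply_symm_apply]
    rfl
  rw [h, valuation_lt_one_of_mem_decomposition hτ]
  exact hσ.2 _ hx'

/-- The powers of `σ` move `x` inside the finite root set of its minimal polynomial, so two of them
agree on `x`. -/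
theorem exists_pow_apply_eq [Algebra.IsAlgebraic K Ω] (σ : Ω ≃ₐ[K] Ω) (x : Ω) :
    ∃ n : ℕ, 0 < n ∧ (σ ^ n) x = x := by
  classical
  have hfin : ((minpoly K x).rootSet Ω).Finite := (minpoly K x).rootSet_finite Ω
  have hmem : ∀ n : ℕ, (σ ^ n) x ∈ (minpoly K x).rootSet Ω := by
    intro n
    rw [Polynomial.mem_rootSet]
    refine ⟨minpoly.ne_zero (Algebra.IsIntegral.isIntegral x), ?_⟩
    change Polynomial.aeval ((σ ^ n : Ω ≃ₐ[K] Ω).toAlgHom x) _ = 0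
    rw [Polynomial.aeval_algHom_apply, minpoly.aeval, map_zero]
  obtain ⟨i, j, hij, h⟩ : ∃ i j : ℕ, i < j ∧ (σ ^ i) x = (σ ^ j) x := by
    obtain ⟨i, -, j, -, hne, h⟩ := Set.infinite_univ.exists_ne_map_eq_of_mapsTo
      (f := fun n : ℕ => (σ ^ n) x) (fun n _ => hmem n) hfin
    rcases lt_or_gt_of_ne hne with h' | h'
    · exact ⟨i, j, h', h⟩
    · exact ⟨j, i, h', h.symm⟩
  refine ⟨j - i, by omega, ?_⟩
  apply (σ ^ i).injective
  rw [h, ← AlgEquiv.mul_apply, ← pow_add]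
  congr 2
  omega

/-- If an element of D lowered the value of `x`, its iterates would keep lowering it, although some
positive power fixes `x`. The opposite inequality is the same argument for the inverse. -/
theorem valuation_apply_of_mem_decomposition [Algebra.IsAlgebraic K Ω] {σ : Ω ≃ₐ[K] Ω}
    (hσ : σ ∈ O.decompositionSubgroup K) (x : Ω) : O.valuation (σ x) = O.valuation x := by
  have key : ∀ τ ∈ O.decompositionSubgroup K, ¬ O.valuation (τ x) < O.valuation x := by
    intro τ hτ hlt
    have hx : x ≠ 0 := by
      rintro rfl
      simp at hlt
    have h0 : O.valuation (τ x * x⁻¹) < 1 := by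
      rw [map_mul, map_inv₀]
      exact (mul_inv_lt_iff₀ (zero_lt_iff.mpr (by simpa using hx))).mpr (by simpa using hlt)
    have hle : ∀ n : ℕ, O.valuation ((τ ^ (n + 1)) x) < O.valuation x := by
      intro n
      induction n with
      | zero => simpa using hlt
      | succ n ih =>
        have h1 := (valuation_lt_one_of_mem_decomposition (pow_mem hτ (n + 1)) _).mpr h0
        rw [map_mul, map_inv₀, map_mul, map_inv₀, ← AlgEquiv.mul_apply, ← pow_succ,
          mul_inv_lt_iff₀ (zero_lt_iff.mpr ((map_ne_zero _).mpr ((map_ne_zero _).mpr hx))),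
          one_mul] at h1
        exact h1.trans ih
    obtain ⟨n, hn, h⟩ := exists_pow_apply_eq τ x
    have := hle (n - 1)
    rw [Nat.sub_add_cancel hn, h] at this
    exact lt_irrefl _ this
  refine le_antisymm (not_lt.mp fun hlt => ?_) (not_lt.mp (key σ hσ))
  have h2 : O.valuation (σ⁻¹ (σ x)) < O.valuation (σ x) → False := by
    intro h3
    have hx : x ≠ 0 := by
      rintro rfl
      simp at hlt
    have h4 : O.valuation (σ⁻¹ (x * (σ x)⁻¹)) < 1 := by
      rw [valuation_lt_one_of_mem_decomposition (inv_mem hσ), map_mul, map_inv₀,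
        mul_inv_lt_iff₀ (zero_lt_iff.mpr (by simpa using hx)), one_mul]
      exact hlt
    apply key σ⁻¹ (inv_mem hσ)
    rw [map_mul, map_inv₀, map_mul, map_inv₀] at h4
    change O.valuation (σ⁻¹ x) * (O.valuation (σ.symm (σ x)))⁻¹ < 1 at h4
    rwa [AlgEquiv.symm_apply_apply,
      mul_inv_lt_iff₀ (zero_lt_iff.mpr (by simpa using hx)), one_mul] at h4
  apply h2
  change O.valuation (σ.symm (σ x)) < _
  rw [AlgEquiv.symm_apply_apply]
  exact hlt

end Inertia

/-! ### The integral closure of the valuation ring of K in Ω -/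

section Conjugates

variable (K : Type u) {Ω : Type v} [Field K] [Field Ω] [Algebra K Ω] (O : ValuationSubring Ω)

/-- The intersection of the conjugates over `K` of the valuation ring `O`, that is, the integral
closure in `Ω` of the valuation ring of `K`. -/
def conjInf : Subring Ω where
  carrier := {x | ∀ σ : Ω ≃ₐ[K] Ω, σ x ∈ O}
  zero_mem' σ := by rw [map_zero]; exact zero_mem O
  one_mem' σ := by rw [map_one]; exact one_mem O
  add_mem' hx hy σ := by rw [map_add]; exact add_mem (hx σ) (hy σ)
  mul_mem' hx hy σ := by rw [map_mul]; exact mul_mem (hx σ) (hy σ)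
  neg_mem' hx σ := by rw [map_neg]; exact neg_mem (hx σ)

variable {K O}

theorem mem_of_mem_conjInf {x : Ω} (hx : x ∈ conjInf K O) : x ∈ O := hx 1

theorem apply_mem_conjInf (σ : Ω ≃ₐ[K] Ω) (x : Ω) (hx : x ∈ conjInf K O) : σ x ∈ conjInf K O :=
  fun τ => hx (τ * σ)

theorem algebraMap_mem_conjInf {a : K} : algebraMap K Ω a ∈ conjInf K O ↔ algebraMap K Ω a ∈ O :=
  ⟨mem_of_mem_conjInf, fun h σ => by rwa [AlgEquiv.commutes]⟩

/-- The index is chosen by a lexicographic maximum of (value, index). Ties go to the highest index,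
which makes all later quotients strictly small. -/
theorem exists_dominant_coeff (P : K[X]) (hP : P ≠ 0) : ∃ j, P.coeff j ≠ 0 ∧
    ∀ i, O.valuation (algebraMap K Ω (P.coeff i / P.coeff j)) ≤ 1 ∧
      (j < i → O.valuation (algebraMap K Ω (P.coeff i / P.coeff j)) < 1) := by
  obtain ⟨j, hj, hmax⟩ := Finset.exists_max_image P.support
    (fun i => toLex (O.valuation (algebraMap K Ω (P.coeff i)), i))
    (Polynomial.support_nonempty.mpr hP)
  have hj0 : P.coeff j ≠ 0 := Polynomial.mem_support_iff.mp hj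
  have hpos : 0 < O.valuation (algebraMap K Ω (P.coeff j)) := by
    rw [zero_lt_iff]
    simpa using hj0
  refine ⟨j, hj0, fun i => ?_⟩
  rw [map_div₀, map_div₀, div_le_one₀ hpos, div_lt_one₀ hpos]
  by_cases hi : P.coeff i = 0
  · rw [hi, map_zero, map_zero]
    exact ⟨hpos.le, fun _ => hpos⟩
  · have h := Prod.Lex.le_iff.mp (hmax i (Polynomial.mem_support_iff.mpr hi))
    simp only [ofLex_toLex] at h
    rcases h with h | ⟨h, h'⟩
    · exact ⟨h.le, fun _ => h⟩
    · exact ⟨h.le, fun h'' => absurd h' (not_le.mpr h'')⟩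

/-- For y in `O` this is clear. Otherwise y⁻¹ is in `O`, and the equation turns the tail times y
into minus the initial part divided by y^(j-1), a polynomial in y⁻¹ over `O`. -/
theorem partial_sum_mem {c : ℕ → Ω} (hc : ∀ i, c i ∈ O) {j n : ℕ} {y : Ω}
    (h : ∑ i ∈ Finset.range j, c i * y ^ i + ∑ k ∈ Finset.range n, c (j + k) * y ^ (j + k) = 0) :
    (∑ k ∈ Finset.range n, c (j + k) * y ^ k) ∈ O ∧
      (∑ k ∈ Finset.range n, c (j + k) * y ^ k) * y ∈ O := by
  by_cases hy : y ∈ O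
  · have h1 : (∑ k ∈ Finset.range n, c (j + k) * y ^ k) ∈ O :=
      sum_mem fun k _ => mul_mem (hc _) (pow_mem hy k)
    exact ⟨h1, mul_mem h1 hy⟩
  · have hy' : y⁻¹ ∈ O := (O.mem_or_inv_mem y).resolve_left hy
    have hy0 : y ≠ 0 := by
      rintro rfl
      exact hy (zero_mem O)
    have h2 : (∑ k ∈ Finset.range n, c (j + k) * y ^ k) * y =
        -∑ i ∈ Finset.range j, c i * (y⁻¹) ^ (j - 1 - i) := by
      apply mul_right_cancel₀ (pow_ne_zero j hy0)
      have h3 : (∑ k ∈ Finset.range n, c (j + k) * y ^ k) * y ^ j =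
          -∑ i ∈ Finset.range j, c i * y ^ i := by
        rw [eq_neg_iff_add_eq_zero, add_comm, ← h, Finset.sum_mul]
        congr 1
        refine Finset.sum_congr rfl fun k _ => ?_
        rw [pow_add]
        ring
      rw [mul_assoc, mul_comm y, ← mul_assoc, h3, neg_mul, neg_mul, Finset.sum_mul, Finset.sum_mul]
      congr 1
      refine Finset.sum_congr rfl fun i hi => ?_
      have hi' := Finset.mem_range.mp hi
      have : y ^ j = y ^ (j - 1 - i) * y ^ i * y := by
        rw [← pow_add, ← pow_succ]
        congr 1
        omega
      rw [this, inv_pow]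
      field_simp
    have h4 : (∑ k ∈ Finset.range n, c (j + k) * y ^ k) * y ∈ O := by
      rw [h2]
      exact neg_mem (sum_mem fun i _ => mul_mem (hc _) (pow_mem hy' _))
    refine ⟨?_, h4⟩
    have := mul_mem h4 hy'
    rwa [mul_assoc, mul_inv_cancel₀ hy0, mul_one] at this

/-- Every element of `O` is a quotient of elements of the integral closure with denominator
congruent to `1`. -/
theorem exists_mul_mem_conjInf [Algebra.IsAlgebraic K Ω] {x : Ω} (hx : x ∈ O) :
    ∃ b ∈ conjInf K O, b * x ∈ conjInf K O ∧ O.valuation (b - 1) < 1 := by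
  have hint : IsIntegral K x := Algebra.IsIntegral.isIntegral x
  obtain ⟨j, hj0, hj⟩ := exists_dominant_coeff (O := O) (minpoly K x) (minpoly.ne_zero hint)
  set P := minpoly K x with hP
  let c : ℕ → K := fun i => P.coeff i / P.coeff j
  have hcO : ∀ i, algebraMap K Ω (c i) ∈ O := fun i =>
    (O.valuation_le_one_iff _).mp (hj i).1
  have hjn : j ≤ P.natDegree := Polynomial.le_natDegree_of_ne_zero hj0
  let n := P.natDegree - j
  have hroot : ∀ σ : Ω ≃ₐ[K] Ω, ∑ i ∈ Finset.range j, algebraMap K Ω (c i) * (σ x) ^ i +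
      ∑ k ∈ Finset.range (n + 1), algebraMap K Ω (c (j + k)) * (σ x) ^ (j + k) = 0 := by
    intro σ
    rw [← Finset.sum_range_add (fun i => algebraMap K Ω (c i) * (σ x) ^ i) j (n + 1)]
    have h1 : Polynomial.aeval (σ x) P = 0 := by
      change Polynomial.aeval (σ.toAlgHom x) P = 0
      rw [Polynomial.aeval_algHom_apply, hP, minpoly.aeval, map_zero]
    rw [Polynomial.aeval_eq_sum_range] at h1
    have hn : j + (n + 1) = P.natDegree + 1 := by omega
    rw [hn]
    have h2 : ∑ i ∈ Finset.range (P.natDegree + 1), algebraMap K Ω (c i) * (σ x) ^ i =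
        (algebraMap K Ω (P.coeff j))⁻¹ *
          ∑ i ∈ Finset.range (P.natDegree + 1), P.coeff i • (σ x) ^ i := by
      rw [Finset.mul_sum]
      refine Finset.sum_congr rfl fun i _ => ?_
      rw [Algebra.smul_def, map_div₀]
      ring
    rw [h2, h1, mul_zero]
  -- The tail of the minimal polynomial of `x`, normalized at its dominant coefficient and divided
  -- by x^j. The coefficients lie in K, so `partial_sum_mem` applies to every conjugate; as `c j =
  -- 1` and the later coefficients are in the maximal ideal, `b` is congruent to 1.
  let b : Ω := ∑ k ∈ Finset.range (n + 1), algebraMap K Ω (c (j + k)) * x ^ k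
  have hb : ∀ σ : Ω ≃ₐ[K] Ω,
      σ b = ∑ k ∈ Finset.range (n + 1), algebraMap K Ω (c (j + k)) * (σ x) ^ k := by
    intro σ
    simp [b, map_sum]
  refine ⟨b, fun σ => ?_, fun σ => ?_, ?_⟩
  · rw [hb]
    exact (partial_sum_mem hcO (hroot σ)).1
  · rw [map_mul, hb]
    exact (partial_sum_mem hcO (hroot σ)).2
  · have h1 : b - 1 = ∑ k ∈ Finset.range n, algebraMap K Ω (c (j + (k + 1))) * x ^ (k + 1) := by
      have : c j = 1 := div_self hj0
      simp only [b]
      rw [Finset.sum_range_succ']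
      simp [this]
    rw [h1]
    refine O.valuation.map_sum_lt one_ne_zero fun k _ => ?_
    rw [map_mul]
    exact mul_lt_one_of_lt_of_le ((hj _).2 (by omega))
      ((O.valuation_le_one_iff _).mpr (pow_mem hx _))

/-- By `exists_mul_mem_conjInf`, `O` is the localization of the integral closure at the centre of
`O`, so preserving this centre is enough. -/
theorem mem_decomposition_of_conjInf [Algebra.IsAlgebraic K Ω] {ρ : Ω ≃ₐ[K] Ω}
    (h : ∀ b ∈ conjInf K O, O.valuation (ρ b) < 1 ↔ O.valuation b < 1) :
    ρ ∈ O.decompositionSubgroup K := by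
  have key : ∀ τ : Ω ≃ₐ[K] Ω, (∀ b ∈ conjInf K O, O.valuation (τ b) < 1 ↔ O.valuation b < 1) →
      ∀ x ∈ O, τ x ∈ O := by
    intro τ hτ x hx
    obtain ⟨b, hb, hbx, hb1⟩ := exists_mul_mem_conjInf (K := K) hx
    have h1 : O.valuation b = 1 := by
      have := O.valuation.map_one_add_of_lt hb1
      rwa [add_sub_cancel] at this
    have h2 : O.valuation (τ b) = 1 := by
      refine le_antisymm ((O.valuation_le_one_iff _).mpr (hb τ)) (not_lt.mp fun h' => ?_)
      rw [hτ b hb, h1] at h'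
      exact lt_irrefl _ h'
    have h3 := (O.valuation_le_one_iff _).mpr (hbx τ)
    rw [map_mul, map_mul, h2, one_mul] at h3
    exact (O.valuation_le_one_iff _).mp h3
  have hinv : ∀ b ∈ conjInf K O, O.valuation (ρ⁻¹ b) < 1 ↔ O.valuation b < 1 := by
    intro b hb
    rw [← h _ (apply_mem_conjInf ρ⁻¹ b hb)]
    change O.valuation (ρ (ρ.symm b)) < 1 ↔ _
    rw [AlgEquiv.apply_symm_apply]
  rw [mem_decomposition_iff]
  refine fun x => ⟨fun hx => ?_, key ρ h x⟩
  have := key ρ⁻¹ hinv _ hx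
  change ρ.symm (ρ x) ∈ O at this
  rwa [AlgEquiv.symm_apply_apply] at this

/-- An automorphism of `Ω` preserving `O` and acting trivially on the residue field of `K`
has the same action on the residue field of `Ω` as some element of the decomposition group
over `K`. -/
theorem exists_decomposition_lift [IsGalois K Ω] {g : Ω ≃+* Ω} (hg : ∀ x, g x ∈ O ↔ x ∈ O)
    (hgK : ∀ a : K, algebraMap K Ω a ∈ O →
      O.valuation (g (algebraMap K Ω a) - algebraMap K Ω a) < 1) :
    ∃ ρ ∈ O.decompositionSubgroup K, ∀ x ∈ O, O.valuation (ρ x - g x) < 1 := by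
  let φ : conjInf K O →+* ResidueField O :=
    (residue O).comp ((conjInf K O).subtype.codRestrict O.toSubring
      fun x => mem_of_mem_conjInf x.2)
  have hres : ∀ x y : O, residue O x = residue O y ↔ O.valuation ((x : Ω) - y) < 1 := by
    intro x y
    rw [← sub_eq_zero, ← map_sub, residue_eq_zero_iff, ValuationSubring.valuation_lt_one_iff]
    rfl
  have hφx : ∀ b : conjInf K O, φ b = residue O ⟨b, mem_of_mem_conjInf b.2⟩ := fun _ => rfl
  have hφ : Function.Surjective φ := by
    intro y
    obtain ⟨⟨x, hx⟩, rfl⟩ := residue_surjective y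
    obtain ⟨b, hb, hbx, hb1⟩ := exists_mul_mem_conjInf (K := K) hx
    refine ⟨⟨_, hbx⟩, ?_⟩
    rw [hφx, hres]
    have h1 : b * x - x = (b - 1) * x := by ring
    change O.valuation (b * x - x) < 1
    rw [h1, map_mul]
    exact mul_lt_one_of_lt_of_le hb1 ((O.valuation_le_one_iff _).mpr hx)
  let gO : O ≃+* O :=
    { toFun := fun x => ⟨g x, (hg x).mpr x.2⟩
      invFun := fun x => ⟨g.symm x, (hg _).mp (by rw [g.apply_symm_apply]; exact x.2)⟩
      left_inv := fun x => Subtype.ext (g.symm_apply_apply _)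
      right_inv := fun x => Subtype.ext (g.apply_symm_apply _)
      map_mul' := fun x y => Subtype.ext (map_mul g _ _)
      map_add' := fun x y => Subtype.ext (map_add g _ _) }
  let gΛ := ResidueField.mapEquiv gO
  have hgΛ : ∀ x : O, gΛ (residue O x) = residue O (gO x) := fun x => rfl
  obtain ⟨ρ, hρ⟩ := stable_exists_lift (conjInf K O) apply_mem_conjInf φ hφ gΛ (by
    intro a ha
    rw [hφx, hgΛ, hres]
    exact hgK a (mem_of_mem_conjInf ha))
  have hρ' : ∀ b ∈ conjInf K O, O.valuation (ρ b - g b) < 1 := by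
    intro b hb
    have := hρ ⟨b, hb⟩
    rw [hφx, hφx, hgΛ, hres] at this
    exact this
  have hD : ρ ∈ O.decompositionSubgroup K := by
    refine mem_decomposition_of_conjInf fun b hb => ?_
    rw [← valuation_lt_one_of_preserves hg b]
    have h1 := hρ' b hb
    constructor
    · intro h
      have := O.valuation.map_sub_lt h h1
      rwa [sub_sub_cancel] at this
    · intro h
      have := O.valuation.map_add_lt h1 h
      rwa [sub_add_cancel] at this
  refine ⟨ρ, hD, fun x hx => ?_⟩
  obtain ⟨b, hb, hbx, hb1⟩ := exists_mul_mem_conjInf (K := K) hx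
  have hx1 : O.valuation (b * x - x) < 1 := by
    have h1 : b * x - x = (b - 1) * x := by ring
    rw [h1, map_mul]
    exact mul_lt_one_of_lt_of_le hb1 ((O.valuation_le_one_iff _).mpr hx)
  have h2 := (valuation_lt_one_of_mem_decomposition hD _).mpr hx1
  have h3 := (valuation_lt_one_of_preserves hg _).mpr hx1
  rw [map_sub] at h2 h3
  have h4 := O.valuation.map_add_lt (O.valuation.map_sub_lt h3 h2) (hρ' _ hbx)
  convert h4 using 2
  ring

/-- For `Y` finite over `K` and fixed by the decomposition group, there is an element of `Y`
congruent to `1` all whose other conjugates are in the maximal ideal. -/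
theorem exists_congr_one [IsGalois K Ω] (Y : IntermediateField K Ω) [FiniteDimensional K Y]
    (hY : Y ≤ IntermediateField.fixedField (O.decompositionSubgroup K)) :
    ∃ e ∈ Y, e ∈ conjInf K O ∧ O.valuation (e - 1) < 1 ∧
      ∀ τ : Ω ≃ₐ[K] Ω, (∃ y ∈ Y, τ y ≠ y) → O.valuation (τ e) < 1 := by
  classical
  let B := conjInf K O
  let R : Subring Ω := B ⊓ Y.toSubalgebra.toSubring
  let A : Subring K := B.comap (algebraMap K Ω)
  let q : (Ω ≃ₐ[K] Ω) → Ideal B := fun τ =>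
    { carrier := {b | O.valuation (τ b) < 1}
      zero_mem' := by simp
      add_mem' := fun {a b} ha hb => by
        change O.valuation (τ ((a : Ω) + b)) < 1
        rw [map_add]
        exact O.valuation.map_add_lt ha hb
      smul_mem' := fun c b hb => by
        change O.valuation (τ ((c : Ω) * b)) < 1
        rw [map_mul, map_mul]
        exact mul_lt_one_of_nonneg_of_lt_one_right ((O.valuation_le_one_iff _).mpr (c.2 τ))
          zero_le hb }
  have hq : ∀ τ (b : B), b ∈ q τ ↔ O.valuation (τ b) < 1 := fun _ _ => Iff.rfl
  have hprime : ∀ τ, (q τ).IsPrime := by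
    intro τ
    constructor
    · intro h
      have := (hq τ 1).mp (h ▸ Submodule.mem_top)
      simp at this
    · intro a b hab
      rw [hq] at hab
      by_contra hcon
      rw [not_or, hq, hq, not_lt, not_lt] at hcon
      have : O.valuation (τ ((a * b : B) : Ω)) = O.valuation (τ a) * O.valuation (τ b) := by
        change O.valuation (τ ((a : Ω) * b)) = _
        rw [map_mul, map_mul]
      rw [this] at hab
      exact absurd (one_le_mul hcon.1 hcon.2) (not_le.mpr hab)
  let ι : R →+* B := Subring.inclusion inf_le_left
  let r : (Ω ≃ₐ[K] Ω) → Ideal R := fun τ => (q τ).comap ι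
  have hr : ∀ τ (b : R), b ∈ r τ ↔ O.valuation (τ b) < 1 := fun _ _ => Iff.rfl
  -- The ring `R` is integral over the valuation ring `A` of K, and the primes `r τ` contract to the
  -- maximal ideal of `A`.
  have hmax : ∀ τ, (r τ).IsMaximal := by
    intro τ
    let _ : Algebra A R :=
      ((algebraMap K Ω).restrict A R fun a ha => Subring.mem_inf.mpr ⟨ha, Y.algebraMap_mem a⟩).toAlgebra
    let _ := stableAction (K := K) B apply_mem_conjInf
    let _ := stableAlgebra K B
    let _ : TopologicalSpace B := ⊥
    have : DiscreteTopology B := ⟨rfl⟩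
    have := stable_continuousSMul (K := K) B apply_mem_conjInf
    have := stable_isInvariant (K := K) B apply_mem_conjInf
    have := stable_smulCommClass (K := K) B apply_mem_conjInf
    have hint : Algebra.IsIntegral A B := Algebra.IsInvariant.isIntegral_of_profinite (G := Ω ≃ₐ[K] Ω)
    have hint' : Algebra.IsIntegral A R := by
      constructor
      intro x
      have h1 := hint.isIntegral (ι x)
      let f : R →ₐ[A] B := { ι with commutes' := fun _ => rfl }
      exact (isIntegral_algHom_iff f
        fun a b hab => Subtype.ext (congrArg (fun z : B => (z : Ω)) hab)).mp h1
    have := hprime τ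
    have hp : (r τ).IsPrime := Ideal.comap_isPrime ι (q τ)
    refine Ideal.isMaximal_of_isIntegral_of_isMaximal_comap (R := A) (r τ) ?_
    have hmem : ∀ a : A, a ∈ (r τ).comap (algebraMap A R) ↔
        O.valuation (algebraMap K Ω a) < 1 := by
      intro a
      rw [Ideal.mem_comap, hr]
      change O.valuation (τ (algebraMap K Ω a)) < 1 ↔ _
      rw [AlgEquiv.commutes]
    rw [Ideal.isMaximal_iff]
    refine ⟨?_, ?_⟩
    · rw [hmem]
      simp
    · intro J a hJ ha haJ
      rw [hmem, not_lt] at ha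
      have ha0 : algebraMap K Ω (a : K) ≠ 0 := by
        intro h0
        rw [h0, map_zero] at ha
        exact absurd ha (by simp)
      have hinv : (a : K)⁻¹ ∈ A := by
        change algebraMap K Ω (a : K)⁻¹ ∈ conjInf K O
        rw [algebraMap_mem_conjInf, ← ValuationSubring.valuation_le_one_iff, map_inv₀, map_inv₀]
        exact inv_le_one_of_one_le₀ ha
      have : (1 : A) = ⟨_, hinv⟩ * a := by
        apply Subtype.ext
        change (1 : K) = (a : K)⁻¹ * a
        rw [inv_mul_cancel₀]
        intro h0
        exact ha0 (by rw [h0, map_zero])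
      rw [this]
      exact J.mul_mem_left _ haJ
  -- If the two primes of `R` agreed, transitivity of Gal(Ω/Y) on the primes of `B` would give ρ
  -- fixing Y with τρ in D. Both ρ and D fix Y, hence so would τ.
  have hne : ∀ τ : Ω ≃ₐ[K] Ω, (∃ y ∈ Y, τ y ≠ y) → r τ ≠ r 1 := by
    rintro τ ⟨y, hy, hτy⟩ heq
    have := hprime τ
    have := hprime 1
    obtain ⟨ρ, hρ⟩ := stable_exists_smul (K := Y) B
      (fun σ x hx => apply_mem_conjInf (σ.restrictScalars K) x hx) (q 1) (q τ) (by
        intro a ha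
        have haR : (a : Ω) ∈ R := ⟨ha, a.2⟩
        have h1 : (⟨a, haR⟩ : R) ∈ r 1 ↔ (⟨a, haR⟩ : R) ∈ r τ := by rw [heq]
        exact h1)
    let ρ' : Ω ≃ₐ[K] Ω := ρ.restrictScalars K
    have hD : τ * ρ' ∈ O.decompositionSubgroup K := by
      refine mem_decomposition_of_conjInf fun b hb => ?_
      have := hρ ⟨b, hb⟩
      rw [hq, hq] at this
      exact this.symm
    have h1 := hY hy ⟨_, hD⟩
    have h2 : ρ y = y := ρ.commutes ⟨y, hy⟩
    apply hτy
    have h3 : τ (ρ y) = y := h1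
    rwa [h2] at h3
  have hex : ∀ τ : Ω ≃ₐ[K] Ω, ∃ e : R, e - 1 ∈ r 1 ∧ ((∃ y ∈ Y, τ y ≠ y) → e ∈ r τ) := by
    intro τ
    by_cases h : ∃ y ∈ Y, τ y ≠ y
    · have h1 := hmax τ
      have h2 := hmax 1
      have := Ideal.isCoprime_of_isMaximal (hne τ h)
      obtain ⟨a, ha, b, hb, hab⟩ := Ideal.isCoprime_iff_exists.mp this
      refine ⟨a, ?_, fun _ => ha⟩
      have : a - 1 = -b := by rw [← hab]; ring
      rw [this]
      exact neg_mem hb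
    · exact ⟨1, by simp, fun h' => absurd h' h⟩
  choose ε hε1 hε2 using hex
  have hfin : Finite (Y →ₐ[K] Ω) := inferInstance
  have : Fintype (Y →ₐ[K] Ω) := Fintype.ofFinite _
  have : Normal K Ω := inferInstance
  have hlift : ∀ f : Y →ₐ[K] Ω, ∃ τ : Ω ≃ₐ[K] Ω, ∀ y : Y, τ y = f y := by
    intro f
    refine ⟨AlgEquiv.ofBijective (f.liftNormal Ω) (AlgHom.normal_bijective K Ω Ω _), fun y => ?_⟩
    exact f.liftNormal_commutes Ω y
  choose lift hlift using hlift
  -- Comaximality gives an element for each embedding of Y; the finite product satisfies all the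
  -- conditions together.
  let e : R := ∏ f : Y →ₐ[K] Ω, ε (lift f)
  refine ⟨e, e.2.2, e.2.1, ?_, ?_⟩
  · have h1 : Ideal.Quotient.mk (r 1) e = 1 := by
      rw [map_prod]
      refine Finset.prod_eq_one fun f _ => ?_
      rw [← map_one (Ideal.Quotient.mk (r 1)), Ideal.Quotient.eq]
      exact hε1 _
    rw [← map_one (Ideal.Quotient.mk (r 1)), Ideal.Quotient.eq] at h1
    exact h1
  · rintro τ ⟨y, hy, hτy⟩
    let f : Y →ₐ[K] Ω := τ.toAlgHom.comp Y.val
    have hf : ∀ y ∈ Y, lift f y = τ y := fun y hy => hlift f ⟨y, hy⟩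
    have h1 : ε (lift f) ∈ r (lift f) := hε2 _ ⟨y, hy, by rwa [hf y hy]⟩
    have h2 : e ∈ r (lift f) := by
      obtain ⟨d, hd⟩ := Finset.dvd_prod_of_mem (fun f => ε (lift f)) (Finset.mem_univ f)
      change (∏ f : Y →ₐ[K] Ω, ε (lift f)) ∈ _
      rw [hd]
      exact Ideal.mul_mem_right _ _ h1
    rw [hr, hf _ e.2.2] at h2
    exact h2

end Conjugates

/-! ### Roots in valuation rings -/

/-- Uniqueness in Hensel's lemma: f(β) = f(α) + (β - α)(f'(α) + k(β - α)), and the last factor is a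
unit because f'(α) is congruent to f'(a). -/
theorem eq_of_isRoot_of_congr {R : Type u} [CommRing R] [IsLocalRing R]
    {f : R[X]} {a α β : R} (ha : IsUnit (f.derivative.eval a)) (hα : f.IsRoot α) (hβ : f.IsRoot β)
    (h1 : α - a ∈ maximalIdeal R) (h2 : β - α ∈ maximalIdeal R) : α = β := by
  obtain ⟨k, hk⟩ := f.binomExpansion α (β - α)
  rw [add_sub_cancel, hα.eq_zero, hβ.eq_zero, zero_add] at hk
  have hu : IsUnit (f.derivative.eval α) := by
    obtain ⟨c, hc⟩ := Polynomial.sub_dvd_eval_sub α a f.derivative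
    have : f.derivative.eval α = f.derivative.eval a + (α - a) * c := by rw [← hc]; ring
    rw [this]
    by_contra hcon
    have h3 : f.derivative.eval a ∈ maximalIdeal R := by
      have := sub_mem ((mem_maximalIdeal _).mpr hcon) (Ideal.mul_mem_right c _ h1)
      rwa [add_sub_cancel_right] at this
    exact (mem_maximalIdeal _).mp h3 ha
  have hu' : IsUnit (f.derivative.eval α + k * (β - α)) := by
    by_contra hcon
    have h3 : f.derivative.eval α ∈ maximalIdeal R := by
      have := sub_mem ((mem_maximalIdeal _).mpr hcon) (Ideal.mul_mem_left _ k h2)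
      rwa [add_sub_cancel_right] at this
    exact (mem_maximalIdeal _).mp h3 hu
  have h0 : (f.derivative.eval α + k * (β - α)) * (β - α) = 0 := by
    rw [hk]; ring
  have := hu'.mul_right_eq_zero.mp h0
  exact (sub_eq_zero.mp this).symm

section Roots

variable {Ω : Type v} [Field Ω] {O : ValuationSubring Ω}

theorem valuation_multiset_prod_eq_one {s : Multiset Ω} (h : ∀ x ∈ s, O.valuation x = 1) :
    O.valuation s.prod = 1 := by
  rw [map_multiset_prod]
  refine Multiset.prod_eq_one fun x hx => ?_
  obtain ⟨y, hy, rfl⟩ := Multiset.mem_map.mp hx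
  exact h y hy

theorem exists_valuation_lt_of_prod_lt {s : Multiset Ω} {γ : O.ValueGroup}
    (h : O.valuation s.prod < γ ^ s.card) : ∃ x ∈ s, O.valuation x < γ := by
  by_contra! hcon
  refine absurd h (not_lt.mpr ?_)
  clear h
  induction s using Multiset.induction_on with
  | empty => simp
  | cons a s ih =>
    rw [Multiset.prod_cons, map_mul, Multiset.card_cons, pow_succ, mul_comm]
    exact mul_le_mul' (hcon a (Multiset.mem_cons_self a s))
      (ih fun x hx => hcon x (Multiset.mem_cons_of_mem hx))

theorem mem_of_isRoot_monic {f : O[X]} (hf : f.Monic) {α : Ω}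
    (h : (f.map O.subtype).eval α = 0) : α ∈ O := by
  have h1 : IsIntegral O α := ⟨f, hf, by rw [Polynomial.eval_map] at h; exact h⟩
  obtain ⟨y, rfl⟩ := (IsIntegrallyClosed.isIntegral_iff (R := O) (K := Ω)).mp h1
  exact y.2

/-- The value f(a) is the product of the differences a - α over the roots α of f; as it is a
non-unit, some factor is. The roots are in `O` because `O` is integrally closed. -/
theorem exists_isRoot_congr [IsAlgClosed Ω] {f : O[X]} (hf : f.Monic) (a : O)
    (ha : f.eval a ∈ maximalIdeal O) : ∃ α : O, f.IsRoot α ∧ α - a ∈ maximalIdeal O := by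
  have hmon : (f.map O.subtype).Monic := hf.map _
  have h1 : (f.map O.subtype).eval (a : Ω) = (f.eval a : O) := by
    rw [Polynomial.eval_map]
    exact Polynomial.eval₂_at_apply O.subtype a
  rw [(IsAlgClosed.splits _).eval_eq_prod_roots_of_monic hmon] at h1
  have h2 : O.valuation (f.eval a : O) < 1 := (O.valuation_lt_one_iff _).mp ha
  rw [← h1, ← one_pow (Multiset.card _)] at h2
  obtain ⟨y, hy, hlt⟩ := exists_valuation_lt_of_prod_lt h2
  obtain ⟨α, hα, rfl⟩ := Multiset.mem_map.mp hy
  have hα' := (Polynomial.mem_roots hmon.ne_zero).mp hα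
  have hαO : α ∈ O := mem_of_isRoot_monic hf hα'
  refine ⟨⟨α, hαO⟩, ?_, ?_⟩
  · have h3 := Polynomial.eval₂_at_apply (p := f) O.subtype ⟨α, hαO⟩
    rw [← Polynomial.eval_map] at h3
    exact Subtype.ext (h3.symm.trans hα')
  · rw [ValuationSubring.valuation_lt_one_iff]
    change O.valuation (α - a) < 1
    rwa [← O.valuation.map_neg, neg_sub]

end Roots

/-! ### Henselization and strict henselization -/

section Henselization

variable {K : Type u} {Ω : Type v} [Field K] [Field Ω] [Algebra K Ω] {O : ValuationSubring Ω}

variable (K O) in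
/-- The inclusion of the valuation ring of `K` into `O`. -/
def comapHom : O.comap (algebraMap K Ω) →+* O :=
  (algebraMap K Ω).restrict (O.comap (algebraMap K Ω)) O fun _ h => h

theorem coe_comapHom (a : O.comap (algebraMap K Ω)) :
    (comapHom K O a : Ω) = algebraMap K Ω (a : K) := rfl

theorem mem_maximalIdeal_comap {a : O.comap (algebraMap K Ω)} :
    a ∈ maximalIdeal (O.comap (algebraMap K Ω)) ↔ O.valuation (algebraMap K Ω (a : K)) < 1 := by
  rw [← ValuationSubring.coe_mem_nonunits_iff, ValuationSubring.mem_nonunits_iff_or,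
    ← ValuationSubring.mem_nonunits_iff, ValuationSubring.mem_nonunits_iff_or, ← map_inv₀,
    map_eq_zero]
  rfl

instance isLocalHom_comapHom : IsLocalHom (comapHom K O) := by
  refine ⟨fun a ha => ?_⟩
  by_contra hcon
  have h1 := mem_maximalIdeal_comap.mp ((mem_maximalIdeal _).mpr hcon)
  have h2 := (O.valuation_eq_one_iff (comapHom K O a)).mp ha
  rw [coe_comapHom] at h2
  exact absurd h2 h1.ne

theorem isRoot_comapHom {F : (O.comap (algebraMap K Ω))[X]} {α : O} :
    (F.map (comapHom K O)).IsRoot α ↔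
      ((F.map (O.comap (algebraMap K Ω)).subtype).map (algebraMap K Ω)).eval (α : Ω) = 0 := by
  have h : ((F.map (O.comap (algebraMap K Ω)).subtype).map (algebraMap K Ω)) =
      (F.map (comapHom K O)).map O.subtype := by
    rw [Polynomial.map_map, Polynomial.map_map]
    rfl
  rw [h, Polynomial.IsRoot, show (α : Ω) = O.subtype α from rfl, Polynomial.eval_map O.subtype,
    Polynomial.eval₂_at_apply, map_eq_zero_iff _ O.subtype_injective]

theorem isRoot_apply_comapHom {F : (O.comap (algebraMap K Ω))[X]} {α β : O} {σ : Ω ≃ₐ[K] Ω}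
    (hα : (F.map (comapHom K O)).IsRoot α) (hβ : (β : Ω) = σ α) :
    (F.map (comapHom K O)).IsRoot β := by
  rw [isRoot_comapHom] at hα ⊢
  rw [hβ, Polynomial.eval_map, ← Polynomial.aeval_def]
  change Polynomial.aeval (σ.toAlgHom (α : Ω)) _ = 0
  rw [Polynomial.aeval_algHom_apply, Polynomial.aeval_def, ← Polynomial.eval_map, hα, map_zero]

/-- The coefficients are polynomials in the conjugates of `e`, which all lie in `O`. -/
theorem exists_lift_minpoly [IsGalois K Ω] {e : Ω} (he : e ∈ conjInf K O) :
    ∃ F : (O.comap (algebraMap K Ω))[X], F.Monic ∧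
      F.map (O.comap (algebraMap K Ω)).subtype = minpoly K e := by
  have hint : IsIntegral K e := Algebra.IsIntegral.isIntegral e
  have hsplit : ((minpoly K e).map (algebraMap K Ω)).Splits := Normal.splits inferInstance e
  have hmon := minpoly.monic hint
  have h1 : (minpoly K e).map (algebraMap K Ω) ∈ Polynomial.lifts O.subtype := by
    refine hsplit.mem_lift_of_roots_mem_range (hmon.map _) O.subtype fun α hα => ?_
    have hα' : Polynomial.aeval α (minpoly K e) = 0 := by
      rw [Polynomial.aeval_def, ← Polynomial.eval_map]
      exact (Polynomial.mem_roots (hmon.map _).ne_zero).mp hα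
    have hconj : IsConjRoot K α e :=
      (isConjRoot_of_aeval_eq_zero hint hα').symm
    obtain ⟨σ, rfl⟩ := isConjRoot_iff_exists_algEquiv.mp hconj
    exact ⟨⟨_, he σ⟩, rfl⟩
  have h2 : minpoly K e ∈ Polynomial.lifts (O.comap (algebraMap K Ω)).subtype := by
    rw [Polynomial.lifts_iff_coeff_lifts] at h1 ⊢
    intro n
    obtain ⟨y, hy⟩ := h1 n
    rw [Polynomial.coeff_map] at hy
    refine ⟨⟨(minpoly K e).coeff n, ?_⟩, rfl⟩
    change algebraMap K Ω _ ∈ O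
    rw [← hy]
    exact y.2
  obtain ⟨F, hF, -, hFm⟩ := Polynomial.lifts_and_natDegree_eq_and_monic h2 hmon
  exact ⟨F, hFm, hF⟩

/-- If the valuation ring of `K` is henselian, the decomposition group has no fixed elements
outside `K`. -/
theorem fixedField_decomposition_eq_bot [IsGalois K Ω]
    (hH : HenselianLocalRing (O.comap (algebraMap K Ω))) :
    IntermediateField.fixedField (O.decompositionSubgroup K) = ⊥ := by
  classical
  rw [eq_bot_iff]
  intro z hz
  let Y := IntermediateField.adjoin K {z}
  have hYfin : FiniteDimensional K Y :=
    IntermediateField.adjoin.finiteDimensional (Algebra.IsIntegral.isIntegral z)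
  have hY : Y ≤ IntermediateField.fixedField (O.decompositionSubgroup K) := by
    rw [IntermediateField.adjoin_le_iff, Set.singleton_subset_iff]
    exact hz
  obtain ⟨e, heY, he, he1, hτ⟩ := exists_congr_one Y hY
  obtain ⟨F, hFm, hF⟩ := exists_lift_minpoly he
  have hint : IsIntegral K e := Algebra.IsIntegral.isIntegral e
  have hev : O.valuation e = 1 := by
    have := O.valuation.map_one_add_of_lt he1
    rwa [add_sub_cancel] at this
  let eO : O := ⟨e, mem_of_mem_conjInf he⟩
  let FO := F.map (comapHom K O)
  have hroot : FO.IsRoot eO := by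
    rw [isRoot_comapHom, hF, Polynomial.eval_map, ← Polynomial.aeval_def]
    exact minpoly.aeval K e
  have he1' : 1 - eO ∈ maximalIdeal O := by
    rw [ValuationSubring.valuation_lt_one_iff]
    change O.valuation (1 - e) < 1
    rwa [← O.valuation.map_neg, neg_sub]
  have hmapeq : FO.map O.subtype = (minpoly K e).map (algebraMap K Ω) := by
    rw [← hF, Polynomial.map_map, Polynomial.map_map]
    rfl
  have h1 : FO.eval 1 ∈ maximalIdeal O := by
    obtain ⟨c, hc⟩ := Polynomial.sub_dvd_eval_sub 1 eO FO
    rw [hroot.eq_zero, sub_zero] at hc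
    rw [hc]
    exact Ideal.mul_mem_right _ _ he1'
  -- The derivative at `e` is the product of e - α over the other conjugates α. Each such α is a
  -- conjugate moved away from `e`, so lies in the maximal ideal, while `e` is a unit.
  have h2 : IsUnit (FO.derivative.eval eO) := by
    rw [ValuationSubring.valuation_eq_one_iff]
    have hsplit : ((minpoly K e).map (algebraMap K Ω)).Splits := Normal.splits inferInstance e
    have hmon := (minpoly.monic hint).map (algebraMap K Ω)
    have hemem : e ∈ ((minpoly K e).map (algebraMap K Ω)).roots := by
      rw [Polynomial.mem_roots hmon.ne_zero, Polynomial.IsRoot, Polynomial.eval_map,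
        ← Polynomial.aeval_def]
      exact minpoly.aeval K e
    have h3 : ((FO.derivative.eval eO : O) : Ω) =
        ((minpoly K e).map (algebraMap K Ω)).derivative.eval e := by
      rw [← hmapeq, Polynomial.derivative_map _ O.subtype, Polynomial.eval_map O.subtype]
      exact (Polynomial.eval₂_at_apply O.subtype eO).symm
    rw [h3, hsplit.eval_root_derivative hmon hemem]
    refine valuation_multiset_prod_eq_one fun y hy => ?_
    obtain ⟨α, hα, rfl⟩ := Multiset.mem_map.mp hy
    have hsep : ((minpoly K e).map (algebraMap K Ω)).Separable :=
      Polynomial.Separable.map (Algebra.IsSeparable.isSeparable K e)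
    have hnodup := Polynomial.nodup_roots hsep
    obtain ⟨hne, hα'⟩ := hnodup.mem_erase_iff.mp hα
    have hα'' : Polynomial.aeval α (minpoly K e) = 0 := by
      rw [Polynomial.aeval_def, ← Polynomial.eval_map]
      exact (Polynomial.mem_roots hmon.ne_zero).mp hα'
    obtain ⟨σ, rfl⟩ := isConjRoot_iff_exists_algEquiv.mp (isConjRoot_of_aeval_eq_zero hint hα'').symm
    have := hτ σ ⟨e, heY, hne⟩
    rw [← hev]
    exact O.valuation.map_sub_eq_of_lt_left (by rwa [hev])
  have h2' : IsUnit (FO.derivative.eval 1) := by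
    obtain ⟨c, hc⟩ := Polynomial.sub_dvd_eval_sub 1 eO FO.derivative
    by_contra hcon
    have h3 := sub_mem ((mem_maximalIdeal _).mpr hcon) (Ideal.mul_mem_right c _ he1')
    rw [← hc, sub_sub_cancel] at h3
    exact (mem_maximalIdeal _).mp h3 h2
  have hFO1 : FO.eval 1 = comapHom K O (F.eval 1) := by
    rw [← map_one (comapHom K O), Polynomial.eval_map, Polynomial.eval₂_at_apply]
  have hFO2 : FO.derivative.eval 1 = comapHom K O (F.derivative.eval 1) := by
    rw [Polynomial.derivative_map, ← map_one (comapHom K O), Polynomial.eval_map,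
      Polynomial.eval₂_at_apply]
  -- Modulo the maximal ideal, 1 is a simple root, so the irreducible minimal polynomial of `e` has
  -- a root in K and `e` is in K. An automorphism moving `z` would send `e` into the maximal ideal,
  -- yet it fixes `e`.
  obtain ⟨a, ha, -⟩ := hH.is_henselian F hFm 1 (by
      rw [mem_maximalIdeal_comap, ← coe_comapHom, ← hFO1, ← ValuationSubring.valuation_lt_one_iff]
      exact h1) (by
      rw [hFO2] at h2'
      exact isUnit_of_map_unit (comapHom K O) _ h2')
  have hdeg : (minpoly K e).degree = 1 := by
    refine Polynomial.degree_eq_one_of_irreducible_of_root (minpoly.irreducible hint)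
      (x := (a : K)) ?_
    rw [← hF, Polynomial.IsRoot, Polynomial.eval_map,
      show (a : K) = (O.comap (algebraMap K Ω)).subtype a from rfl, Polynomial.eval₂_at_apply,
      ha.eq_zero, map_zero]
  obtain ⟨c, hc⟩ := minpoly.mem_range_of_degree_eq_one K e hdeg
  rw [InfiniteGalois.mem_bot_iff_fixed]
  intro τ
  by_contra hne
  have h5 := hτ τ ⟨z, IntermediateField.mem_adjoin_simple_self K z, hne⟩
  rw [← hc, AlgEquiv.commutes, hc, hev] at h5
  exact lt_irrefl _ h5

/-- If the valuation ring of `K` is henselian with separably closed residue field, the inertia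
group has no fixed elements outside `K`. -/
theorem fixedField_inertia_eq_bot [IsGalois K Ω]
    (hH : HenselianLocalRing (O.comap (algebraMap K Ω)))
    (hS : IsSepClosed (ResidueField (O.comap (algebraMap K Ω)))) :
    IntermediateField.fixedField (inertia K O) = ⊥ := by
  -- The residue field of Ω is algebraic over a separably closed field, hence purely inseparable
  -- over it, so D acts trivially on it.
  have hDI : inertia K O = O.decompositionSubgroup K := by
    refine le_antisymm (fun σ hσ => hσ.1) fun σ hσ => ⟨hσ, fun x hx => ?_⟩
    let _ : Algebra (ResidueField (O.comap (algebraMap K Ω))) (ResidueField O) :=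
      (ResidueField.map (comapHom K O)).toAlgebra
    have halg : ∀ b (hb : b ∈ conjInf K O),
        IsIntegral (ResidueField (O.comap (algebraMap K Ω)))
          (residue O ⟨b, mem_of_mem_conjInf hb⟩) := by
      intro b hb
      obtain ⟨F, hFm, hF⟩ := exists_lift_minpoly hb
      refine ⟨F.map (residue _), hFm.map _, ?_⟩
      have hr : (F.map (comapHom K O)).IsRoot ⟨b, mem_of_mem_conjInf hb⟩ := by
        rw [isRoot_comapHom, hF, Polynomial.eval_map, ← Polynomial.aeval_def]
        exact minpoly.aeval K b
      rw [Polynomial.eval₂_map]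
      change F.eval₂ ((residue O).comp (comapHom K O)) _ = 0
      rw [← Polynomial.hom_eval₂, ← Polynomial.eval_map, hr.eq_zero, map_zero]
    have hAlg : Algebra.IsAlgebraic (ResidueField (O.comap (algebraMap K Ω))) (ResidueField O) := by
      constructor
      intro y
      obtain ⟨⟨x, hx⟩, rfl⟩ := residue_surjective y
      obtain ⟨b, hb, hbx, hb1⟩ := exists_mul_mem_conjInf (K := K) hx
      have h1 : residue O ⟨x, hx⟩ = residue O ⟨b * x, mem_of_mem_conjInf hbx⟩ := by
        rw [← sub_eq_zero, ← map_sub, residue_eq_zero_iff, ValuationSubring.valuation_lt_one_iff]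
        change O.valuation (x - b * x) < 1
        rw [show x - b * x = -((b - 1) * x) by ring, O.valuation.map_neg, map_mul]
        exact mul_lt_one_of_lt_of_le hb1 ((O.valuation_le_one_iff _).mpr hx)
      rw [h1]
      exact (halg _ hbx).isAlgebraic
    let q := ringExpChar (ResidueField (O.comap (algebraMap K Ω)))
    have : ExpChar (ResidueField O) q :=
      expChar_of_injective_algebraMap
        (algebraMap (ResidueField (O.comap (algebraMap K Ω))) (ResidueField O)).injective q
    obtain ⟨n, y, hy⟩ := IsPurelyInseparable.pow_mem (ResidueField (O.comap (algebraMap K Ω))) q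
      (residue O ⟨x, hx⟩)
    obtain ⟨a, rfl⟩ := residue_surjective y
    have hσx : σ x ∈ O := (mem_decomposition_iff.mp hσ x).mpr hx
    have h3 : O.valuation (x ^ q ^ n - algebraMap K Ω a) < 1 := by
      have : residue O (⟨x, hx⟩ ^ q ^ n - comapHom K O a) = 0 := by
        rw [map_sub, map_pow, ← hy, sub_eq_zero]
        rfl
      rw [residue_eq_zero_iff, ValuationSubring.valuation_lt_one_iff] at this
      exact this
    have h4 := (valuation_lt_one_of_mem_decomposition hσ _).mpr h3
    rw [map_sub, AlgEquiv.commutes, map_pow] at h4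
    have h5 := O.valuation.map_sub_lt h4 h3
    rw [sub_sub_sub_cancel_right] at h5
    have h6 : residue O ⟨σ x, hσx⟩ ^ q ^ n = residue O ⟨x, hx⟩ ^ q ^ n := by
      rw [← map_pow, ← map_pow, ← sub_eq_zero, ← map_sub, residue_eq_zero_iff,
        ValuationSubring.valuation_lt_one_iff]
      exact h5
    have h7 := iterateFrobenius_inj (ResidueField O) q n h6
    rw [← sub_eq_zero, ← map_sub, residue_eq_zero_iff,
      ValuationSubring.valuation_lt_one_iff] at h7
    exact h7
  rw [hDI]
  exact fixedField_decomposition_eq_bot hH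

/-- A root in Ω congruent to `a` is unique among such roots. The group `H` permutes these roots,
since it preserves `O` and fixes `a`; hence it fixes the root. -/
theorem henselian_fixedField [IsAlgClosed Ω] (H : Subgroup (Ω ≃ₐ[K] Ω))
    (hH : H ≤ O.decompositionSubgroup K) :
    HenselianLocalRing (O.comap (algebraMap (IntermediateField.fixedField H) Ω)) := by
  let E := IntermediateField.fixedField H
  refine { is_henselian := fun f hf a h1 h2 => ?_ }
  have hev : ∀ g : (O.comap (algebraMap E Ω))[X],
      (g.map (comapHom E O)).eval (comapHom E O a) = comapHom E O (g.eval a) := by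
    intro g
    rw [Polynomial.eval_map, Polynomial.eval₂_at_apply]
  obtain ⟨α, hα, hαa⟩ := exists_isRoot_congr (hf.map (comapHom E O)) (comapHom E O a) (by
    rw [hev, ValuationSubring.valuation_lt_one_iff, coe_comapHom, ← mem_maximalIdeal_comap]
    exact h1)
  have hfix : ∀ σ : H, σ.1 (α : Ω) = α := by
    intro σ
    have hσ := hH σ.2
    have hσα : σ.1 (α : Ω) ∈ O := (mem_decomposition_iff.mp hσ _).mpr α.2
    let σ' : Ω ≃ₐ[E] Ω := IntermediateField.fixingSubgroupEquiv E
      ⟨σ.1, fun x => x.2 σ⟩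
    have h3 := isRoot_apply_comapHom (σ := σ') (β := ⟨_, hσα⟩) hα rfl
    have h4 : (⟨_, hσα⟩ : O) - comapHom E O a ∈ maximalIdeal O := by
      rw [ValuationSubring.valuation_lt_one_iff] at hαa ⊢
      have := (valuation_lt_one_of_mem_decomposition hσ _).mpr hαa
      rw [AddSubgroupClass.coe_sub, map_sub] at this
      rw [show σ.1 ((comapHom E O a : O) : Ω) = (comapHom E O a : Ω) from (a : E).2 σ] at this
      exact this
    have h5 := eq_of_isRoot_of_congr (f := f.map (comapHom E O)) (a := comapHom E O a)
      (by rw [Polynomial.derivative_map, hev]; exact h2.map _) hα h3 hαa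
      (by rw [← sub_sub_sub_cancel_right _ α (comapHom E O a)]; exact sub_mem h4 hαa)
    exact (congrArg Subtype.val h5).symm
  let αE : E := ⟨α, hfix⟩
  let αA : O.comap (algebraMap E Ω) := ⟨αE, α.2⟩
  have hαA : comapHom E O αA = α := rfl
  refine ⟨αA, ?_, ?_⟩
  · have hinj : Function.Injective (comapHom E O) := fun x y hxy =>
      Subtype.ext (Subtype.ext (congrArg (fun z : O => (z : Ω)) hxy))
    rw [← hαA, Polynomial.IsRoot, Polynomial.eval_map, Polynomial.eval₂_at_apply,
      map_eq_zero_iff _ hinj] at hα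
    exact hα
  · rw [mem_maximalIdeal_comap, ← coe_comapHom, map_sub, hαA,
      ← ValuationSubring.valuation_lt_one_iff]
    exact hαa

/-- Lift a separable polynomial and take a root of the lift in Ω. It is simple modulo the maximal
ideal, and inertia sends it to a congruent root, hence to itself. -/
theorem isSepClosed_residueField_fixedField_inertia [IsAlgClosed Ω] :
    IsSepClosed (ResidueField
      (O.comap (algebraMap (IntermediateField.fixedField (inertia K O)) Ω))) := by
  let E := IntermediateField.fixedField (inertia K O)
  let A := O.comap (algebraMap E Ω)
  refine IsSepClosed.of_exists_root _ fun p hpm hpi hps => ?_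
  obtain ⟨f, hf, hdeg, hfm⟩ := Polynomial.lifts_and_natDegree_eq_and_monic
    (Polynomial.mem_lifts_of_surjective (residue_surjective (R := A)) p) hpm
  let fO := f.map (comapHom E O)
  have hfO : fO.Monic := hfm.map _
  obtain ⟨α, hα⟩ := IsAlgClosed.exists_root (fO.map O.subtype) (by
    rw [Polynomial.degree_eq_natDegree (hfO.map _).ne_zero, hfO.natDegree_map, hfm.natDegree_map,
      hdeg]
    exact_mod_cast hpi.natDegree_pos.ne')
  have hαO : α ∈ O := mem_of_isRoot_monic hfO hα
  let αO : O := ⟨α, hαO⟩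
  have hroot : fO.IsRoot αO := by
    have h3 := Polynomial.eval₂_at_apply (p := fO) O.subtype αO
    rw [← Polynomial.eval_map] at h3
    exact Subtype.ext (h3.symm.trans hα)
  let _ : Algebra (ResidueField A) (ResidueField O) := (ResidueField.map (comapHom E O)).toAlgebra
  have haev : ∀ g : A[X], Polynomial.aeval (residue O αO) (g.map (residue A)) =
      residue O ((g.map (comapHom E O)).eval αO) := by
    intro g
    rw [Polynomial.aeval_def, Polynomial.eval₂_map, Polynomial.eval_map, Polynomial.hom_eval₂]
    rfl
  have hu : IsUnit (fO.derivative.eval αO) := by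
    have h1 : Polynomial.aeval (residue O αO) p = 0 := by
      rw [← hf, haev, hroot.eq_zero, map_zero]
    have h2 := hps.aeval_derivative_ne_zero h1
    rw [← hf, Polynomial.derivative_map, haev, ← Polynomial.derivative_map] at h2
    exact residue_ne_zero_iff_isUnit _ |>.mp h2
  have hfix : ∀ σ : inertia K O, σ.1 α = α := by
    intro σ
    have hσα : σ.1 α ∈ O := (mem_decomposition_iff.mp σ.2.1 _).mpr hαO
    let σ' : Ω ≃ₐ[E] Ω := IntermediateField.fixingSubgroupEquiv E
      ⟨σ.1, fun x => x.2 σ⟩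
    have h3 := isRoot_apply_comapHom (σ := σ') (β := ⟨_, hσα⟩) hroot rfl
    have h5 := eq_of_isRoot_of_congr (a := αO) hu hroot h3 (by rw [sub_self]; exact zero_mem _)
      (by rw [ValuationSubring.valuation_lt_one_iff]; exact σ.2.2 α hαO)
    exact (congrArg Subtype.val h5).symm
  let αE : E := ⟨α, hfix⟩
  let αA : A := ⟨αE, hαO⟩
  have hinj : Function.Injective (comapHom E O) := fun x y hxy =>
    Subtype.ext (Subtype.ext (congrArg (fun z : O => (z : Ω)) hxy))
  have hαA : comapHom E O αA = αO := rfl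
  refine ⟨residue A αA, ?_⟩
  rw [← hαA, Polynomial.IsRoot, Polynomial.eval_map, Polynomial.eval₂_at_apply,
    map_eq_zero_iff _ hinj] at hroot
  rw [← hf, Polynomial.eval_map, Polynomial.eval₂_at_apply, hroot, map_zero]

-- The fixed field of D is itself henselian. Conversely a henselian E contains every element fixed
-- by its own decomposition group, and this group is contained in D.
variable (K O) in
theorem henselization_eq [IsGalois K Ω] [IsAlgClosed Ω] :
    henselization K O = IntermediateField.fixedField (O.decompositionSubgroup K) := by
  refine le_antisymm (sInf_le (henselian_fixedField _ le_rfl)) (le_sInf fun E hE x hx => ?_)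
  have h1 : x ∈ IntermediateField.fixedField (O.decompositionSubgroup E) := fun σ =>
    hx ⟨σ.1.restrictScalars K, mem_decomposition_iff.mpr (mem_decomposition_iff.mp σ.2)⟩
  rw [fixedField_decomposition_eq_bot hE] at h1
  obtain ⟨y, rfl⟩ := IntermediateField.mem_bot.mp h1
  exact y.2

variable (K O) in
theorem strictHenselization_eq [IsGalois K Ω] [IsAlgClosed Ω] :
    strictHenselization K O = IntermediateField.fixedField (inertia K O) := by
  refine le_antisymm (sInf_le ⟨henselian_fixedField _ fun σ hσ => hσ.1,
    isSepClosed_residueField_fixedField_inertia⟩) (le_sInf fun E hE x hx => ?_)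
  have h1 : x ∈ IntermediateField.fixedField (inertia E O) := fun σ =>
    hx ⟨σ.1.restrictScalars K, mem_decomposition_iff.mpr (mem_decomposition_iff.mp σ.2.1), σ.2.2⟩
  rw [fixedField_inertia_eq_bot hE.1 hE.2] at h1
  obtain ⟨y, rfl⟩ := IntermediateField.mem_bot.mp h1
  exact y.2

end Henselization

/-! ### Subgroups of prime power index from an action on a field of characteristic `p` -/

section Cocycle

variable {G : Type u} [Group G] (p : ℕ) (N W : Subgroup G)

/-- The homomorphisms from `W` to `ZMod p` that are trivial on `N`, extended by zero to `G`. -/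
def pCharacters : Submodule (ZMod p) (G → ZMod p) where
  carrier := {χ | (∀ a ∈ W, ∀ b ∈ W, χ (a * b) = χ a + χ b) ∧ (∀ n ∈ N, χ n = 0) ∧
    ∀ g, g ∉ W → χ g = 0}
  zero_mem' := by simp
  add_mem' := by
    rintro χ ψ ⟨h1, h2, h3⟩ ⟨h1', h2', h3'⟩
    refine ⟨fun a ha b hb => ?_, fun n hn => ?_, fun g hg => ?_⟩
    · simp only [Pi.add_apply, h1 a ha b hb, h1' a ha b hb]
      ring
    · simp [h2 n hn, h2' n hn]
    · simp [h3 g hg, h3' g hg]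
  smul_mem' := by
    rintro c χ ⟨h1, h2, h3⟩
    refine ⟨fun a ha b hb => ?_, fun n hn => ?_, fun g hg => ?_⟩
    · simp only [Pi.smul_apply, h1 a ha b hb, smul_add]
    · simp [h2 n hn]
    · simp [h3 g hg]

variable {p N W}

theorem pCharacters_one (χ : pCharacters p N W) : χ.1 1 = 0 := χ.2.2.1 1 (one_mem N)

theorem pCharacters_inv (χ : pCharacters p N W) {a : G} (ha : a ∈ W) : χ.1 a⁻¹ = -χ.1 a := by
  have := χ.2.1 a ha a⁻¹ (inv_mem ha)
  rw [mul_inv_cancel, pCharacters_one] at this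
  exact (neg_eq_of_add_eq_zero_right this.symm).symm

/-- The right conjugation action on characters. -/
def pCharacters.conj [N.Normal] [W.Normal] (g : G) : pCharacters p N W →+ pCharacters p N W where
  toFun χ := ⟨fun x => χ.1 (g * x * g⁻¹), by
    refine ⟨fun a ha b hb => ?_, fun n hn => ?_, fun x hx => ?_⟩
    · beta_reduce
      rw [show g * (a * b) * g⁻¹ = (g * a * g⁻¹) * (g * b * g⁻¹) by group]
      exact χ.2.1 _ (Subgroup.Normal.conj_mem inferInstance a ha g) _
        (Subgroup.Normal.conj_mem inferInstance b hb g)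
    · exact χ.2.2.1 _ (Subgroup.Normal.conj_mem inferInstance n hn g)
    · refine χ.2.2.2 _ fun h => hx ?_
      have := Subgroup.Normal.conj_mem (H := W) inferInstance _ h g⁻¹
      rwa [show g⁻¹ * (g * x * g⁻¹) * g⁻¹⁻¹ = x by group] at this⟩
  map_zero' := rfl
  map_add' _ _ := rfl

theorem pCharacters.conj_mul [N.Normal] [W.Normal] (g h : G) (χ : pCharacters p N W) :
    pCharacters.conj (g * h) χ = pCharacters.conj h (pCharacters.conj g χ) := by
  apply Subtype.ext
  funext x
  change χ.1 _ = χ.1 _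
  group

theorem pCharacters.conj_of_mem [N.Normal] [W.Normal] {w : G} (hw : w ∈ W)
    (χ : pCharacters p N W) : pCharacters.conj w χ = χ := by
  apply Subtype.ext
  funext x
  change χ.1 (w * x * w⁻¹) = χ.1 x
  by_cases hx : x ∈ W
  · rw [χ.2.1 _ (mul_mem hw hx) _ (inv_mem hw), χ.2.1 _ hw _ hx, pCharacters_inv χ hw]
    ring
  · rw [χ.2.2.2 x hx, χ.2.2.2]
    intro h
    apply hx
    have := mul_mem (mul_mem (inv_mem hw) h) hw
    rwa [show w⁻¹ * (w * x * w⁻¹) * w = x by group] at this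

theorem pCharacters_finite [Fact p.Prime] [N.FiniteIndex] (hNW : N ≤ W) :
    Finite (pCharacters p N W) := by
  have hinj : Function.Injective
      (fun (χ : pCharacters p N W) (q : G ⧸ N) => χ.1 q.out) := by
    intro χ ψ h
    apply Subtype.ext
    funext g
    have key : ∀ χ : pCharacters p N W, χ.1 g = χ.1 (QuotientGroup.mk (s := N) g).out := by
      intro χ
      obtain ⟨n, hn⟩ := QuotientGroup.mk_out_eq_mul N g
      rw [hn]
      by_cases hg : g ∈ W
      · rw [χ.2.1 g hg n (hNW n.2), χ.2.2.1 n n.2, add_zero]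
      · rw [χ.2.2.2 g hg, χ.2.2.2]
        intro h
        apply hg
        have := mul_mem h (inv_mem (hNW n.2))
        rwa [mul_inv_cancel_right] at this
    rw [key χ, key ψ]
    exact congrFun h _
  exact Finite.of_injective _ hinj

/-- The quotient W/N is a non-trivial finite p-group, so it has a normal subgroup of index p. -/
theorem pCharacters_nontrivial [Fact p.Prime] [N.Normal] [N.FiniteIndex]
    (hp : ∀ w ∈ W, ∃ k : ℕ, w ^ p ^ k ∈ N) {w : G} (hw : w ∈ W) (hwN : w ∉ N) :
    Nontrivial (pCharacters p N W) := by
  classical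
  let P := W ⧸ N.subgroupOf W
  have : (N.subgroupOf W).Normal := inferInstance
  have hfin : Finite P := inferInstance
  have hP : IsPGroup p P := by
    intro x
    obtain ⟨y, rfl⟩ := QuotientGroup.mk_surjective x
    obtain ⟨k, hk⟩ := hp y y.2
    refine ⟨k, ?_⟩
    rw [← QuotientGroup.mk_pow, QuotientGroup.eq_one_iff]
    exact hk
  obtain ⟨n, hn⟩ := IsPGroup.iff_card.mp hP
  have hn0 : n ≠ 0 := by
    rintro rfl
    rw [pow_zero, Nat.card_eq_one_iff_unique] at hn
    have := hn.1
    have h1 : (QuotientGroup.mk (⟨w, hw⟩ : W) : P) = 1 := Subsingleton.elim _ _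
    rw [QuotientGroup.eq_one_iff] at h1
    exact hwN h1
  obtain ⟨m, rfl⟩ := Nat.exists_eq_succ_of_ne_zero hn0
  obtain ⟨H, hH⟩ := Sylow.exists_subgroup_card_pow_prime (G := P) p (n := m)
    (by rw [hn]; exact pow_dvd_pow p (Nat.le_succ m))
  have hp0 : p ≠ 0 := (Fact.out : p.Prime).ne_zero
  have hidx : H.index = p := by
    have := H.card_mul_index
    rw [hH, hn, pow_succ] at this
    exact mul_left_cancel₀ (pow_ne_zero m hp0) this
  have hnorm : H.Normal := by
    apply Subgroup.normal_of_index_eq_minFac_card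
    rw [hidx, hn, Nat.Prime.pow_minFac Fact.out (Nat.succ_ne_zero m)]
  have hcard : Nat.card (P ⧸ H) = p := hidx
  have hcyc : IsCyclic (P ⧸ H) := isCyclic_of_prime_card hcard
  let f : P ⧸ H ≃* Multiplicative (ZMod (Nat.card (P ⧸ H))) := (zmodCyclicMulEquiv hcyc).symm
  have hf : ∃ f : P ⧸ H ≃* Multiplicative (ZMod p), True := by
    rw [hcard] at f
    exact ⟨f, trivial⟩
  obtain ⟨f, -⟩ := hf
  let F : W →* Multiplicative (ZMod p) :=
    f.toMonoidHom.comp ((QuotientGroup.mk' H).comp (QuotientGroup.mk' (N.subgroupOf W)))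
  have hF : Function.Surjective F := f.surjective.comp
    ((QuotientGroup.mk'_surjective H).comp (QuotientGroup.mk'_surjective _))
  let χ : pCharacters p N W := ⟨fun g => if hg : g ∈ W then (F ⟨g, hg⟩).toAdd else 0, by
    refine ⟨fun a ha b hb => ?_, fun n hn => ?_, fun g hg => dif_neg hg⟩
    · beta_reduce
      rw [dif_pos ha, dif_pos hb, dif_pos (mul_mem ha hb)]
      rw [show (⟨a * b, mul_mem ha hb⟩ : W) = ⟨a, ha⟩ * ⟨b, hb⟩ from rfl, map_mul]
      rfl
    · by_cases hnW : n ∈ W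
      · beta_reduce
        rw [dif_pos hnW]
        have h1 : (QuotientGroup.mk' (N.subgroupOf W)) ⟨n, hnW⟩ = 1 :=
          (QuotientGroup.eq_one_iff _).mpr hn
        change (f (QuotientGroup.mk' H (QuotientGroup.mk' (N.subgroupOf W) ⟨n, hnW⟩))).toAdd = 0
        rw [h1, map_one, map_one]
        rfl
      · exact dif_neg hnW⟩
  refine ⟨χ, 0, fun h => ?_⟩
  obtain ⟨y, hy⟩ := hF (Multiplicative.ofAdd 1)
  have h1 : χ.1 y = (0 : pCharacters p N W).1 y := by rw [h]
  have h2 : χ.1 y = (F y).toAdd := dif_pos y.2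
  rw [h2, hy] at h1
  exact one_ne_zero h1

variable (p N W) in
/-- Evaluation of characters at an element of `W`. -/
def pCharacters.eval (a : G) : Module.Dual (ZMod p) (pCharacters p N W) :=
  (LinearMap.proj a).comp (pCharacters p N W).subtype

/-- The evaluations form an F_p-subspace of the dual with zero common kernel; by finiteness this
subspace is the whole dual. -/
theorem pCharacters.exists_eval_eq [Fact p.Prime] [N.FiniteIndex] (hNW : N ≤ W)
    (f : Module.Dual (ZMod p) (pCharacters p N W)) :
    ∃ a ∈ W, pCharacters.eval p N W a = f := by
  have := pCharacters_finite (p := p) hNW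
  let S : AddSubgroup (Module.Dual (ZMod p) (pCharacters p N W)) :=
    { carrier := {f | ∃ a ∈ W, pCharacters.eval p N W a = f}
      zero_mem' := ⟨1, one_mem W, LinearMap.ext fun χ => pCharacters_one χ⟩
      add_mem' := by
        rintro _ _ ⟨a, ha, rfl⟩ ⟨b, hb, rfl⟩
        exact ⟨a * b, mul_mem ha hb, LinearMap.ext fun χ => χ.2.1 a ha b hb⟩
      neg_mem' := by
        rintro _ ⟨a, ha, rfl⟩
        exact ⟨a⁻¹, inv_mem ha, LinearMap.ext fun χ => pCharacters_inv χ ha⟩ }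
  let S' := AddSubgroup.toZModSubmodule p S
  have h1 : S'.dualCoannihilator = ⊥ := by
    rw [eq_bot_iff]
    intro χ hχ
    rw [Submodule.mem_dualCoannihilator] at hχ
    rw [Submodule.mem_bot]
    apply Subtype.ext
    funext a
    by_cases ha : a ∈ W
    · exact hχ (pCharacters.eval p N W a) ⟨a, ha, rfl⟩
    · exact χ.2.2.2 a ha
  have h2 : S' = ⊤ := by
    rw [← Subspace.dualCoannihilator_dualAnnihilator_eq (W := S'), h1,
      Submodule.dualAnnihilator_bot]
  have : f ∈ S' := h2 ▸ Submodule.mem_top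
  exact this

variable {Λ : Type v} [Field Λ] [MulSemiringAction G Λ]

theorem smul_zmod_cast [CharP Λ p] (g : G) (c : ZMod p) :
    g • (ZMod.castHom (dvd_refl p) Λ c) = ZMod.castHom (dvd_refl p) Λ c := by
  have : (MulSemiringAction.toRingHom G Λ g).comp (ZMod.castHom (dvd_refl p) Λ) =
      ZMod.castHom (dvd_refl p) Λ := Subsingleton.elim _ _
  exact DFunLike.congr_fun this c

/-- The subgroup X is the kernel of a 1-cocycle Z from G to the dual of V = Hom(W/N, F_p) that
restricts to minus evaluation on those elements of W acting trivially on Λ. The family `E`, a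
partition of unity permuted by G, makes the additive cohomology of G/W in Λ vanish; `hWN` ensures
that elements of W acting trivially on Λ already give all values. The finite set S bounds the level
at which X is defined. -/
theorem exists_subgroup_index_prime_pow [Fact p.Prime] [CharP Λ p] [IsAlgClosed Λ]
    [N.Normal] [W.Normal] [N.FiniteIndex] (hNW : N ≤ W)
    (hp : ∀ w ∈ W, ∃ k : ℕ, w ^ p ^ k ∈ N) {w : G} (hw : w ∈ W) (hwN : w ∉ N)
    (hWN : ∀ w ∈ W, ∃ j ∈ W, (∀ x : Λ, j • x = x) ∧ j⁻¹ * w ∈ N)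
    [Fintype (G ⧸ W)] (E : G ⧸ W → Λ) (hE : ∀ (g : G) q, g • E q = E (g • q))
    (hE1 : ∑ q, E q = 1) :
    ∃ (X : Subgroup G) (n : ℕ), X.index = p ^ (n + 1) ∧
      ∃ S : Finset Λ, ∀ g ∈ N, (∀ s ∈ S, g • s = s) → g ∈ X := by
  classical
  have hppos : p.Prime := Fact.out
  let V := pCharacters p N W
  let ι : ZMod p →+* Λ := ZMod.castHom (dvd_refl p) Λ
  have hι : ∀ (g : G) c, g • ι c = ι c := smul_zmod_cast
  let _ : Algebra (ZMod p) Λ := ZMod.algebra Λ p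
  have hfinV : Finite V := pCharacters_finite hNW
  have hnontriv : Nontrivial V := pCharacters_nontrivial hp hw hwN
  let conj : G → V →+ V := pCharacters.conj
  -- the transition elements of the section `Quotient.out`
  let t : G → G ⧸ W → G := fun g q => q.out * ((g⁻¹ • q).out)⁻¹ * g⁻¹
  have ht : ∀ g q, t g q ∈ W := by
    intro g q
    rw [← QuotientGroup.eq_one_iff]
    have h1 : ((g⁻¹ • q).out : G ⧸ W) = g⁻¹ • q := QuotientGroup.out_eq' _
    have h2 : (q.out : G ⧸ W) = q := QuotientGroup.out_eq' _
    change ((q.out * ((g⁻¹ • q).out)⁻¹ * g⁻¹ : G) : G ⧸ W) = 1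
    rw [QuotientGroup.mk_mul, QuotientGroup.mk_mul, QuotientGroup.mk_inv, h1, h2]
    have h3 : g⁻¹ • q = (g⁻¹ : G) * q := by
      conv_lhs => rw [← h2]
      conv_rhs => rw [← h2]
      rfl
    rw [h3]
    simp
  have htmul : ∀ g h q, t (g * h) q = t g q * (g * t h (g⁻¹ • q) * g⁻¹) := by
    intro g h q
    simp only [t, mul_inv_rev, mul_smul]
    group
  -- Averaging the characters of the transition elements with weights `E` gives a Λ-valued 1-cocycle
  -- on G whose restriction to W is minus evaluation.
  let z0 : G → V →+ Λ := fun g =>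
    { toFun := fun χ => ∑ q, E q * ι (χ.1 (t g q))
      map_zero' := by
        refine Finset.sum_eq_zero fun q _ => ?_
        change E q * ι 0 = 0
        rw [map_zero, mul_zero]
      map_add' := fun χ ψ => by
        rw [← Finset.sum_add_distrib]
        refine Finset.sum_congr rfl fun q _ => ?_
        change E q * ι (χ.1 (t g q) + ψ.1 (t g q)) = _
        rw [map_add, mul_add] }
  have hz0 : ∀ g χ, z0 g χ = ∑ q, E q * ι (χ.1 (t g q)) := fun _ _ => rfl
  have hz0mul : ∀ g h χ, z0 (g * h) χ = z0 g χ + g • z0 h (conj g χ) := by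
    intro g h χ
    have h1 : g • z0 h (conj g χ) = ∑ q, E q * ι (χ.1 (g * t h (g⁻¹ • q) * g⁻¹)) := by
      rw [hz0, Finset.smul_sum]
      refine Fintype.sum_equiv (MulAction.toPerm g) _ _ fun q => ?_
      rw [smul_mul', hι, hE]
      simp only [MulAction.toPerm_apply, inv_smul_smul]
      rfl
    rw [h1, hz0, hz0, ← Finset.sum_add_distrib]
    refine Finset.sum_congr rfl fun q _ => ?_
    rw [htmul, χ.2.1 _ (ht g q) _ (Subgroup.Normal.conj_mem inferInstance _ (ht _ _) g), map_add,
      mul_add]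
  have hz0W : ∀ a ∈ W, ∀ χ, z0 a χ = -ι (χ.1 a) := by
    intro a ha χ
    have h1 : ∀ q, t a q = a⁻¹ := by
      intro q
      have h2 : a⁻¹ • q = q := by
        obtain ⟨b, rfl⟩ := QuotientGroup.mk_surjective q
        change ((a⁻¹ * b : G) : G ⧸ W) = b
        rw [QuotientGroup.eq]
        have := Subgroup.Normal.conj_mem (H := W) inferInstance a ha b⁻¹
        simpa [mul_assoc] using this
      simp only [t, h2]
      group
    rw [hz0]
    simp only [h1]
    rw [← Finset.sum_mul, hE1, one_mul, pCharacters_inv χ ha, map_neg]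
  -- the Artin-Schreier map
  let AS : Λ →+ Λ := (frobenius Λ p).toAddMonoidHom - AddMonoidHom.id Λ
  have hAS : ∀ x, AS x = x ^ p - x := fun _ => rfl
  have hASsmul : ∀ (g : G) x, g • AS x = AS (g • x) := by
    intro g x
    rw [hAS, hAS, smul_sub, smul_pow']
  -- On W the values of `z0` lie in the prime field, which Artin-Schreier kills. So `c` is a cocycle
  -- that vanishes on W, and averaging with `E` exhibits it below as the coboundary of `m`.
  let c : G → V →+ Λ := fun g => AS.comp (z0 g)
  have hcmul : ∀ g h χ, c (g * h) χ = c g χ + g • c h (conj g χ) := by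
    intro g h χ
    change AS (z0 (g * h) χ) = AS (z0 g χ) + g • AS (z0 h (conj g χ))
    rw [hz0mul, map_add, hASsmul]
  have hcW : ∀ a ∈ W, ∀ χ, c a χ = 0 := by
    intro a ha χ
    change AS (z0 a χ) = 0
    rw [hz0W a ha, map_neg, hAS, ← map_pow, ZMod.pow_card, sub_self, neg_zero]
  have hcmulW : ∀ g, ∀ a ∈ W, ∀ χ, c (g * a) χ = c g χ := by
    intro g a ha χ
    rw [hcmul, hcW a ha, smul_zero, add_zero]
  let m : V →+ Λ := -∑ q : G ⧸ W, (AddMonoidHom.mulLeft (E q)).comp (c q.out)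
  have hm : ∀ χ, m χ = -∑ q, E q * c q.out χ := by
    intro χ
    simp [m]
  have hmc : ∀ g χ, g • m (conj g χ) - m χ = c g χ := by
    intro g χ
    have h1 : g • m (conj g χ) = -∑ q, E q * (c q.out χ - c g χ) := by
      rw [hm, smul_neg, Finset.smul_sum]
      congr 1
      refine Fintype.sum_equiv (MulAction.toPerm g) _ _ fun q => ?_
      rw [smul_mul', hE]
      simp only [MulAction.toPerm_apply]
      congr 1
      have h2 := hcmul g q.out χ
      rw [eq_sub_iff_add_eq, add_comm, ← h2]
      have h3 : ∃ a ∈ W, (g • q).out = g * q.out * a := by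
        refine ⟨(g * q.out)⁻¹ * (g • q).out, ?_, by group⟩
        rw [← QuotientGroup.eq, QuotientGroup.out_eq']
        conv_rhs => rw [← QuotientGroup.out_eq' q]
        rfl
      obtain ⟨a, ha, h3⟩ := h3
      rw [h3, hcmulW _ a ha]
    rw [h1, hm]
    simp only [mul_sub, Finset.sum_sub_distrib]
    rw [← Finset.sum_mul, hE1, one_mul]
    ring
  -- an additive preimage of `m` under the Artin-Schreier map
  have hASsurj : Function.Surjective AS := by
    intro y
    obtain ⟨x, hx⟩ := IsAlgClosed.exists_root (k := Λ)
      (Polynomial.X ^ p - Polynomial.X - Polynomial.C y) (by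
        have hd : (Polynomial.X ^ p - Polynomial.X - Polynomial.C y : Λ[X]).natDegree = p := by
          rw [Polynomial.natDegree_sub_C, FiniteField.X_pow_card_sub_X_natDegree_eq Λ hppos.one_lt]
        intro h0
        have := Polynomial.natDegree_eq_of_degree_eq_some h0
        rw [hd] at this
        exact hppos.ne_zero this)
    refine ⟨x, ?_⟩
    rw [hAS]
    simpa [Polynomial.IsRoot, sub_eq_zero] using hx
  obtain ⟨m2, hm2⟩ := Module.projective_lifting_property (AddMonoidHom.toZModLinearMap p AS)
    (AddMonoidHom.toZModLinearMap p m) hASsurj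
  have hm2' : ∀ χ, AS (m2 χ) = m χ := fun χ => DFunLike.congr_fun hm2 χ
  -- Subtracting the coboundary of `m2` makes the Artin-Schreier image vanish, so that the values of
  -- `z` lie in F_p.
  let z : G → V → Λ := fun g χ => z0 g χ - (g • m2 (conj g χ) - m2 χ)
  have hzF : ∀ g χ, ∃ a : ZMod p, ι a = z g χ := by
    intro g χ
    have h1 : AS (z g χ) = 0 := by
      simp only [z]
      rw [map_sub, map_sub, ← hASsmul, hm2', hm2', hmc]
      exact sub_self _
    rw [hAS, sub_eq_zero, ← Subfield.mem_bot_iff_pow_eq_self,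
      ← ZMod.fieldRange_castHom_eq_bot p] at h1
    exact h1
  have hzmul : ∀ g h χ, z (g * h) χ = z g χ + z h (conj g χ) := by
    intro g h χ
    have h1 : g • z h (conj g χ) = z h (conj g χ) := by
      obtain ⟨a, ha⟩ := hzF h (conj g χ)
      rw [← ha, hι]
    rw [← h1]
    simp only [z]
    rw [hz0mul, smul_sub, smul_sub, ← mul_smul,
      show conj (g * h) χ = conj h (conj g χ) from pCharacters.conj_mul g h χ]
    ring
  choose Zf hZf using hzF
  have hιinj : Function.Injective ι := ι.injective
  have hZadd : ∀ g χ ψ, Zf g (χ + ψ) = Zf g χ + Zf g ψ := by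
    intro g χ ψ
    apply hιinj
    rw [map_add, hZf, hZf, hZf]
    simp only [z]
    rw [map_add, map_add, map_add, map_add, smul_add]
    ring
  have hZmul : ∀ g h χ, Zf (g * h) χ = Zf g χ + Zf h (conj g χ) := by
    intro g h χ
    apply hιinj
    rw [map_add, hZf, hZf, hZf, hzmul]
  let Z : G → Module.Dual (ZMod p) V := fun g =>
    AddMonoidHom.toZModLinearMap p (AddMonoidHom.mk' (Zf g) (hZadd g))
  have hZ : ∀ g χ, Z g χ = Zf g χ := fun _ _ => rfl
  have hconjsurj : ∀ g χ, ∃ ψ, conj g ψ = χ := by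
    intro g χ
    refine ⟨conj g⁻¹ χ, ?_⟩
    have := pCharacters.conj_mul g⁻¹ g χ
    rw [inv_mul_cancel, pCharacters.conj_of_mem (one_mem W)] at this
    exact this.symm
  have hZ1 : ∀ χ, Zf 1 χ = 0 := by
    intro χ
    have := hZmul 1 1 χ
    rw [mul_one, show conj 1 χ = χ from pCharacters.conj_of_mem (one_mem W) χ] at this
    exact left_eq_add.mp this
  let X : Subgroup G :=
    { carrier := {g | ∀ χ, Zf g χ = 0}
      one_mem' := hZ1
      mul_mem' := fun {a b} ha hb χ => by rw [hZmul, ha, hb, add_zero]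
      inv_mem' := fun {a} ha χ => by
        obtain ⟨ψ, rfl⟩ := hconjsurj a χ
        have := hZmul a a⁻¹ ψ
        rw [mul_inv_cancel, hZ1, ha, zero_add] at this
        exact this.symm }
  have hXmem : ∀ g, g ∈ X ↔ ∀ χ, Zf g χ = 0 := fun _ => Iff.rfl
  have hZeq : ∀ g h, g⁻¹ * h ∈ X ↔ Z g = Z h := by
    intro g h
    have h1 : ∀ χ, Zf h χ = Zf g χ + Zf (g⁻¹ * h) (conj g χ) := by
      intro χ
      rw [← hZmul, mul_inv_cancel_left]
    constructor
    · intro h2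
      refine LinearMap.ext fun χ => ?_
      rw [hZ, hZ, h1, h2, add_zero]
    · intro h2 χ
      obtain ⟨ψ, rfl⟩ := hconjsurj g χ
      have h3 := h1 ψ
      rw [← hZ, ← hZ, h2] at h3
      exact left_eq_add.mp h3
  -- An element `j` of W acting trivially on Λ does not see the correction by `m2`, since
  -- conjugation by W is trivial on characters; there Z is exactly minus evaluation.
  have hZsurj : Function.Surjective Z := by
    intro f
    obtain ⟨a, ha, haf⟩ := pCharacters.exists_eval_eq hNW (-f)
    obtain ⟨j, hj, hjtriv, hja⟩ := hWN a ha
    refine ⟨j, LinearMap.ext fun χ => ?_⟩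
    apply hιinj
    have h1 : χ.1 j = χ.1 a := by
      have := χ.2.1 j hj _ (hNW hja)
      rw [mul_inv_cancel_left, χ.2.2.1 _ hja, add_zero] at this
      exact this.symm
    rw [hZ, hZf]
    simp only [z]
    rw [hz0W j hj, show conj j χ = χ from pCharacters.conj_of_mem hj χ, hjtriv, sub_self, sub_zero,
      h1, ← map_neg]
    congr 1
    have h2 : χ.1 a = (-f) χ := by rw [← haf]; rfl
    rw [h2, LinearMap.neg_apply, neg_neg]
  have hequiv : G ⧸ X ≃ Module.Dual (ZMod p) V := by
    refine Equiv.ofBijective (Quotient.lift Z fun a b hab => ?_) ⟨?_, ?_⟩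
    · exact (hZeq a b).mp (QuotientGroup.leftRel_apply.mp hab)
    · intro x y
      induction x using QuotientGroup.induction_on with | H x => ?_
      induction y using QuotientGroup.induction_on with | H y => ?_
      intro h
      exact QuotientGroup.eq.mpr ((hZeq x y).mpr h)
    · intro f
      obtain ⟨g, hg⟩ := hZsurj f
      exact ⟨QuotientGroup.mk g, hg⟩
  have hidx : X.index = p ^ Module.finrank (ZMod p) V := by
    rw [Subgroup.index, Nat.card_congr hequiv, Module.natCard_eq_pow_finrank (K := ZMod p),
      Subspace.dual_finrank_eq, Nat.card_zmod]
  have hpos : 0 < Module.finrank (ZMod p) V := Module.finrank_pos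
  have : Fintype V := Fintype.ofFinite V
  refine ⟨X, Module.finrank (ZMod p) V - 1, ?_, Finset.univ.image m2, fun g hg hs χ => ?_⟩
  · rw [hidx, Nat.sub_add_cancel hpos]
  · apply hιinj
    rw [hZf, map_zero]
    simp only [z]
    rw [hz0W g (hNW hg), χ.2.2.1 g hg, show conj g χ = χ from pCharacters.conj_of_mem (hNW hg) χ,
      hs _ (Finset.mem_image_of_mem _ (Finset.mem_univ χ)), map_zero, neg_zero, sub_self, sub_zero]

end Cocycle

/-! ### Approximation in rank one -/

section RankOne

variable {K : Type u} {Ω : Type v} [Field K] [Field Ω] [Algebra K Ω] {O : ValuationSubring Ω}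

/-- The valuation ring `O` has rank at most one. -/
def IsRankLeOne (O : ValuationSubring Ω) : Prop :=
  ∀ x c : Ω, O.valuation x < 1 → c ≠ 0 → ∃ n : ℕ, O.valuation x ^ n ≤ O.valuation c

theorem exists_algEquiv_extends [Normal K Ω] (Y : IntermediateField K Ω) (f : Y →ₐ[K] Ω) :
    ∃ τ : Ω ≃ₐ[K] Ω, ∀ y : Y, τ y = f y :=
  ⟨AlgEquiv.ofBijective (f.liftNormal Ω) (AlgHom.normal_bijective K Ω Ω _),
    fun y => f.liftNormal_commutes Ω y⟩

theorem valuation_one_sub_pow_le {x d : Ω} (hx : x ∈ O) (h : O.valuation x ≤ O.valuation d)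
    (k : ℕ) : O.valuation (1 - (1 - x) ^ k) ≤ O.valuation d := by
  have hdvd : (⟨x, hx⟩ : O) ∣ 1 - (1 - ⟨x, hx⟩) ^ k := by
    have := sub_dvd_pow_sub_pow (1 : O) (1 - ⟨x, hx⟩) k
    rwa [sub_sub_cancel, one_pow] at this
  obtain ⟨c, hc⟩ := hdvd
  have hc' : 1 - (1 - x) ^ k = x * c := congrArg Subtype.val hc
  rw [hc', map_mul]
  exact (mul_le_of_le_one_right' ((O.valuation_le_one_iff _).mpr c.2)).trans h

/-- `K` is dense in the fixed field of the decomposition group. -/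
theorem exists_approx_of_mem_fixedField [IsGalois K Ω] [IsAlgClosed Ω] (hR : IsRankLeOne O) {z : Ω}
    (hz : z ∈ IntermediateField.fixedField (O.decompositionSubgroup K)) {c : Ω} (hc : c ≠ 0) :
    ∃ a : K, O.valuation (z - algebraMap K Ω a) ≤ O.valuation c := by
  classical
  by_cases hz0 : z = 0
  · exact ⟨0, by simp [hz0]⟩
  let Y := IntermediateField.adjoin K {z}
  have hYfin : FiniteDimensional K Y :=
    IntermediateField.adjoin.finiteDimensional (Algebra.IsIntegral.isIntegral z)
  have hY : Y ≤ IntermediateField.fixedField (O.decompositionSubgroup K) := by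
    rw [IntermediateField.adjoin_le_iff, Set.singleton_subset_iff]
    exact hz
  obtain ⟨e, heY, he, he1, hτ⟩ := exists_congr_one Y hY
  have hzY : z ∈ Y := IntermediateField.mem_adjoin_simple_self K z
  let zY : Y := ⟨z, hzY⟩
  let eY : Y := ⟨e, heY⟩
  obtain ⟨f0, -, hf0⟩ := Finset.exists_max_image (Finset.univ : Finset (Y →ₐ[K] Ω))
    (fun f => O.valuation (f zY)) ⟨Y.val, Finset.mem_univ _⟩
  have hzY0 : zY ≠ 0 := fun h => hz0 (congrArg Subtype.val h)
  have hf0z : f0 zY ≠ 0 := (map_ne_zero f0).mpr hzY0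
  -- The error allowed for the multiplier: divided by the largest conjugate of `z`, so that an error
  -- of size `d` times any conjugate is at most `c`.
  let d : Ω := c / f0 zY
  have hd : d ≠ 0 := div_ne_zero hc hf0z
  have hdz : ∀ f : Y →ₐ[K] Ω, O.valuation d * O.valuation (f zY) ≤ O.valuation c := by
    intro f
    calc O.valuation d * O.valuation (f zY) ≤ O.valuation d * O.valuation (f0 zY) :=
          mul_le_mul_right (hf0 f (Finset.mem_univ f)) _
      _ = O.valuation c := by rw [← map_mul, div_mul_cancel₀ _ hf0z]
  have hlt : ∀ f : Y →ₐ[K] Ω, f ≠ Y.val → O.valuation (f eY) < 1 := by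
    intro f hf
    obtain ⟨τ, hτf⟩ := exists_algEquiv_extends Y f
    rw [← hτf]
    apply hτ
    by_contra! hcon
    exact hf (AlgHom.ext fun y => (hτf y).symm.trans (hcon y y.2))
  have hex : ∀ f : Y →ₐ[K] Ω, ∃ n : ℕ, f ≠ Y.val → O.valuation (f eY) ^ n ≤ O.valuation d := by
    intro f
    by_cases hf : f = Y.val
    · exact ⟨0, fun h => absurd hf h⟩
    · obtain ⟨n, hn⟩ := hR _ _ (hlt f hf) hd
      exact ⟨n, fun _ => hn⟩
  choose n hn using hex
  let n1 := Finset.univ.sup n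
  have hn1 : ∀ f : Y →ₐ[K] Ω, f ≠ Y.val → O.valuation (f eY) ^ n1 ≤ O.valuation d := fun f hf =>
    (pow_le_pow_right_of_le_one' (hlt f hf).le (Finset.le_sup (Finset.mem_univ f))).trans (hn f hf)
  have heO : e ∈ O := mem_of_mem_conjInf he
  have h1e : O.valuation (1 - e ^ n1) < 1 := by
    have h1 : (1 - ⟨e, heO⟩ : O) ∣ 1 - ⟨e, heO⟩ ^ n1 := by
      have := sub_dvd_pow_sub_pow (1 : O) ⟨e, heO⟩ n1
      rwa [one_pow] at this
    obtain ⟨b, hb⟩ := h1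
    have hb' : 1 - e ^ n1 = (1 - e) * b := congrArg Subtype.val hb
    rw [hb', map_mul]
    refine mul_lt_one_of_lt_of_le ?_ ((O.valuation_le_one_iff _).mpr b.2)
    rwa [← O.valuation.map_neg, neg_sub]
  obtain ⟨n2, hn2⟩ := hR _ _ h1e hd
  -- Under the inclusion of Y the value is within `d` of 1, and under every other embedding it is
  -- within `d` of 0. The trace of `uY * zY` is therefore close to `z`.
  let uY : Y := 1 - (1 - eY ^ n1) ^ n2
  have hu : ∀ f : Y →ₐ[K] Ω, f uY = 1 - (1 - f eY ^ n1) ^ n2 := by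
    intro f
    simp [uY]
  refine ⟨Algebra.trace K Y (uY * zY), ?_⟩
  rw [trace_eq_sum_embeddings Ω, ← Finset.add_sum_erase _ _ (Finset.mem_univ Y.val),
    ← sub_sub]
  refine (O.valuation.map_sub _ _).trans (max_le ?_ ?_)
  · have h2 : z - Y.val (uY * zY) = (1 - e ^ n1) ^ n2 * z := by
      rw [map_mul, hu]
      change z - (1 - (1 - e ^ n1) ^ n2) * z = _
      ring
    rw [h2, map_mul, map_pow]
    exact (mul_le_mul_left hn2 _).trans (hdz Y.val)
  · refine O.valuation.map_sum_le fun f hf => ?_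
    have hf' : f ≠ Y.val := (Finset.mem_erase.mp hf).1
    rw [map_mul, map_mul, hu]
    refine (mul_le_mul_left (valuation_one_sub_pow_le ?_ ?_ n2) _).trans (hdz f)
    · exact pow_mem ((O.valuation_le_one_iff _).mp (hlt f hf').le) n1
    · rw [map_pow]
      exact hn1 f hf'

/-- A finite transitive set for the decomposition group gives an element of `Ω` whose degree
over `K` is the cardinality of the set. -/
theorem exists_natDegree_minpoly_eq_card [IsGalois K Ω] [IsAlgClosed Ω] (hR : IsRankLeOne O)
    {π : Ω} (hπ0 : π ≠ 0) (hπ : O.valuation π < 1) (R : Finset Ω) {r₀ : Ω} (hr₀ : r₀ ∈ R)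
    (hstab : ∀ σ ∈ O.decompositionSubgroup K, ∀ r ∈ R, σ r ∈ R)
    (htrans : ∀ r ∈ R, ∃ σ ∈ O.decompositionSubgroup K, σ r₀ = r) :
    ∃ β : Ω, (minpoly K β).natDegree = R.card := by
  classical
  let f : Polynomial Ω := ∏ r ∈ R, (Polynomial.X - Polynomial.C r)
  have hfdeg : f.natDegree = R.card := by simp [f]
  have hfm : f.Monic := Polynomial.monic_prod_X_sub_C _ _
  have hcoeff : ∀ i, f.coeff i ∈ IntermediateField.fixedField (O.decompositionSubgroup K) := by
    intro i σ
    have h1 : f.map (σ.1 : Ω →+* Ω) = f := by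
      simp only [f, Polynomial.map_prod, Polynomial.map_sub, Polynomial.map_X, Polynomial.map_C]
      refine Finset.prod_bij (fun r _ => σ.1 r) (fun r hr => hstab _ σ.2 r hr)
        (fun a _ b _ h => σ.1.injective h) (fun b hb => ?_) (fun r _ => rfl)
      refine ⟨σ.1⁻¹ b, hstab _ (inv_mem σ.2) b hb, ?_⟩
      exact σ.1.apply_symm_apply b
    conv_rhs => rw [← h1, Polynomial.coeff_map]
    rfl
  -- a lower bound for the distances
  have hd : ∃ d : Ω, d ≠ 0 ∧ ∀ r ∈ R, ∀ s ∈ R, r ≠ s → O.valuation d ≤ O.valuation (r - s) := by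
    by_cases hne : R.offDiag.Nonempty
    · obtain ⟨⟨r, s⟩, hrs, hmin⟩ := Finset.exists_min_image R.offDiag
        (fun q => O.valuation (q.1 - q.2)) hne
      refine ⟨r - s, sub_ne_zero.mpr (Finset.mem_offDiag.mp hrs).2.2, fun a ha b hb hab => ?_⟩
      exact hmin (a, b) (Finset.mem_offDiag.mpr ⟨ha, hb, hab⟩)
    · refine ⟨1, one_ne_zero, fun r hr s hs hrs => absurd ⟨(r, s), ?_⟩ hne⟩
      exact Finset.mem_offDiag.mpr ⟨hr, hs, hrs⟩
  obtain ⟨d, hd0, hd⟩ := hd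
  let n := R.card
  -- A common bound for 1 and `r₀`, so that every power r₀^i with i ≤ n is bounded by y^n.
  have hy : ∃ y : Ω, y ≠ 0 ∧ 1 ≤ O.valuation y ∧ O.valuation r₀ ≤ O.valuation y := by
    by_cases h : O.valuation r₀ ≤ 1
    · exact ⟨1, one_ne_zero, by simp, by simpa using h⟩
    · refine ⟨r₀, ?_, (not_le.mp h).le, le_rfl⟩
      rintro rfl
      simp at h
  obtain ⟨y, hy0, hy1, hyr⟩ := hy
  -- With coefficient errors of this size the approximating polynomial takes at `r₀` a value smaller
  -- than d^n, so one of its n roots is closer to `r₀` than `d`. The factor `π` makes the inequality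
  -- strict.
  let c : Ω := d ^ n * π / y ^ n
  have hc0 : c ≠ 0 := div_ne_zero (mul_ne_zero (pow_ne_zero _ hd0) hπ0) (pow_ne_zero _ hy0)
  choose a ha using fun i => exists_approx_of_mem_fixedField hR (hcoeff i) hc0
  let h : K[X] := ∑ i ∈ Finset.range n, Polynomial.monomial i (a i)
  have hdegh : h.degree < n := by
    refine lt_of_le_of_lt (Polynomial.degree_sum_le _ _) ?_
    refine (Finset.sup_lt_iff (WithBot.bot_lt_coe n)).mpr fun i hi => ?_
    exact lt_of_le_of_lt (Polynomial.degree_monomial_le _ _)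
      (Nat.cast_lt.mpr (Finset.mem_range.mp hi))
  let g : K[X] := Polynomial.X ^ n + h
  have hgm : g.Monic := Polynomial.monic_X_pow_add hdegh
  have hgdeg : g.natDegree = n := by
    apply Polynomial.natDegree_eq_of_degree_eq_some
    rw [Polynomial.degree_add_eq_left_of_degree_lt (by rwa [Polynomial.degree_X_pow]),
      Polynomial.degree_X_pow]
  have hf0 : f.eval r₀ = 0 := by
    rw [Polynomial.eval_prod]
    exact Finset.prod_eq_zero hr₀ (by simp)
  have hgeval : (g.map (algebraMap K Ω)).eval r₀ =
      -∑ i ∈ Finset.range n, (f.coeff i - algebraMap K Ω (a i)) * r₀ ^ i := by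
    have h1 : f.eval r₀ = ∑ i ∈ Finset.range n, f.coeff i * r₀ ^ i + r₀ ^ n := by
      rw [Polynomial.eval_eq_sum_range, hfdeg, Finset.sum_range_succ]
      have : f.coeff n = 1 := by
        have := hfm.coeff_natDegree
        rwa [hfdeg] at this
      rw [this, one_mul]
    have h2 : (g.map (algebraMap K Ω)).eval r₀ =
        r₀ ^ n + ∑ i ∈ Finset.range n, algebraMap K Ω (a i) * r₀ ^ i := by
      simp [g, h, Polynomial.eval_finsetSum, Polynomial.map_sum]
    rw [h2]
    simp only [sub_mul, Finset.sum_sub_distrib]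
    rw [hf0] at h1
    linear_combination -h1
  have hsmall : O.valuation ((g.map (algebraMap K Ω)).eval r₀) < O.valuation d ^ n := by
    rw [hgeval, O.valuation.map_neg]
    have hdn : O.valuation d ^ n ≠ 0 := pow_ne_zero _ ((map_ne_zero _).mpr hd0)
    refine O.valuation.map_sum_lt hdn fun i hi => ?_
    rw [map_mul, map_pow]
    have hi' : i ≤ n := (Finset.mem_range.mp hi).le
    have h3 : O.valuation r₀ ^ i ≤ O.valuation y ^ n :=
      (pow_le_pow_left' hyr i).trans (pow_le_pow_right' hy1 hi')
    have h4 : O.valuation c * O.valuation y ^ n = O.valuation d ^ n * O.valuation π := by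
      rw [← map_pow, ← map_mul, div_mul_cancel₀ _ (pow_ne_zero _ hy0), map_mul, map_pow]
    calc _ ≤ O.valuation c * O.valuation y ^ n := mul_le_mul' (ha i) h3
      _ = O.valuation d ^ n * O.valuation π := h4
      _ < O.valuation d ^ n := mul_lt_of_lt_one_right (zero_lt_iff.mpr hdn) hπ
  have hsplit : (g.map (algebraMap K Ω)).Splits := IsAlgClosed.splits _
  rw [hsplit.eval_eq_prod_roots_of_monic (hgm.map _)] at hsmall
  have hcard : ((g.map (algebraMap K Ω)).roots.map (fun x => r₀ - x)).card = n := by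
    rw [Multiset.card_map, ← hsplit.natDegree_eq_card_roots, hgm.natDegree_map, hgdeg]
  rw [← hcard] at hsmall
  obtain ⟨x, hx, hxlt⟩ := exists_valuation_lt_of_prod_lt hsmall
  obtain ⟨β, hβ, rfl⟩ := Multiset.mem_map.mp hx
  have hβroot : Polynomial.aeval β g = 0 := by
    rw [Polynomial.aeval_def, ← Polynomial.eval_map]
    exact (Polynomial.mem_roots (hgm.map _).ne_zero).mp hβ
  have hint : IsIntegral K β := Algebra.IsIntegral.isIntegral β
  refine ⟨β, le_antisymm ?_ ?_⟩
  · have := Polynomial.natDegree_le_of_dvd (minpoly.dvd K β hβroot) hgm.ne_zero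
    rwa [hgdeg] at this
  -- Krasner's argument: applying elements of D puts a conjugate of `β` near each element of `R`.
  -- These elements are at mutual distance at least `d`, so the conjugates are distinct and the
  -- degree is at least n.
  · choose! σ hσD hσ using htrans
    have hmaps : ∀ r ∈ R, σ r β ∈ ((minpoly K β).map (algebraMap K Ω)).roots.toFinset := by
      intro r hr
      rw [Multiset.mem_toFinset, Polynomial.mem_roots ((minpoly.monic hint).map _).ne_zero,
        Polynomial.IsRoot, Polynomial.eval_map, ← Polynomial.aeval_def]
      change Polynomial.aeval ((σ r).toAlgHom β) _ = 0
      rw [Polynomial.aeval_algHom_apply, minpoly.aeval, map_zero]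
    have hclose : ∀ r ∈ R, O.valuation (r - σ r β) < O.valuation d := by
      intro r hr
      have h5 := valuation_apply_of_mem_decomposition (hσD r hr) (r₀ - β)
      rw [map_sub, hσ r hr] at h5
      rwa [h5]
    have hinj : Set.InjOn (fun r => σ r β) R := by
      intro r hr s hs hrs
      by_contra hne
      have h6 := O.valuation.map_sub_lt (hclose r hr) (hclose s hs)
      have hrs' : σ r β = σ s β := hrs
      rw [hrs', sub_sub_sub_cancel_right] at h6
      exact absurd (hd r hr s hs hne) (not_le.mpr h6)
    have h7 := Finset.card_le_card_of_injOn _ hmaps hinj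
    refine h7.trans ((Multiset.toFinset_card_le _).trans ((Polynomial.card_roots' _).trans ?_))
    rw [(minpoly.monic hint).natDegree_map]

end RankOne

/-! ### Wild inertia at a finite level -/

section Residue

variable {Ω : Type v} [Field Ω] {O : ValuationSubring Ω}

theorem residue_eq_iff {a b : O} :
    residue O a = residue O b ↔ O.valuation ((a : Ω) - b) < 1 := by
  rw [← sub_eq_zero, ← map_sub, residue_eq_zero_iff, ValuationSubring.valuation_lt_one_iff]
  rfl

theorem isAlgClosed_residueField [IsAlgClosed Ω] : IsAlgClosed (ResidueField O) := by
  refine IsAlgClosed.of_exists_root _ fun p hpm hpi => ?_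
  obtain ⟨f, hf, hdeg, hfm⟩ := Polynomial.lifts_and_natDegree_eq_and_monic
    (Polynomial.mem_lifts_of_surjective (residue_surjective (R := O)) p) hpm
  obtain ⟨α, hα⟩ := IsAlgClosed.exists_root (f.map O.subtype) (by
    rw [Polynomial.degree_eq_natDegree (hfm.map _).ne_zero, hfm.natDegree_map, hdeg]
    exact_mod_cast hpi.natDegree_pos.ne')
  have hαO : α ∈ O := mem_of_isRoot_monic hfm hα
  refine ⟨residue O ⟨α, hαO⟩, ?_⟩
  have h3 := Polynomial.eval₂_at_apply (p := f) O.subtype ⟨α, hαO⟩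
  rw [← Polynomial.eval_map] at h3
  have h4 : f.eval ⟨α, hαO⟩ = 0 := Subtype.ext (h3.symm.trans hα)
  rw [← hf, Polynomial.eval_map, Polynomial.eval₂_at_apply, h4, map_zero]

theorem natCast_residue_eq_zero_iff {n : ℕ} :
    (n : ResidueField O) = 0 ↔ O.valuation (n : Ω) < 1 := by
  rw [← map_natCast (residue O), residue_eq_zero_iff, ValuationSubring.valuation_lt_one_iff]
  rfl

theorem charP_residueField {p : ℕ} (hp : p.Prime) (h : O.valuation (p : Ω) < 1) :
    CharP (ResidueField O) p :=
  (CharP.charP_iff_prime_eq_zero hp).mpr (natCast_residue_eq_zero_iff.mpr h)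

theorem valuation_natCast_eq_one {p m : ℕ} (hp : p.Prime) (h : O.valuation (p : Ω) < 1)
    (hm : ¬ p ∣ m) : O.valuation (m : Ω) = 1 := by
  have := charP_residueField hp h
  refine le_antisymm ((O.valuation_le_one_iff _).mpr (natCast_mem O m)) (not_lt.mp fun hlt => hm ?_)
  exact (CharP.cast_eq_zero_iff (ResidueField O) p m).mp (natCast_residue_eq_zero_iff.mpr hlt)

end Residue

section Wild

variable {K : Type u} {Ω : Type v} [Field K] [Field Ω] [Algebra K Ω] {O : ValuationSubring Ω}

theorem apply_mem_of_normal (N : IntermediateField K Ω) [Normal K N] (g : Ω ≃ₐ[K] Ω) {x : Ω}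
    (hx : x ∈ N) : g x ∈ N := by
  have h := AlgEquiv.restrictNormal_commutes g N ⟨x, hx⟩
  have h' : ((g.restrictNormal N ⟨x, hx⟩ : N) : Ω) = g x := h
  rw [← h']
  exact Subtype.mem _

/-- Subtract from `x` its mean over the powers of `g`; the mean is fixed by `g`, so the difference
is not zero. -/
theorem exists_sum_pow_apply_eq_zero (N : IntermediateField K Ω) [Normal K N] (g : Ω ≃ₐ[K] Ω)
    {m : ℕ} (hm : (m : Ω) ≠ 0) {x : Ω} (hx : x ∈ N) (hgm : (g ^ m) x = x) (hg : g x ≠ x) :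
    ∃ y ∈ N, y ≠ 0 ∧ ∑ i ∈ Finset.range m, (g ^ i) y = 0 := by
  let T := (∑ i ∈ Finset.range m, (g ^ i) x) / m
  have hTN : T ∈ N := div_mem (sum_mem fun i _ => apply_mem_of_normal N _ hx) (natCast_mem N m)
  have hT : g T = T := by
    have h1 : ∑ i ∈ Finset.range m, (g ^ (i + 1)) x = ∑ i ∈ Finset.range m, (g ^ i) x := by
      have h2 := Finset.sum_range_succ (fun i => (g ^ i) x) m
      rw [Finset.sum_range_succ', hgm, pow_zero, AlgEquiv.one_apply] at h2
      exact add_right_cancel h2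
    simp only [T, map_div₀, map_natCast, map_sum]
    rw [← h1]
    congr 1
    refine Finset.sum_congr rfl fun i _ => ?_
    rw [pow_succ', AlgEquiv.mul_apply]
  have hTi : ∀ i : ℕ, (g ^ i) T = T := by
    intro i
    induction i with
    | zero => simp
    | succ i ih => rw [pow_succ, AlgEquiv.mul_apply, hT, ih]
  refine ⟨x - T, sub_mem hx hTN, fun h => hg ?_, ?_⟩
  · rw [sub_eq_zero.mp h, hT]
  · simp only [map_sub, hTi, Finset.sum_sub_distrib, Finset.sum_const, Finset.card_range,
      nsmul_eq_mul]
    rw [mul_div_cancel₀ _ hm, sub_self]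

variable (O) in
/-- The elements of the decomposition group which act trivially on the residues of elements
of `N`. -/
def residualInertia (N : IntermediateField K Ω) [Normal K N] :
    Subgroup (O.decompositionSubgroup K) where
  carrier := {g | ∀ x ∈ N, x ∈ O → O.valuation (g.1 x - x) < 1}
  one_mem' := fun x _ _ => by simp
  mul_mem' := by
    intro g h hg hh x hxN hx
    have := O.valuation.map_add_lt (hg (h.1 x) (apply_mem_of_normal N _ hxN)
      ((mem_decomposition_iff.mp h.2 x).mpr hx)) (hh x hxN hx)
    simpa using this
  inv_mem' := by
    intro g hg x hxN hx
    rw [← valuation_lt_one_of_mem_decomposition g.2, map_sub, ← O.valuation.map_neg, neg_sub]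
    change O.valuation (g.1 x - g.1 (g.1.symm x)) < 1
    rw [AlgEquiv.apply_symm_apply]
    exact hg x hxN hx

/-- As `g` is trivial on the residues of N, its action on the residue field of Ω lifts to some ρ in
D that fixes N. Then gρ⁻¹ is in the inertia group and agrees with `g` on N. -/
theorem exists_inertia_of_residualInertia [IsGalois K Ω] (N : IntermediateField K Ω)
    [Normal K N] {g : O.decompositionSubgroup K}
    (hg : g ∈ residualInertia O N) : ∃ j : O.decompositionSubgroup K, j.1 ∈ inertia K O ∧
      j⁻¹ * g ∈ N.fixingSubgroup.subgroupOf (O.decompositionSubgroup K) := by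
  obtain ⟨ρ, hρ, hρg⟩ := exists_decomposition_lift (K := N) (O := O) (g := (g.1 : Ω ≃+* Ω))
    (mem_decomposition_iff.mp g.2) (fun a ha => hg a a.2 ha)
  let ρ' : O.decompositionSubgroup K :=
    ⟨ρ.restrictScalars K, mem_decomposition_iff.mpr (mem_decomposition_iff.mp hρ)⟩
  refine ⟨g * ρ'⁻¹, ⟨Subtype.mem _, fun x hx => ?_⟩, ?_⟩
  · have hx' : ρ.symm x ∈ O := (mem_decomposition_iff.mp (inv_mem hρ) x).mpr hx
    have h1 := hρg _ hx'
    rw [AlgEquiv.apply_symm_apply, ← O.valuation.map_neg, neg_sub] at h1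
    exact h1
  · rw [mul_inv_rev, inv_inv, inv_mul_cancel_right]
    exact fun x => ρ.commutes x

theorem smul_residue_eq_of_mem_inertia {j : O.decompositionSubgroup K} (hj : j.1 ∈ inertia K O)
    (x : ResidueField O) : j • x = x := by
  obtain ⟨y, rfl⟩ := residue_surjective x
  rw [← ResidueField.residue_smul, residue_eq_iff]
  exact hj.2 y y.2

variable [Algebra.IsAlgebraic K Ω]

variable (O) in
/-- The wild inertia group of `N`. -/
def wildInertia (N : IntermediateField K Ω) [Normal K N] :
    Subgroup (O.decompositionSubgroup K) where
  carrier := {g | ∀ x ∈ N, x ≠ 0 → O.valuation (g.1 x - x) < O.valuation x}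
  one_mem' := fun x _ hx => by simpa [zero_lt_iff] using hx
  mul_mem' := by
    intro g h hg hh x hxN hx
    have h1 := hg (h.1 x) (apply_mem_of_normal N _ hxN) ((map_ne_zero _).mpr hx)
    rw [valuation_apply_of_mem_decomposition h.2] at h1
    have := O.valuation.map_add_lt h1 (hh x hxN hx)
    simpa using this
  inv_mem' := by
    intro g hg x hxN hx
    rw [← valuation_apply_of_mem_decomposition g.2, map_sub, ← O.valuation.map_neg, neg_sub]
    change O.valuation (g.1 x - g.1 (g.1.symm x)) < _
    rw [AlgEquiv.apply_symm_apply]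
    exact hg x hxN hx

variable (N : IntermediateField K Ω) [Normal K N]

instance wildInertia_normal : (wildInertia O N).Normal := by
  constructor
  intro w hw g x hxN hx
  have hx' : g.1.symm x ≠ 0 := (map_ne_zero _).mpr hx
  have h1 := hw (g.1.symm x) (apply_mem_of_normal N _ hxN) hx'
  rw [← valuation_apply_of_mem_decomposition g.2, map_sub,
    ← valuation_apply_of_mem_decomposition g.2 (g.1.symm x), AlgEquiv.apply_symm_apply] at h1
  exact h1

theorem wildInertia_le_residualInertia : wildInertia O N ≤ residualInertia O N := by
  intro g hg x hxN hx
  by_cases hx0 : x = 0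
  · simp [hx0]
  · exact (hg x hxN hx0).trans_le ((O.valuation_le_one_iff x).mpr hx)

theorem fixing_le_wildInertia : N.fixingSubgroup.subgroupOf (O.decompositionSubgroup K) ≤
    wildInertia O N := by
  intro g hg x hxN hx
  have h1 : g.1 x = x := hg ⟨x, hxN⟩
  rw [h1, sub_self, map_zero]
  exact zero_lt_iff.mpr ((map_ne_zero _).mpr hx)

/-- Since `g` fixes residues of N, the residue of g(y)/y is multiplicative along the powers of `g`.
-/
theorem valuation_pow_apply_div_sub_lt {g : O.decompositionSubgroup K}
    (hg : g ∈ residualInertia O N) {y : Ω} (hyN : y ∈ N) (hy : y ≠ 0) (n : ℕ) :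
    O.valuation ((g.1 ^ n) y / y - (g.1 y / y) ^ n) < 1 := by
  have hv : ∀ n : ℕ, O.valuation ((g.1 ^ n) y / y) = 1 := fun n => by
    rw [map_div₀, valuation_apply_of_mem_decomposition (pow_mem g.2 n),
      div_self ((map_ne_zero _).mpr hy)]
  induction n with
  | zero => simp [hy]
  | succ n ih =>
    have h1 := hg ((g.1 ^ n) y / y) (div_mem (apply_mem_of_normal N _ hyN) hyN)
      ((O.valuation_le_one_iff _).mp (hv n).le)
    have h2 : (g.1 ^ (n + 1)) y / y - (g.1 y / y) ^ (n + 1) =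
        (g.1 ((g.1 ^ n) y / y) - (g.1 ^ n) y / y + ((g.1 ^ n) y / y - (g.1 y / y) ^ n)) *
          (g.1 y / y) := by
      rw [sub_add_sub_cancel, sub_mul, ← pow_succ, map_div₀, pow_succ', AlgEquiv.mul_apply]
      have : g.1 y ≠ 0 := (map_ne_zero _).mpr hy
      field_simp
    have h3 := hv 1
    rw [pow_one] at h3
    rw [h2, map_mul, h3, mul_one]
    exact O.valuation.map_add_lt h1 ih

/-- A field of characteristic p has no non-trivial p-th roots of unity, so the residue of g(y)/y is
1 as soon as its p-th power is. -/
theorem mem_wildInertia_of_pow {p : ℕ} (hp : p.Prime) (hpO : O.valuation (p : Ω) < 1)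
    {g : O.decompositionSubgroup K} (hg : g ∈ residualInertia O N)
    (hgp : g ^ p ∈ wildInertia O N) : g ∈ wildInertia O N := by
  have := charP_residueField hp hpO
  have : Fact p.Prime := ⟨hp⟩
  intro y hyN hy
  have hvz : O.valuation (g.1 y / y) = 1 := by
    rw [map_div₀, valuation_apply_of_mem_decomposition g.2, div_self ((map_ne_zero _).mpr hy)]
  let z : O := ⟨g.1 y / y, (O.valuation_le_one_iff _).mp hvz.le⟩
  have h1 := valuation_pow_apply_div_sub_lt N hg hyN hy p
  have hy0 : 0 < O.valuation y := zero_lt_iff.mpr ((map_ne_zero _).mpr hy)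
  have h2 : O.valuation ((g.1 ^ p) y / y - 1) < 1 := by
    have h3 := hgp y hyN hy
    rw [show (g.1 ^ p) y / y - 1 = ((g.1 ^ p) y - y) / y by field_simp, map_div₀,
      div_lt_one₀ hy0]
    exact h3
  have h4 : O.valuation ((z ^ p : O) - (1 : O) : Ω) < 1 := by
    have := O.valuation.map_sub_lt h2 h1
    rw [sub_sub_sub_cancel_left] at this
    exact this
  rw [← residue_eq_iff, map_pow, map_one, ← sub_eq_zero, ← one_pow p, ← sub_pow_char,
    pow_eq_zero_iff hp.ne_zero, sub_eq_zero, ← map_one (residue O), residue_eq_iff] at h4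
  have h5 : (z : Ω) - (1 : O) = (g.1 y - y) / y := by
    change g.1 y / y - 1 = _
    field_simp
  rwa [h5, map_div₀, div_lt_one₀ hy0] at h4

/-- Wild inertia acts on N through a p-group. A power `g` of `w` of order prime to p on N that acts
non-trivially would have y ≠ 0 with vanishing sum of g^i(y) over i < m; wildness makes this sum
equal to m·y up to terms of smaller value, and m is a unit. -/
theorem exists_pow_mem_fixing [FiniteDimensional K N] {p : ℕ} (hp : p.Prime)
    (hpO : O.valuation (p : Ω) < 1) {w : O.decompositionSubgroup K} (hw : w ∈ wildInertia O N) :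
    ∃ k : ℕ, w ^ p ^ k ∈ N.fixingSubgroup.subgroupOf (O.decompositionSubgroup K) := by
  let r := AlgEquiv.restrictNormalHom (F := K) (K₁ := Ω) N
  have hr : ∀ (g : Ω ≃ₐ[K] Ω), r g = 1 → ∀ x ∈ N, g x = x := by
    intro g hg x hx
    have h : ((r g ⟨x, hx⟩ : N) : Ω) = g x := AlgEquiv.restrictNormal_commutes g N ⟨x, hx⟩
    rw [hg] at h
    exact h.symm
  obtain ⟨k, m, hm, hkm⟩ := Nat.exists_eq_pow_mul_and_not_dvd
    (orderOf_pos (r w.1)).ne' p hp.ne_one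
  refine ⟨k, fun x => ?_⟩
  let g := w ^ p ^ k
  have hgW : g ∈ wildInertia O N := pow_mem hw _
  have hgm : ∀ x ∈ N, (g.1 ^ m) x = x := by
    apply hr
    change r ((w.1 ^ p ^ k) ^ m) = 1
    rw [← pow_mul, ← hkm, map_pow, pow_orderOf_eq_one]
  by_contra hne
  have hm0 : O.valuation (m : Ω) = 1 := valuation_natCast_eq_one hp hpO hm
  have hm0' : (m : Ω) ≠ 0 := by
    rintro h
    simp [h] at hm0
  obtain ⟨y, hyN, hy, hsum⟩ := exists_sum_pow_apply_eq_zero N g.1 hm0' x.2 (hgm x x.2) hne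
  have h1 : ∑ i ∈ Finset.range m, ((g.1 ^ i) y - y) = - (m * y) := by
    rw [Finset.sum_sub_distrib, hsum]
    simp
  have h2 : O.valuation (∑ i ∈ Finset.range m, ((g.1 ^ i) y - y)) < O.valuation y := by
    refine O.valuation.map_sum_lt ((map_ne_zero _).mpr hy) fun i _ => ?_
    exact pow_mem hgW i y hyN hy
  rw [h1, O.valuation.map_neg, map_mul, hm0, one_mul] at h2
  exact lt_irrefl _ h2

end Wild

/-! ### The wild inertia in rank one -/

section Crux

variable {K : Type u} {Ω : Type v} [Field K] [Field Ω] [Algebra K Ω] {O : ValuationSubring Ω}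

instance finiteIndex_fixing (N : IntermediateField K Ω) [FiniteDimensional K N] [Normal K N] :
    (N.fixingSubgroup.subgroupOf (O.decompositionSubgroup K)).FiniteIndex := by
  have h : N.fixingSubgroup.FiniteIndex := by
    rw [← N.restrictNormalHom_ker]
    infer_instance
  infer_instance

instance normal_fixing (N : IntermediateField K Ω) [Normal K N] :
    (N.fixingSubgroup.subgroupOf (O.decompositionSubgroup K)).Normal := by
  have h : N.fixingSubgroup.Normal := by
    rw [← N.restrictNormalHom_ker]
    infer_instance
  infer_instance

theorem exists_finite_normal [IsGalois K Ω] (s : Finset Ω) :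
    ∃ N : IntermediateField K Ω, FiniteDimensional K N ∧ Normal K N ∧ ∀ x ∈ s, x ∈ N := by
  let F := IntermediateField.adjoin K (s : Set Ω)
  have hF : FiniteDimensional K F :=
    IntermediateField.finiteDimensional_adjoin fun x _ => Algebra.IsIntegral.isIntegral x
  refine ⟨IntermediateField.normalClosure K F Ω, inferInstance, inferInstance, fun x hx => ?_⟩
  exact F.le_normalClosure (IntermediateField.subset_adjoin K _ hx)

/-- At a finite normal level containing `s`, take a primitive element of the fixed field of the
image of X. -/
theorem exists_stabilizer_eq [IsGalois K Ω] (D : Subgroup (Ω ≃ₐ[K] Ω)) (X : Subgroup D)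
    (s : Finset Ω) (hs : ∀ g : D, (∀ x ∈ s, g.1 x = x) → g ∈ X) :
    ∃ θ : Ω, ∀ g : D, g.1 θ = θ ↔ g ∈ X := by
  obtain ⟨N, hfin, hnorm, hsN⟩ := exists_finite_normal (K := K) s
  let r := AlgEquiv.restrictNormalHom (F := K) (K₁ := Ω) N
  have hr : ∀ (g : Ω ≃ₐ[K] Ω) (x : N), ((r g x : N) : Ω) = g x := fun g x =>
    AlgEquiv.restrictNormal_commutes g N x
  let Y : Subgroup (N ≃ₐ[K] N) := (X.map D.subtype).map r
  obtain ⟨θ, hθ⟩ := Field.exists_primitive_element K (IntermediateField.fixedField Y)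
  have hmem : ∀ τ : N ≃ₐ[K] N, τ θ = θ ↔ τ ∈ Y := by
    intro τ
    conv_rhs => rw [← IntermediateField.fixingSubgroup_fixedField Y]
    constructor
    · intro h x
      have hx : x ∈ IntermediateField.adjoin K {θ} := by rw [hθ]; trivial
      have h2 : (x : N) ∈ IntermediateField.adjoin K {(θ : N)} := by
        have h3 := IntermediateField.lift_adjoin_simple K (IntermediateField.fixedField Y) θ
        rw [← h3, IntermediateField.mem_lift]
        exact hx
      exact apply_eq_of_mem_adjoin τ (by simpa using h) h2
    · intro h
      exact h θ
  refine ⟨(θ : N), fun g => ?_⟩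
  have h1 : g.1 (θ : N) = (θ : N) ↔ r g.1 θ = θ := by
    rw [← hr, Subtype.ext_iff]
  rw [h1, hmem]
  constructor
  · rintro ⟨_, ⟨h, hh, rfl⟩, hgh⟩
    have h2 : h⁻¹ * g ∈ X := by
      refine hs _ fun x hx => ?_
      have h3 := congrArg (fun τ : N ≃ₐ[K] N => ((τ ⟨x, hsN x hx⟩ : N) : Ω)) hgh
      have h4 : h.1 x = g.1 x := by
        simp only [hr] at h3
        exact h3
      change h.1.symm (g.1 x) = x
      rw [← h4, AlgEquiv.symm_apply_apply]
    simpa using mul_mem hh h2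
  · intro hg
    exact ⟨_, ⟨g, hg, rfl⟩, rfl⟩

/-- The residual character of `g` on the monoid of integral elements of `N`. -/
def residueHom (N : IntermediateField K Ω) (g : O.decompositionSubgroup K) :
    ((N.toSubfield.toSubring ⊓ O.toSubring : Subring Ω) : Type _) →* ResidueField O :=
  ((MulSemiringAction.toRingHom _ (ResidueField O) g).comp ((residue O).comp
    (Subring.inclusion (inf_le_right : N.toSubfield.toSubring ⊓ O.toSubring ≤ O.toSubring)))
    : _ →+* _)

theorem residueHom_apply (N : IntermediateField K Ω) (g : O.decompositionSubgroup K)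
    (x : (N.toSubfield.toSubring ⊓ O.toSubring : Subring Ω)) :
    residueHom N g x = g • residue O ⟨x, x.2.2⟩ := rfl

theorem residueHom_eq_iff (N : IntermediateField K Ω) [Normal K N]
    {g h : O.decompositionSubgroup K} :
    residueHom N g = residueHom N h ↔ h⁻¹ * g ∈ residualInertia O N := by
  have key : ∀ (x : Ω) (hx : x ∈ O), g • residue O ⟨x, hx⟩ = h • residue O ⟨x, hx⟩ ↔
      O.valuation ((h⁻¹ * g).1 x - x) < 1 := by
    intro x hx
    rw [← inv_smul_eq_iff, ← mul_smul, ← ResidueField.residue_smul, residue_eq_iff]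
    rfl
  constructor
  · intro heq x hxN hx
    rw [← key x hx, ← residueHom_apply N g ⟨x, hxN, hx⟩, heq, residueHom_apply]
  · intro hgh
    ext ⟨x, hxN, hx⟩
    rw [residueHom_apply, residueHom_apply, key]
    exact hgh x hxN hx

/-- By independence of characters it is enough that the character of the trivial coset has non-zero
multiplicity in Λ. The multiplicity is the order of residual inertia modulo wild inertia, which is
prime to p by Cauchy and `mem_wildInertia_of_pow`. -/
theorem exists_sum_residueHom_ne_zero [Algebra.IsAlgebraic K Ω] (N : IntermediateField K Ω)
    [Normal K N] {p : ℕ} (hp : p.Prime) (hpO : O.valuation (p : Ω) < 1)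
    [Fintype (O.decompositionSubgroup K ⧸ wildInertia O N)] :
    ∃ x, ∑ q : O.decompositionSubgroup K ⧸ wildInertia O N, residueHom N q.out x ≠ 0 := by
  classical
  have := charP_residueField hp hpO
  have : Fact p.Prime := ⟨hp⟩
  by_contra! hcon
  let ψ : O.decompositionSubgroup K ⧸ wildInertia O N → _ := fun q => residueHom N q.out
  have hsum : ∑ f ∈ Finset.univ.image ψ,
      (({q | ψ q = f} : Finset _).card : ResidueField O) • (f : _ → ResidueField O) = 0 := by
    ext x
    have h1 := Finset.sum_comp (s := Finset.univ) (fun f : _ →* ResidueField O => f x) ψ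
    have h2 := hcon x
    rw [h1] at h2
    simpa [Finset.sum_apply] using h2
  have hlin := linearIndependent_iff'.mp (linearIndependent_monoidHom
    ((N.toSubfield.toSubring ⊓ O.toSubring : Subring Ω) : Type _) (ResidueField O))
    (Finset.univ.image ψ) _ hsum (ψ 1) (Finset.mem_image_of_mem ψ (Finset.mem_univ _))
  rw [CharP.cast_eq_zero_iff (ResidueField O) p] at hlin
  let J := (residualInertia O N).map (QuotientGroup.mk' (wildInertia O N))
  have hJ : ∀ q, ψ q = ψ 1 ↔ q ∈ J := by
    intro q
    have h1 : (1 : O.decompositionSubgroup K ⧸ wildInertia O N).out ∈ wildInertia O N := by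
      rw [← QuotientGroup.eq_one_iff, QuotientGroup.out_eq']
    have h2 := wildInertia_le_residualInertia N h1
    simp only [ψ]
    rw [residueHom_eq_iff, Subgroup.mul_mem_cancel_left _ (inv_mem h2)]
    constructor
    · intro h
      exact ⟨q.out, h, QuotientGroup.out_eq' q⟩
    · rintro ⟨j, hj, rfl⟩
      have h3 : j⁻¹ * (QuotientGroup.mk' (wildInertia O N) j).out ∈ wildInertia O N := by
        rw [← QuotientGroup.eq]
        exact (QuotientGroup.out_eq' _).symm
      have := mul_mem hj (wildInertia_le_residualInertia N h3)
      rwa [mul_inv_cancel_left] at this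
  have hcard : ({q | ψ q = ψ 1} : Finset _).card = Fintype.card J := by
    rw [Fintype.card_subtype]
    simp only [hJ]
  rw [hcard] at hlin
  obtain ⟨⟨q, j, hj, rfl⟩, hq⟩ := exists_prime_orderOf_dvd_card p hlin
  have hjp : j ^ p ∈ wildInertia O N := by
    have h1 := congrArg Subtype.val (hq ▸ pow_orderOf_eq_one _)
    rw [← QuotientGroup.eq_one_iff]
    exact h1
  have hjW := mem_wildInertia_of_pow N hp hpO hj hjp
  have h1 : (⟨QuotientGroup.mk' (wildInertia O N) j, j, hj, rfl⟩ : J) = 1 :=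
    Subtype.ext ((QuotientGroup.eq_one_iff j).mpr hjW)
  rw [h1, orderOf_one] at hq
  exact hp.one_lt.ne hq

variable (K O) in
/-- The pro-order of the inertia group is prime to `p`: an element of `Ω` which is fixed by the
`p`-th power of an element of the inertia group is fixed by this element. -/
def NoPInertia (p : ℕ) : Prop :=
  ∀ σ ∈ inertia K O, ∀ x : Ω, (σ ^ p) x = x → σ x = x

theorem pow_apply_eq_iterate (σ : Ω ≃ₐ[K] Ω) (n : ℕ) (x : Ω) : (σ ^ n) x = σ^[n] x := by
  induction n generalizing x with
  | zero => rfl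
  | succ n ih => rw [pow_succ, AlgEquiv.mul_apply, ih, Function.iterate_succ_apply]

/-- Let p^k·m be the order of `σ` on a finite normal N containing `x`, with m prime to p. Applied
repeatedly, the hypothesis shows that σ^m is trivial on N; as σ^p also fixes `x` and m is prime to
p, `σ` fixes `x`. -/
theorem noPInertia_of_forall_normal [IsGalois K Ω] {p : ℕ} (hp : p.Prime)
    (h : ∀ σ ∈ inertia K O, ∀ N : IntermediateField K Ω, FiniteDimensional K N → Normal K N →
      (∀ x ∈ N, (σ ^ p) x = x) → ∀ x ∈ N, σ x = x) : NoPInertia K O p := by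
  intro σ hσ x hx
  obtain ⟨N, hfin, hnorm, hxN⟩ := exists_finite_normal (K := K) {x}
  let r := AlgEquiv.restrictNormalHom (F := K) (K₁ := Ω) N
  have hr : ∀ (g : Ω ≃ₐ[K] Ω), r g = 1 → ∀ x ∈ N, g x = x := by
    intro g hg x hx
    have h : ((r g ⟨x, hx⟩ : N) : Ω) = g x := AlgEquiv.restrictNormal_commutes g N ⟨x, hx⟩
    rw [hg] at h
    exact h.symm
  obtain ⟨k, m, hm, hkm⟩ := Nat.exists_eq_pow_mul_and_not_dvd (orderOf_pos (r σ)).ne' p hp.ne_one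
  have h1 : ∀ k : ℕ, (∀ x ∈ N, ((σ ^ m) ^ p ^ k) x = x) → ∀ x ∈ N, (σ ^ m) x = x := by
    intro k
    induction k with
    | zero => simp
    | succ k ih =>
      intro hk
      refine ih (h _ (pow_mem (pow_mem hσ m) _) N hfin hnorm ?_)
      rwa [← pow_mul, ← pow_succ]
  have h2 : (σ ^ m) x = x := by
    refine h1 k (hr _ ?_) x (hxN x (Finset.mem_singleton_self x))
    rw [← pow_mul, mul_comm, ← hkm, map_pow, pow_orderOf_eq_one]
  have h3 : Function.IsPeriodicPt σ (Nat.gcd p m) x := Function.IsPeriodicPt.gcd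
    ((pow_apply_eq_iterate σ p x).symm.trans hx) ((pow_apply_eq_iterate σ m x).symm.trans h2)
  rw [(Nat.Prime.coprime_iff_not_dvd hp).mpr hm] at h3
  exact h3

variable (K Ω) in
/-- No element of `Ω` has as its degree over `K` a non-trivial power of `p`. -/
def NoPDegree (p : ℕ) : Prop :=
  ∀ (β : Ω) (n : ℕ), (minpoly K β).natDegree = p ^ n → n = 0

/-- A wild element that is non-trivial on N produces an open subgroup of D of index p^(n+1). It is
the stabilizer of some θ, and the orbit of θ under D yields an element of degree p^(n+1) over K. -/
theorem noPInertia_of_isRankLeOne [IsGalois K Ω] [IsAlgClosed Ω] {p : ℕ} (hp : p.Prime)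
    (hpO : O.valuation (p : Ω) < 1) (hR : IsRankLeOne O) (hK : NoPDegree K Ω p) :
    NoPInertia K O p := by
  classical
  refine noPInertia_of_forall_normal hp fun σ hσ N hfin hnorm hσp => ?_
  by_contra! hcon
  obtain ⟨x, hxN, hx⟩ := hcon
  have := charP_residueField hp hpO
  have : Fact p.Prime := ⟨hp⟩
  have := isAlgClosed_residueField (O := O)
  let w : O.decompositionSubgroup K := ⟨σ, hσ.1⟩
  let F := N.fixingSubgroup.subgroupOf (O.decompositionSubgroup K)
  let W := wildInertia O N
  have hFW : F ≤ W := fixing_le_wildInertia N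
  have hwp : w ^ p ∈ F := fun y => hσp y y.2
  have hwW : w ∈ W :=
    mem_wildInertia_of_pow N hp hpO (fun y _ hy => hσ.2 y hy) (hFW hwp)
  have hwF : w ∉ F := fun h => hx (h ⟨x, hxN⟩)
  have hx0 : x ≠ 0 := by
    rintro rfl
    exact hx (map_zero σ)
  have hWfin : W.FiniteIndex := Subgroup.finiteIndex_of_le hFW
  let _ : Fintype (O.decompositionSubgroup K ⧸ W) := Fintype.ofFinite _
  have hWN : ∀ w ∈ W, ∃ j ∈ W, (∀ x : ResidueField O, j • x = x) ∧ j⁻¹ * w ∈ F := by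
    intro w hw
    obtain ⟨j, hj, hjw⟩ := exists_inertia_of_residualInertia N
      (wildInertia_le_residualInertia N hw)
    refine ⟨j, ?_, smul_residue_eq_of_mem_inertia hj, hjw⟩
    have := mul_mem hw (inv_mem (hFW hjw))
    simpa using this
  obtain ⟨⟨e, heN, heO⟩, he⟩ := exists_sum_residueHom_ne_zero (O := O) N hp hpO
  let S := ∑ q : O.decompositionSubgroup K ⧸ W, residueHom N q.out ⟨e, heN, heO⟩
  have hEq : ∀ (g : O.decompositionSubgroup K) (q : O.decompositionSubgroup K ⧸ W),
      g • residueHom N q.out ⟨e, heN, heO⟩ = residueHom N (g • q).out ⟨e, heN, heO⟩ := by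
    intro g q
    have h1 : residueHom N (g * q.out) = residueHom N (g • q).out := by
      rw [residueHom_eq_iff]
      apply wildInertia_le_residualInertia N
      rw [← QuotientGroup.eq, QuotientGroup.out_eq']
      conv_lhs => rw [← QuotientGroup.out_eq' q]
      rfl
    rw [← h1, residueHom_apply, residueHom_apply, mul_smul]
  have hS : ∀ g : O.decompositionSubgroup K, g • S = S := by
    intro g
    simp only [S, Finset.smul_sum, hEq]
    exact Fintype.sum_equiv (MulAction.toPerm g) _ _ fun q => rfl
  -- The conjugates of one residue with non-zero sum S, divided by S, are the required partition of
  -- unity permuted by D.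
  obtain ⟨X, n, hX, s, hs⟩ := exists_subgroup_index_prime_pow (G := O.decompositionSubgroup K)
    (p := p) (N := F) (W := W) (Λ := ResidueField O) hFW
    (fun w hw => exists_pow_mem_fixing N hp hpO hw) hwW hwF hWN
    (fun q => residueHom N q.out ⟨e, heN, heO⟩ / S)
    (fun g q => by rw [div_eq_mul_inv, smul_mul', smul_inv'', hS, hEq, div_eq_mul_inv])
    (by rw [← Finset.sum_div]; exact div_self he)
  obtain ⟨l, hl⟩ := residue_surjective.hasRightInverse (f := residue O)
  obtain ⟨t, ht⟩ : ∃ t : Finset Ω, IntermediateField.adjoin K (t : Set Ω) = N :=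
    IntermediateField.fg_of_fg_toSubalgebra N
      ((Subalgebra.fg_iff_finiteType _).mpr (inferInstanceAs (Algebra.FiniteType K N)))
  -- Fixing generators of N and lifts of the residues in `s` forces membership in X.
  obtain ⟨θ, hθ⟩ := exists_stabilizer_eq (O.decompositionSubgroup K) X
    (t ∪ s.image fun a => (l a : Ω)) (by
      intro g hg
      refine hs g ?_ fun a ha => ?_
      · rintro ⟨y, hy⟩
        rw [← ht] at hy
        exact apply_eq_of_mem_adjoin g.1
          (fun z hz => hg z (Finset.mem_union_left _ hz)) hy
      · have h1 := hg (l a) (Finset.mem_union_right _ (Finset.mem_image_of_mem _ ha))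
        rw [← hl a, ← ResidueField.residue_smul]
        congr 1
        exact Subtype.ext h1)
  let R := MulAction.orbit (O.decompositionSubgroup K) θ
  have hstab : MulAction.stabilizer (O.decompositionSubgroup K) θ = X := by
    ext g
    exact hθ g
  have hcard : R.ncard = p ^ (n + 1) := by
    rw [← MulAction.index_stabilizer, hstab, hX]
  have hRfin : R.Finite := Set.finite_of_ncard_pos (by rw [hcard]; exact pow_pos hp.pos _)
  have hv := hwW x hxN hx0
  obtain ⟨β, hβ⟩ := exists_natDegree_minpoly_eq_card (K := K) hR (π := (σ x - x) / x)
    (div_ne_zero (sub_ne_zero.mpr hx) hx0)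
    (by rw [map_div₀, div_lt_one₀ (zero_lt_iff.mpr ((map_ne_zero _).mpr hx0))]; exact hv)
    hRfin.toFinset (r₀ := θ) (hRfin.mem_toFinset.mpr (MulAction.mem_orbit_self θ))
    (by
      intro τ hτ r hr
      rw [Set.Finite.mem_toFinset] at hr ⊢
      exact MulAction.mem_orbit_of_mem_orbit (⟨τ, hτ⟩ : O.decompositionSubgroup K) hr)
    (by
      intro r hr
      rw [Set.Finite.mem_toFinset] at hr
      obtain ⟨τ, rfl⟩ := hr
      exact ⟨τ.1, τ.2, rfl⟩)
  rw [← Set.ncard_eq_toFinset_card R hRfin, hcard] at hβ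
  exact absurd (hK β _ hβ) (Nat.succ_ne_zero n)

end Crux

/-! ### Roots, perfectness, and the tame part of the inertia -/

section Tame

variable {K : Type u} {Ω : Type v} [Field K] [Field Ω] [Algebra K Ω] {O : ValuationSubring Ω}

theorem NoPDegree.exists_pow_eq [IsAlgClosed Ω] {p : ℕ} (hp : p.Prime) (hK : NoPDegree K Ω p)
    (a : K) : ∃ b : K, b ^ p = a := by
  by_contra! hcon
  have hirr := X_pow_sub_C_irreducible_of_prime hp hcon
  obtain ⟨β, hβ⟩ := IsAlgClosed.exists_aeval_eq_zero Ω _ hirr.degree_pos.ne'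
  have h1 := minpoly.eq_of_irreducible_of_monic hirr hβ (Polynomial.monic_X_pow_sub_C a hp.ne_zero)
  have h2 := hK β 1 (by rw [← h1, Polynomial.natDegree_X_pow_sub_C, pow_one])
  exact one_ne_zero h2

theorem NoPDegree.exists_pow_pow_eq [IsAlgClosed Ω] {p : ℕ} (hp : p.Prime) (hK : NoPDegree K Ω p)
    (e : ℕ) (a : K) : ∃ b : K, b ^ p ^ e = a := by
  induction e generalizing a with
  | zero => exact ⟨a, by simp⟩
  | succ e ih =>
    obtain ⟨b, rfl⟩ := hK.exists_pow_eq hp a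
    obtain ⟨c, rfl⟩ := ih b
    exact ⟨c, by rw [← pow_mul, pow_succ]⟩

/-- A positive characteristic of K must be p, because p is not a unit in `O`. Then the p-th roots
make K perfect. -/
theorem NoPDegree.isGalois [IsAlgClosed Ω] [Algebra.IsAlgebraic K Ω] {p : ℕ} (hp : p.Prime)
    (hpO : O.valuation (p : Ω) < 1) (hK : NoPDegree K Ω p) : IsGalois K Ω := by
  have hperf : PerfectField K := by
    obtain ⟨q, hq⟩ := CharP.exists K
    by_cases hq0 : q = 0
    · subst hq0
      have := CharP.charP_to_charZero K
      infer_instance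
    · have hqp : q.Prime := (CharP.char_is_prime_or_zero K q).resolve_right hq0
      have hpq : p = q := by
        by_contra hne
        have h1 := valuation_natCast_eq_one hp hpO (m := q)
          (fun h => hne ((Nat.prime_dvd_prime_iff_eq hp hqp).mp h))
        have h2 : (q : Ω) = 0 := by
          rw [← map_natCast (algebraMap K Ω), CharP.cast_eq_zero, map_zero]
        simp [h2] at h1
      subst hpq
      have : ExpChar K p := ExpChar.prime hp
      have : PerfectRing K p := PerfectRing.ofSurjective K p fun a => hK.exists_pow_eq hp a
      exact PerfectRing.toPerfectField K p
  have : Normal K Ω := normal_iff.mpr fun x =>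
    ⟨Algebra.IsIntegral.isIntegral x, IsAlgClosed.splits _⟩
  constructor

theorem exists_valuation_sum_eq {ι : Type*} {s : Finset ι} (hs : s.Nonempty)
    {f : ι → Ω} (hinj : ∀ i ∈ s, ∀ j ∈ s, O.valuation (f i) = O.valuation (f j) → i = j) :
    ∃ i ∈ s, O.valuation (∑ j ∈ s, f j) = O.valuation (f i) := by
  classical
  obtain ⟨i, hi, hmax⟩ := s.exists_max_image (fun i => O.valuation (f i)) hs
  refine ⟨i, hi, O.valuation.map_sum_eq_of_lt hi fun j hj => ?_⟩
  rw [Finset.mem_sdiff, Finset.mem_singleton] at hj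
  exact lt_of_le_of_ne (hmax j hj.1) fun h => hj.2 (hinj j hj.1 i hi h)

/-- In an algebraic equation for `y`, two terms must have equal value; otherwise the sum could not
vanish. -/
theorem exists_pow_valuation_eq [Algebra.IsAlgebraic K Ω] {y : Ω} (hy : y ≠ 0) :
    ∃ k : ℕ, 0 < k ∧ ∃ b : K, O.valuation (y ^ k) = O.valuation (algebraMap K Ω b) := by
  by_contra! hcon
  let f := minpoly K y
  have hf : f ≠ 0 := minpoly.ne_zero (Algebra.IsIntegral.isIntegral y)
  have hy0 : O.valuation y ≠ 0 := (map_ne_zero _).mpr hy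
  have key : ∀ i j : ℕ, f.coeff j ≠ 0 → i < j →
      O.valuation (algebraMap K Ω (f.coeff i) * y ^ i) ≠
      O.valuation (algebraMap K Ω (f.coeff j) * y ^ j) := by
    intro i j hj hij h
    apply hcon (j - i) (Nat.sub_pos_of_lt hij) (f.coeff i / f.coeff j)
    have hj' : O.valuation (algebraMap K Ω (f.coeff j)) ≠ 0 :=
      (map_ne_zero _).mpr ((map_ne_zero _).mpr hj)
    rw [map_div₀, map_div₀, eq_div_iff hj']
    apply mul_right_cancel₀ (pow_ne_zero i hy0)
    rw [← map_pow, ← map_mul, ← map_mul, ← map_mul, h]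
    congr 1
    rw [show y ^ j = y ^ (j - i) * y ^ i by rw [← pow_add, Nat.sub_add_cancel hij.le]]
    ring
  obtain ⟨i, hi, h⟩ := exists_valuation_sum_eq (O := O) (s := f.support)
    (f := fun i => algebraMap K Ω (f.coeff i) * y ^ i)
    (Polynomial.support_nonempty.mpr hf) (by
      intro i hi j hj h
      rw [Polynomial.mem_support_iff] at hi hj
      rcases lt_trichotomy i j with hij | hij | hij
      · exact absurd h (key i j hj hij)
      · exact hij
      · exact absurd h.symm (key j i hi hij))
  have h1 : ∑ i ∈ f.support, algebraMap K Ω (f.coeff i) * y ^ i = 0 := by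
    have := minpoly.aeval K y
    rwa [Polynomial.aeval_def, Polynomial.eval₂_eq_sum, Polynomial.sum_def] at this
  rw [h1, map_zero, eq_comm, map_eq_zero] at h
  rw [Polynomial.mem_support_iff] at hi
  exact mul_ne_zero ((map_ne_zero _).mpr hi) (pow_ne_zero i hy) h

/-- When p is a unit, a non-trivial `σ` gives `y` whose residue ζ of σ(y)/y satisfies ζ^p = 1 and ζ
≠ 1. Some power of `y` has its value in the value group of K; since K has p-th roots, the exponent
may be taken to be an m prime to p. Then y^m is a unit times an element of K, and inertia forces ζ^m
= 1, a contradiction. -/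
theorem apply_eq_of_valuation_eq_one [IsGalois K Ω] [IsAlgClosed Ω] {p : ℕ} (hp : p.Prime)
    (hpO : O.valuation (p : Ω) = 1) (hK : NoPDegree K Ω p) {σ : Ω ≃ₐ[K] Ω}
    (hσ : σ ∈ inertia K O) (N : IntermediateField K Ω) [Normal K N]
    (hσp : ∀ x ∈ N, (σ ^ p) x = x) : ∀ x ∈ N, σ x = x := by
  by_contra! hcon
  obtain ⟨x, hxN, hx⟩ := hcon
  have hp0 : (p : Ω) ≠ 0 := by
    intro h
    simp [h] at hpO
  obtain ⟨y, hyN, hy, hsum⟩ := exists_sum_pow_apply_eq_zero N σ hp0 hxN (hσp x hxN) hx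
  let g : O.decompositionSubgroup K := ⟨σ, hσ.1⟩
  have hg : g ∈ residualInertia O N := fun z _ hz => hσ.2 z hz
  have hv : ∀ n : ℕ, O.valuation ((σ ^ n) y / y) = 1 := fun n => by
    rw [map_div₀, valuation_apply_of_mem_decomposition (pow_mem hσ.1 n),
      div_self ((map_ne_zero _).mpr hy)]
  let z : ℕ → O := fun n => ⟨(σ ^ n) y / y, (O.valuation_le_one_iff _).mp (hv n).le⟩
  let ζ := residue O (z 1)
  have hz : ∀ n, residue O (z n) = ζ ^ n := by
    intro n
    rw [← map_pow, residue_eq_iff]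
    have := valuation_pow_apply_div_sub_lt N hg hyN hy n
    simpa [z] using this
  have hζp : ζ ^ p = 1 := by
    rw [← hz, ← map_one (residue O)]
    congr 1
    apply Subtype.ext
    change (σ ^ p) y / y = 1
    rw [hσp y hyN, div_self hy]
  have hζsum : ∑ i ∈ Finset.range p, ζ ^ i = 0 := by
    simp only [← hz]
    rw [← map_sum, ← map_zero (residue O)]
    congr 1
    apply Subtype.ext
    have : ((∑ i ∈ Finset.range p, z i : O) : Ω) = ∑ i ∈ Finset.range p, ((σ ^ i) y / y) := by
      push_cast
      rfl
    rw [this, ← Finset.sum_div, hsum, zero_div]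
    rfl
  have hζ1 : ζ ≠ 1 := by
    intro h
    rw [h] at hζsum
    simp only [one_pow, Finset.sum_const, Finset.card_range, nsmul_eq_mul, mul_one] at hζsum
    exact absurd (natCast_residue_eq_zero_iff.mp hζsum) hpO.not_lt
  obtain ⟨k, hk, b, hb⟩ := exists_pow_valuation_eq (K := K) (O := O) hy
  obtain ⟨e, m, hm, rfl⟩ := Nat.exists_eq_pow_mul_and_not_dvd hk.ne' p hp.ne_one
  obtain ⟨c, rfl⟩ := hK.exists_pow_pow_eq hp e b
  have hc : O.valuation (y ^ m) = O.valuation (algebraMap K Ω c) := by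
    rw [mul_comm, pow_mul, map_pow O.valuation (y ^ m), map_pow (algebraMap K Ω),
      map_pow O.valuation (algebraMap K Ω c)] at hb
    exact (pow_left_inj₀ zero_le zero_le (pow_ne_zero e hp.ne_zero)).mp hb
  have hc0 : algebraMap K Ω c ≠ 0 := by
    intro h
    rw [h, map_zero, map_eq_zero] at hc
    exact pow_ne_zero m hy hc
  have hu1 : O.valuation (y ^ m / algebraMap K Ω c) = 1 := by
    rw [map_div₀, hc, div_self ((map_ne_zero _).mpr hc0)]
  have hu := hσ.2 (y ^ m / algebraMap K Ω c) ((O.valuation_le_one_iff _).mp hu1.le)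
  have h1 : σ (y ^ m / algebraMap K Ω c) - y ^ m / algebraMap K Ω c =
      (y ^ m / algebraMap K Ω c) * ((σ y / y) ^ m - 1) := by
    rw [map_div₀, map_pow, σ.commutes, div_pow]
    field_simp
  rw [h1, map_mul, hu1, one_mul] at hu
  have hζm : ζ ^ m = 1 := by
    rw [← map_pow, ← map_one (residue O), residue_eq_iff]
    simpa [z] using hu
  apply hζ1
  have h2 := Nat.dvd_gcd (orderOf_dvd_of_pow_eq_one hζp) (orderOf_dvd_of_pow_eq_one hζm)
  rw [(Nat.Prime.coprime_iff_not_dvd hp).mpr hm, Nat.dvd_one, orderOf_eq_one_iff] at h2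
  exact h2

end Tame

/-! ### Composition of valuations -/

section Composite

variable {K : Type u} {Ω : Type v} [Field K] [Field Ω] [Algebra K Ω] {S T : ValuationSubring Ω}

theorem valuation_lt_one_iff_inv {x : Ω} : S.valuation x < 1 ↔ x = 0 ∨ x⁻¹ ∉ S := by
  rw [← ValuationSubring.mem_nonunits_iff, ValuationSubring.mem_nonunits_iff_or]

theorem valuation_lt_one_of_le (h : S ≤ T) {x : Ω} (hx : T.valuation x < 1) :
    S.valuation x < 1 := by
  rw [valuation_lt_one_iff_inv] at hx ⊢
  exact hx.imp_right fun h' h'' => h' (h h'')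

/-- Elements of the decomposition group of S preserve S-values, so τ(x)/x is in S and hence in T. -/
theorem mem_decomposition_of_le [Algebra.IsAlgebraic K Ω] (h : S ≤ T) {σ : Ω ≃ₐ[K] Ω}
    (hσ : σ ∈ S.decompositionSubgroup K) : σ ∈ T.decompositionSubgroup K := by
  have key : ∀ τ ∈ S.decompositionSubgroup K, ∀ x ∈ T, τ x ∈ T := by
    intro τ hτ x hx
    by_cases hx0 : x = 0
    · simp [hx0]
    · have h1 : S.valuation (τ x / x) = 1 := by
        rw [map_div₀, valuation_apply_of_mem_decomposition hτ,
          div_self ((map_ne_zero _).mpr hx0)]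
      have h2 := mul_mem (h ((S.valuation_le_one_iff _).mp h1.le)) hx
      rwa [div_mul_cancel₀ _ hx0] at h2
  refine mem_decomposition_iff.mpr fun x => ⟨fun hx => ?_, key σ hσ x⟩
  have := key σ⁻¹ (inv_mem hσ) _ hx
  rwa [← AlgEquiv.mul_apply, inv_mul_cancel] at this

variable (S T) in
/-- The image of `S` in the residue field of `T`. -/
def residueSubring : ValuationSubring (ResidueField T) where
  toSubring := (S.toSubring.comap T.subtype).map (residue T)
  mem_or_inv_mem' := by
    intro z
    obtain ⟨x, rfl⟩ := residue_surjective z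
    by_cases hx : IsUnit x
    · obtain ⟨y, rfl⟩ := hx
      rcases S.mem_or_inv_mem (y : Ω) with h | h
      · exact Or.inl ⟨y, h, rfl⟩
      · refine Or.inr ⟨(y⁻¹ : Tˣ), ?_, ?_⟩
        · have : (((y⁻¹ : Tˣ) : T) : Ω) = ((y : T) : Ω)⁻¹ := by
            apply eq_inv_of_mul_eq_one_left
            exact congrArg Subtype.val y.inv_mul
          change (((y⁻¹ : Tˣ) : T) : Ω) ∈ S
          rwa [this]
        · apply eq_inv_of_mul_eq_one_left
          rw [← map_mul, Units.inv_mul, map_one]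
    · refine Or.inl ⟨0, zero_mem S, ?_⟩
      rw [map_zero, eq_comm, residue_eq_zero_iff]
      exact hx

theorem residue_mem_residueSubring (h : S ≤ T) {x : T} :
    residue T x ∈ residueSubring S T ↔ (x : Ω) ∈ S := by
  constructor
  · rintro ⟨y, hy, hxy⟩
    have h1 := valuation_lt_one_of_le h (residue_eq_iff.mp hxy)
    have h2 := sub_mem (show (y : Ω) ∈ S from hy) ((S.valuation_le_one_iff _).mp h1.le)
    rwa [sub_sub_cancel] at h2
  · intro hx
    exact ⟨x, hx, rfl⟩

theorem valuation_residue_lt_one (h : S ≤ T) {x : T} :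
    (residueSubring S T).valuation (residue T x) < 1 ↔ S.valuation (x : Ω) < 1 := by
  rw [valuation_lt_one_iff_inv, valuation_lt_one_iff_inv]
  by_cases hx : IsUnit x
  · obtain ⟨y, rfl⟩ := hx
    have h1 : (((y⁻¹ : Tˣ) : T) : Ω) = ((y : T) : Ω)⁻¹ := by
      apply eq_inv_of_mul_eq_one_left
      exact congrArg Subtype.val y.inv_mul
    have h2 : (residue T (y : T))⁻¹ = residue T ((y⁻¹ : Tˣ) : T) := by
      symm
      apply eq_inv_of_mul_eq_one_left
      rw [← map_mul, Units.inv_mul, map_one]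
    have h3 : residue T (y : T) ≠ 0 := (residue_ne_zero_iff_isUnit _).mpr y.isUnit
    have h4 : ((y : T) : Ω) ≠ 0 := fun h0 => h3 (by
      rw [show (y : T) = 0 from Subtype.ext h0, map_zero])
    rw [h2, residue_mem_residueSubring h, h1]
    simp [h3, h4]
  · have h1 : residue T x = 0 := (residue_eq_zero_iff _).mpr hx
    have h2 := valuation_lt_one_of_le h ((T.valuation_lt_one_iff x).mp hx)
    rw [valuation_lt_one_iff_inv] at h2
    exact ⟨fun _ => h2, fun _ => Or.inl h1⟩

/-- The valuation ring obtained from `S` by inverting an element `t`. -/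
def invertElement (S : ValuationSubring Ω) {t : Ω} (ht : t ∈ S) : ValuationSubring Ω :=
  ValuationSubring.ofLE S
    { carrier := {z | ∃ n : ℕ, z * t ^ n ∈ S}
      zero_mem' := ⟨0, by simp⟩
      one_mem' := ⟨0, by simp⟩
      mul_mem' := by
        rintro a b ⟨m, hm⟩ ⟨n, hn⟩
        refine ⟨m + n, ?_⟩
        rw [pow_add, mul_mul_mul_comm]
        exact mul_mem hm hn
      add_mem' := by
        rintro a b ⟨m, hm⟩ ⟨n, hn⟩
        refine ⟨m + n, ?_⟩
        have := add_mem (mul_mem hm (pow_mem ht n)) (mul_mem hn (pow_mem ht m))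
        convert! this using 1
        ring
      neg_mem' := by
        rintro a ⟨m, hm⟩
        exact ⟨m, by rw [neg_mul]; exact neg_mem hm⟩ }
    (fun x hx => ⟨0, by simpa using hx⟩)

theorem mem_invertElement {t : Ω} (ht : t ∈ S) {z : Ω} :
    z ∈ invertElement S ht ↔ ∃ n : ℕ, z * t ^ n ∈ S := Iff.rfl

/-- Inverting in S a lift of `x` gives a strictly larger ring, which contains T by minimality; so
some power of `x` absorbs the denominator `c`. -/
theorem isRankLeOne_residueSubring (h : S < T) (hmin : ∀ U, S < U → T ≤ U) :
    IsRankLeOne (residueSubring S T) := by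
  intro x c hx hc
  obtain ⟨x, rfl⟩ := residue_surjective x
  obtain ⟨c, rfl⟩ := residue_surjective c
  rw [valuation_residue_lt_one h.le] at hx
  rw [residue_ne_zero_iff_isUnit] at hc
  obtain ⟨c, rfl⟩ := hc
  by_cases hx0 : (x : Ω) = 0
  · refine ⟨1, ?_⟩
    rw [show x = 0 from Subtype.ext hx0, map_zero, map_zero]
    simp
  · have hxS : (x : Ω) ∈ S := (S.valuation_le_one_iff _).mp hx.le
    have hxinv : (x : Ω)⁻¹ ∉ S := (valuation_lt_one_iff_inv.mp hx).resolve_left hx0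
    have hlt : S < invertElement S hxS := by
      refine lt_of_le_of_ne (fun z hz => ⟨0, by simpa using hz⟩) fun heq => hxinv ?_
      rw [heq, mem_invertElement]
      exact ⟨1, by rw [pow_one, inv_mul_cancel₀ hx0]; exact one_mem S⟩
    obtain ⟨n, hn⟩ := hmin _ hlt ((c⁻¹ : Tˣ) : T).2
    refine ⟨n, ?_⟩
    have h1 : residue T (((c⁻¹ : Tˣ) : T) * x ^ n) ∈ residueSubring S T := by
      rw [residue_mem_residueSubring h.le]
      exact hn
    rw [← ValuationSubring.valuation_le_one_iff] at h1
    have h2 : residue T (x ^ n) = residue T (c : T) * residue T (((c⁻¹ : Tˣ) : T) * x ^ n) := by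
      rw [← map_mul, ← mul_assoc, Units.mul_inv, one_mul]
    rw [← map_pow, ← map_pow, h2, map_mul]
    exact mul_le_of_le_one_right' h1

variable (K S) in
/-- The residue field of `S` as an extension of the residue field of `S ∩ K`. -/
@[reducible] def residueAlgebra :
    Algebra (ResidueField (S.comap (algebraMap K Ω))) (ResidueField S) :=
  (ResidueField.map (comapHom K S)).toAlgebra

theorem aeval_residue (α : S) (g : (S.comap (algebraMap K Ω))[X]) :
    letI := residueAlgebra K S
    Polynomial.aeval (residue S α) (g.map (residue (S.comap (algebraMap K Ω)))) =
      residue S ((g.map (comapHom K S)).eval α) := by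
  let := residueAlgebra K S
  rw [Polynomial.aeval_def, Polynomial.eval₂_map, Polynomial.eval_map, Polynomial.hom_eval₂]
  rfl

theorem isAlgebraic_residueField [Algebra.IsAlgebraic K Ω] :
    letI := residueAlgebra K S
    Algebra.IsAlgebraic (ResidueField (S.comap (algebraMap K Ω))) (ResidueField S) := by
  let := residueAlgebra K S
  constructor
  intro z
  obtain ⟨α, rfl⟩ := residue_surjective z
  obtain ⟨f, hf, hfα⟩ := Algebra.IsAlgebraic.isAlgebraic (R := K) (α : Ω)
  obtain ⟨j, hj, hij⟩ := exists_dominant_coeff (O := S) f hf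
  let A := S.comap (algebraMap K Ω)
  let g := Polynomial.C (f.coeff j)⁻¹ * f
  have hgc : ∀ i, g.coeff i = f.coeff i / f.coeff j := fun i => by
    simp only [g, Polynomial.coeff_C_mul]
    rw [div_eq_inv_mul]
  have hg : g ∈ Polynomial.lifts A.subtype := by
    rw [Polynomial.lifts_iff_coeff_lifts]
    intro i
    refine ⟨⟨g.coeff i, ?_⟩, rfl⟩
    change algebraMap K Ω (g.coeff i) ∈ S
    rw [hgc, ← ValuationSubring.valuation_le_one_iff]
    exact (hij i).1
  obtain ⟨G, hG⟩ := hg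
  have hG' : G.map A.subtype = g := hG
  refine ⟨G.map (residue A), fun h0 => ?_, ?_⟩
  · have h1 : (G.map (residue A)).coeff j = 1 := by
      have h2 : G.coeff j = 1 := by
        apply Subtype.ext
        have := congrArg (fun q => Polynomial.coeff q j) hG'
        simp only [Polynomial.coeff_map, hgc, div_self hj] at this
        exact this
      rw [Polynomial.coeff_map, h2, map_one]
    rw [h0] at h1
    simp at h1
  · rw [aeval_residue]
    have h3 : (G.map (comapHom K S)).IsRoot α := by
      rw [isRoot_comapHom, hG', Polynomial.eval_map, ← Polynomial.aeval_def]
      simp [g, hfα]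
    rw [h3.eq_zero, map_zero]

/-- A monic lift of an irreducible polynomial over the residue field is irreducible over the
valuation ring of K, and by Gauss's lemma over K, with the same degree. -/
theorem noPDegree_residueField [IsAlgClosed Ω] {p : ℕ} (hK : NoPDegree K Ω p)
    [Algebra.IsAlgebraic K Ω] :
    letI := residueAlgebra K S
    NoPDegree (ResidueField (S.comap (algebraMap K Ω))) (ResidueField S) p := by
  let := residueAlgebra K S
  have := isAlgebraic_residueField (K := K) (S := S)
  intro β n hn
  let A := S.comap (algebraMap K Ω)
  have hint : IsIntegral (ResidueField A) β := Algebra.IsIntegral.isIntegral β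
  obtain ⟨f, hf, hdeg, hfm⟩ := Polynomial.lifts_and_natDegree_eq_and_monic
    (Polynomial.mem_lifts_of_surjective (residue_surjective (R := A)) (minpoly _ β))
    (minpoly.monic hint)
  have hirr : Irreducible f := by
    refine hfm.irreducible_of_irreducible_map (residue A) _ ?_
    rw [hf]
    exact minpoly.irreducible hint
  have hirrK := (hfm.irreducible_iff_irreducible_map_fraction_map (K := K)).mp hirr
  obtain ⟨γ, hγ⟩ := IsAlgClosed.exists_aeval_eq_zero Ω _ hirrK.degree_pos.ne'
  have h1 := minpoly.eq_of_irreducible_of_monic hirrK hγ (hfm.map _)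
  refine hK γ n ?_
  rw [← h1, hfm.natDegree_map, hdeg, hn]

variable (S) in
/-- The automorphism of the residue field induced by an element of the decomposition group. -/
def residueAut (σ : S.decompositionSubgroup K) :
    letI := residueAlgebra K S
    ResidueField S ≃ₐ[ResidueField (S.comap (algebraMap K Ω))] ResidueField S :=
  letI := residueAlgebra K S
  AlgEquiv.ofRingEquiv (f := MulSemiringAction.toRingEquiv _ (ResidueField S) σ) (by
    intro z
    obtain ⟨a, rfl⟩ := residue_surjective z
    change σ • residue S (comapHom K S a) = residue S (comapHom K S a)
    rw [← ResidueField.residue_smul]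
    congr 1
    exact Subtype.ext (σ.1.commutes (a : K)))

theorem residueAut_apply (σ : S.decompositionSubgroup K) (x : ResidueField S) :
    residueAut S σ x = σ • x := rfl

theorem residueAut_pow_apply (σ : S.decompositionSubgroup K) (n : ℕ) (x : ResidueField S) :
    letI := residueAlgebra K S
    (residueAut S σ ^ n) x = σ ^ n • x := by
  let := residueAlgebra K S
  induction n generalizing x with
  | zero => simp
  | succ n ih => rw [pow_succ, AlgEquiv.mul_apply, ih, residueAut_apply, pow_succ, mul_smul]

theorem residueAut_mem_inertia [Algebra.IsAlgebraic K Ω] (h : S ≤ T) {σ : Ω ≃ₐ[K] Ω}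
    (hσ : σ ∈ inertia K S) :
    letI := residueAlgebra K T
    residueAut T ⟨σ, mem_decomposition_of_le h hσ.1⟩ ∈
      inertia (ResidueField (T.comap (algebraMap K Ω))) (residueSubring S T) := by
  let := residueAlgebra K T
  refine ⟨mem_decomposition_iff.mpr fun z => ?_, fun z hz => ?_⟩
  · obtain ⟨x, rfl⟩ := residue_surjective z
    rw [residueAut_apply, ← ResidueField.residue_smul, residue_mem_residueSubring h,
      residue_mem_residueSubring h]
    exact mem_decomposition_iff.mp hσ.1 x
  · obtain ⟨x, rfl⟩ := residue_surjective z
    rw [residue_mem_residueSubring h] at hz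
    rw [residueAut_apply, ← ResidueField.residue_smul, ← map_sub, valuation_residue_lt_one h]
    exact hσ.2 x hz

/-- Wild inertia at `S` comes from wild inertia at the minimal valuation ring above `S`. -/
theorem exists_inertia_of_lt [IsGalois K Ω] [IsAlgClosed Ω] {p : ℕ} (hp : p.Prime)
    (hpS : S.valuation (p : Ω) < 1) (hK : NoPDegree K Ω p) (h : S < T)
    (hmin : ∀ U, S < U → T ≤ U) {σ : Ω ≃ₐ[K] Ω} (hσ : σ ∈ inertia K S)
    (N : IntermediateField K Ω) [Normal K N] (hσp : ∀ x ∈ N, (σ ^ p) x = x) :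
    ∃ τ ∈ inertia K T, ∀ x ∈ N, τ x = σ x := by
  let := residueAlgebra K T
  have := isAlgebraic_residueField (K := K) (S := T)
  have := isAlgClosed_residueField (O := T)
  have hpT : (residueSubring S T).valuation (p : ResidueField T) < 1 := by
    rw [← map_natCast (residue T), valuation_residue_lt_one h.le]
    exact hpS
  have hPC := noPDegree_residueField (S := T) hK
  have := hPC.isGalois hp hpT
  have hno := noPInertia_of_isRankLeOne hp hpT (isRankLeOne_residueSubring h hmin) hPC
  let σ' : T.decompositionSubgroup K := ⟨σ, mem_decomposition_of_le h.le hσ.1⟩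
  have hσ' : σ' ∈ residualInertia T N := by
    intro x hxN hx
    -- As σ^p is trivial on N, the rank one case on the residue field of T shows that `σ` fixes the
    -- T-residues of N.
    have h1 := hno _ (residueAut_mem_inertia h.le hσ) (residue T ⟨x, hx⟩) (by
      rw [residueAut_pow_apply, ← ResidueField.residue_smul]
      congr 1
      exact Subtype.ext (hσp x hxN))
    rw [residueAut_apply, ← ResidueField.residue_smul, residue_eq_iff] at h1
    exact h1
  obtain ⟨j, hj, hjσ⟩ := exists_inertia_of_residualInertia N hσ'
  refine ⟨j.1, hj, fun x hx => ?_⟩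
  have h2 : j.1.symm (σ x) = x := hjσ ⟨x, hx⟩
  rw [← h2, AlgEquiv.apply_symm_apply, h2]

end Composite

/-! ### Finiteness of the rank -/

section FiniteRank

variable {Ω : Type v} [Field Ω] {S T : ValuationSubring Ω}

theorem valuation_eq_of_le (h : S ≤ T) {x y : Ω} (hxy : S.valuation x = S.valuation y) :
    T.valuation x = T.valuation y := by
  rw [← ValuationSubring.mapOfLE_valuation_apply S T h, hxy,
    ValuationSubring.mapOfLE_valuation_apply]

/-- The non-zero elements of `k` are, up to units of `S`, powers of `p`. -/
def IsPowUpToUnits (p : ℕ) (S : ValuationSubring Ω) (k : Type w) [Field k] [Algebra k Ω] : Prop :=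
  ∀ a : k, a ≠ 0 → ∃ n : ℤ, S.valuation (algebraMap k Ω a * (p : Ω) ^ n) = 1

variable {k : Type w} [Field k] [Algebra k Ω] {p : ℕ}

/-- No two terms of f(t) have equal S-value. Equality would pass to T, where `t` is a unit, so the
two coefficients would involve the same power of p; their S-values would agree, and then so would
those of two powers of `t`, which is a non-unit of S. Thus f(t) has the S-value, hence the T-value,
of one of its terms. -/
theorem exists_valuation_aeval_eq_one (hk : IsPowUpToUnits p S k) (h : S ≤ T)
    (hpT : T.valuation (p : Ω) < 1) {t : Ω} (ht0 : t ≠ 0) (htS : S.valuation t < 1)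
    (htT : T.valuation t = 1) {f : k[X]} (hf : f ≠ 0) :
    ∃ n : ℤ, T.valuation (Polynomial.aeval t f * (p : Ω) ^ n) = 1 := by
  choose! n hn using hk
  have hnT : ∀ a : k, a ≠ 0 → T.valuation (algebraMap k Ω a) * T.valuation (p : Ω) ^ n a = 1 := by
    intro a ha
    rw [← map_zpow₀, ← map_mul, valuation_eq_of_le h (y := 1) (by rw [hn a ha, map_one]), map_one]
  have hnS : ∀ a : k, a ≠ 0 → S.valuation (algebraMap k Ω a) * S.valuation (p : Ω) ^ n a = 1 := by
    intro a ha
    rw [← map_zpow₀, ← map_mul, hn a ha]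
  obtain ⟨i, hi, hval⟩ := exists_valuation_sum_eq (O := S) (s := f.support)
    (f := fun i => algebraMap k Ω (f.coeff i) * t ^ i)
    (Polynomial.support_nonempty.mpr hf) (by
      intro i hi j hj hij
      rw [Polynomial.mem_support_iff] at hi hj
      have h1 := valuation_eq_of_le h hij
      rw [map_mul, map_mul, map_pow, map_pow, htT, one_pow, one_pow, mul_one, mul_one] at h1
      have h2 : T.valuation (p : Ω) ^ n (f.coeff i) = T.valuation (p : Ω) ^ n (f.coeff j) := by
        have := hnT _ hi
        rw [h1, ← hnT _ hj] at this
        exact mul_left_cancel₀ ((map_ne_zero _).mpr ((map_ne_zero _).mpr hj)) this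
      have h3 : n (f.coeff i) = n (f.coeff j) := by
        -- In equal characteristic p is zero, and the only exponent compatible with value 1 is 0.
        by_cases hp0 : T.valuation (p : Ω) = 0
        · have key : ∀ a : k, a ≠ 0 → n a = 0 := by
            intro a ha
            by_contra hne
            have := hnT a ha
            rw [hp0, zero_zpow _ hne, mul_zero] at this
            exact zero_ne_one this
          rw [key _ hi, key _ hj]
        · exact zpow_right_injective₀ (zero_lt_iff.mpr hp0) hpT.ne h2
      have h4 : S.valuation (algebraMap k Ω (f.coeff i)) =
          S.valuation (algebraMap k Ω (f.coeff j)) := by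
        have h5 := hnS _ hi
        have h6 := hnS _ hj
        rw [h3] at h5
        rw [← h6] at h5
        refine mul_right_cancel₀ (fun h0 => ?_) h5
        rw [h0, mul_zero] at h6
        exact zero_ne_one h6
      simp only [map_mul, map_pow] at hij
      rw [h4] at hij
      have h7 := mul_left_cancel₀ ((map_ne_zero _).mpr ((map_ne_zero _).mpr hj)) hij
      exact pow_right_injective₀ (zero_lt_iff.mpr ((map_ne_zero _).mpr ht0)) htS.ne h7)
  refine ⟨n (f.coeff i), ?_⟩
  rw [Polynomial.mem_support_iff] at hi
  rw [Polynomial.aeval_def, Polynomial.eval₂_eq_sum, Polynomial.sum_def, map_mul,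
    valuation_eq_of_le h hval, map_mul, map_pow, htT, one_pow, mul_one, map_zpow₀]
  exact hnT _ hi

/-- For `t`, take the inverse of an element of T outside S: a unit of T and a non-unit of S. Going
up to T thus costs one transcendental element. -/
theorem exists_adjoin_isPowUpToUnits (hk : IsPowUpToUnits p S k) (h : S < T)
    (hpT : T.valuation (p : Ω) < 1) : ∃ t : Ω, Transcendental k t ∧
      IsPowUpToUnits p T (IntermediateField.adjoin k {t}) := by
  obtain ⟨x, hxT, hxS⟩ := SetLike.exists_of_lt h
  have hx0 : x ≠ 0 := by
    rintro rfl
    exact hxS (zero_mem S)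
  have ht0 : x⁻¹ ≠ 0 := inv_ne_zero hx0
  have htS : S.valuation x⁻¹ < 1 := by
    rw [valuation_lt_one_iff_inv, inv_inv]
    exact Or.inr hxS
  have htT : T.valuation x⁻¹ = 1 := by
    refine le_antisymm ((T.valuation_le_one_iff _).mpr
      (h.le ((S.valuation_le_one_iff _).mp htS.le))) (not_lt.mp fun hlt => ?_)
    rw [valuation_lt_one_iff_inv, inv_inv] at hlt
    exact hlt.elim ht0 fun h' => h' hxT
  have key := fun f hf => exists_valuation_aeval_eq_one (f := f) hk h.le hpT ht0 htS htT hf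
  refine ⟨x⁻¹, ?_, ?_⟩
  · rw [transcendental_iff]
    intro f hf
    by_contra hf0
    obtain ⟨n, hn⟩ := key f hf0
    rw [hf, zero_mul, map_zero] at hn
    exact zero_ne_one hn
  · rintro ⟨a, ha⟩ ha0
    obtain ⟨r, s, rfl⟩ := IntermediateField.mem_adjoin_simple_iff k a |>.mp ha
    have hne : Polynomial.aeval x⁻¹ r / Polynomial.aeval x⁻¹ s ≠ 0 := fun h0 =>
      ha0 (Subtype.ext h0)
    rw [div_ne_zero_iff] at hne
    have hr0 : r ≠ 0 := by
      rintro rfl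
      exact hne.1 (map_zero _)
    have hs0 : s ≠ 0 := by
      rintro rfl
      exact hne.2 (map_zero _)
    obtain ⟨m, hm⟩ := key r hr0
    obtain ⟨n, hn⟩ := key s hs0
    have hpm : (p : Ω) ^ m ≠ 0 := by
      intro h0
      rw [h0, mul_zero, map_zero] at hm
      exact zero_ne_one hm
    have hpn : (p : Ω) ^ n ≠ 0 := by
      intro h0
      rw [h0, mul_zero, map_zero] at hn
      exact zero_ne_one hn
    refine ⟨m - n, ?_⟩
    have h1 : (p : Ω) ^ (m - n) = (p : Ω) ^ m / (p : Ω) ^ n := by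
      by_cases hp0 : (p : Ω) = 0
      · have hm0 : m = 0 := by
          by_contra hm0
          exact hpm (by rw [hp0, zero_zpow _ hm0])
        have hn0 : n = 0 := by
          by_contra hn0
          exact hpn (by rw [hp0, zero_zpow _ hn0])
        simp [hm0, hn0]
      · exact zpow_sub₀ hp0 m n
    change T.valuation (Polynomial.aeval x⁻¹ r / Polynomial.aeval x⁻¹ s * (p : Ω) ^ (m - n)) = 1
    rw [h1, div_mul_div_comm, map_div₀, hm, hn, div_one]

/-- The overrings of S form a chain. Passing to the least one in `F` adjoins one transcendental
element to the base, and induction applies to the rest. -/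
theorem card_le_trdeg (F : Finset (ValuationSubring Ω)) {k : Type v} [Field k] [Algebra k Ω]
    {S : ValuationSubring Ω} (hk : IsPowUpToUnits p S k)
    (hF : ∀ U ∈ F, S < U ∧ U.valuation (p : Ω) < 1) : (F.card : Cardinal) ≤ Algebra.trdeg k Ω := by
  classical
  induction hn : F.card generalizing F k S with
  | zero => simp
  | succ n ih =>
    have hne : F.Nonempty := Finset.card_pos.mp (by omega)
    obtain ⟨U, hU, hmin⟩ := F.exists_minimal hne
    obtain ⟨t, ht, hk'⟩ := exists_adjoin_isPowUpToUnits hk (hF U hU).1 (hF U hU).2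
    have h1 := ih (F.erase U) (k := IntermediateField.adjoin k {t}) (S := U) hk' (by
      intro V hV
      rw [Finset.mem_erase] at hV
      refine ⟨?_, (hF V hV.2).2⟩
      have htot := le_total (⟨U, (hF U hU).1.le⟩ : {R // S ≤ R}) ⟨V, (hF V hV.2).1.le⟩
      have hUV : U ≤ V := htot.elim id fun hle => hmin hV.2 hle
      exact lt_of_le_of_ne hUV (Ne.symm hV.1)) (by rw [Finset.card_erase_of_mem hU, hn]; rfl)
    have h2 := trdeg_add_eq k (IntermediateField.adjoin k {t}) (A := Ω)
    have h3 : Algebra.Transcendental k (IntermediateField.adjoin k {t}) := by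
      refine ⟨⟨IntermediateField.AdjoinSimple.gen k t, ?_⟩⟩
      intro halg
      exact ht (by
        have := halg.algebraMap (A := Ω)
        simpa using this)
    have h4 : 1 ≤ Algebra.trdeg k (IntermediateField.adjoin k {t}) :=
      Cardinal.one_le_iff_pos.mpr (trdeg_pos _ _)
    rw [← h2, Nat.cast_succ, add_comm]
    exact add_le_add h4 h1

theorem finite_overrings {k : Type v} [Field k] [Algebra k Ω] [FinTrdeg k Ω]
    (hk : IsPowUpToUnits p S k) : {U | S < U ∧ U.valuation (p : Ω) < 1}.Finite := by
  by_contra hinf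
  obtain ⟨n, hn⟩ := Cardinal.lt_aleph0.mp (trdeg_lt_aleph0 k Ω)
  obtain ⟨F, hF, hcard⟩ := Set.Infinite.exists_subset_card_eq hinf (n + 1)
  have h1 := card_le_trdeg F hk fun U hU => hF hU
  rw [hn, hcard, Nat.cast_le] at h1
  omega

theorem isPowUpToUnits_bot (hp : p.Prime) (hpS : S.valuation (p : Ω) < 1) :
    IsPowUpToUnits p S (⊥ : Subfield Ω) := by
  have hfrac : ∀ a ∈ (⊥ : Subfield Ω), ∃ m n : ℤ, (n : Ω) ≠ 0 ∧ a = m / n := by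
    intro a ha
    rw [← Subfield.closure_empty] at ha
    induction ha using Subfield.closure_induction with
    | mem x hx => exact hx.elim
    | one => exact ⟨1, 1, by simp, by simp⟩
    | add x y _ _ hx hy =>
      obtain ⟨m, n, hn, rfl⟩ := hx
      obtain ⟨m', n', hn', rfl⟩ := hy
      refine ⟨m * n' + n * m', n * n', by push_cast; exact mul_ne_zero hn hn', ?_⟩
      push_cast
      rw [div_add_div _ _ hn hn']
    | neg x _ hx =>
      obtain ⟨m, n, hn, rfl⟩ := hx
      exact ⟨-m, n, hn, by push_cast; rw [neg_div]⟩
    | inv x _ hx =>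
      obtain ⟨m, n, hn, rfl⟩ := hx
      by_cases hm : (m : Ω) = 0
      · exact ⟨0, 1, by simp, by simp [hm]⟩
      · exact ⟨n, m, hm, by rw [inv_div]⟩
    | mul x y _ _ hx hy =>
      obtain ⟨m, n, hn, rfl⟩ := hx
      obtain ⟨m', n', hn', rfl⟩ := hy
      refine ⟨m * m', n * n', by push_cast; exact mul_ne_zero hn hn', ?_⟩
      push_cast
      rw [div_mul_div_comm]
  have hint : ∀ m : ℤ, (m : Ω) ≠ 0 → ∃ n : ℕ, (p : Ω) ^ n ≠ 0 ∧
      S.valuation ((m : Ω) / (p : Ω) ^ n) = 1 := by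
    intro m hm
    have hm0 : m ≠ 0 := by
      rintro rfl
      exact hm (by simp)
    obtain ⟨n, m', hm', hmn⟩ := Nat.exists_eq_pow_mul_and_not_dvd
      (Int.natAbs_ne_zero.mpr hm0) p hp.ne_one
    have h1 : S.valuation (m : Ω) = S.valuation ((p : Ω) ^ n) := by
      have h2 : S.valuation (m : Ω) = S.valuation ((m.natAbs : ℕ) : Ω) := by
        rcases Int.natAbs_eq m with h | h
        · conv_lhs => rw [h]
          simp
        · conv_lhs => rw [h]
          rw [Int.cast_neg, S.valuation.map_neg]
          simp
      rw [h2, hmn]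
      push_cast
      rw [map_mul, valuation_natCast_eq_one hp hpS hm', mul_one]
    have h3 : (p : Ω) ^ n ≠ 0 := by
      intro h0
      rw [h0, map_zero, map_eq_zero] at h1
      exact hm h1
    exact ⟨n, h3, by rw [map_div₀, h1, div_self ((map_ne_zero _).mpr h3)]⟩
  rintro ⟨a, ha⟩ ha0
  obtain ⟨m, n, hn, rfl⟩ := hfrac a ha
  have hm : (m : Ω) ≠ 0 := by
    intro h0
    exact ha0 (Subtype.ext (by simp [h0]))
  obtain ⟨i, hi0, hi⟩ := hint m hm
  obtain ⟨j, hj0, hj⟩ := hint n hn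
  refine ⟨(j : ℤ) - i, ?_⟩
  have h1 : (p : Ω) ^ ((j : ℤ) - i) = (p : Ω) ^ j / (p : Ω) ^ i := by
    by_cases hp0 : (p : Ω) = 0
    · have hi' : i = 0 := by
        by_contra h
        exact hi0 (by rw [hp0, zero_pow h])
      have hj' : j = 0 := by
        by_contra h
        exact hj0 (by rw [hp0, zero_pow h])
      simp [hi', hj']
    · rw [zpow_sub₀ hp0, zpow_natCast, zpow_natCast]
  change S.valuation ((m : Ω) / n * (p : Ω) ^ ((j : ℤ) - i)) = 1
  rw [h1, show (m : Ω) / n * ((p : Ω) ^ j / (p : Ω) ^ i) =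
    ((m : Ω) / (p : Ω) ^ i) / ((n : Ω) / (p : Ω) ^ j) by field_simp, map_div₀, hi, hj, div_one]

end FiniteRank

/-! ### From rank one to finitely many overrings -/

section

variable {K : Type u} {Ω : Type v} [Field K] [Field Ω] [Algebra K Ω] {O : ValuationSubring Ω}

/-- If p is a non-unit in some larger ring, take the least of these finitely many rings. Otherwise p
is a unit in every larger ring, so S[1/p] is the least one; p is not zero because it is a unit in Ω
itself. -/
theorem exists_minimal_overring {p : ℕ}
    (hfin : {U | O < U ∧ U.valuation (p : Ω) < 1}.Finite) {S : ValuationSubring Ω} (hOS : O ≤ S)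
    (hpS : S.valuation (p : Ω) < 1) (hS : S ≠ ⊤) :
    ∃ T, S < T ∧ ∀ U, S < U → T ≤ U := by
  have htot : ∀ U V : ValuationSubring Ω, S < U → S < V → U ≤ V ∨ V ≤ U := fun U V hU hV =>
    le_total (⟨U, hU.le⟩ : {R // S ≤ R}) ⟨V, hV.le⟩
  by_cases hne : {U | S < U ∧ U.valuation (p : Ω) < 1}.Nonempty
  · have hfin' : {U | S < U ∧ U.valuation (p : Ω) < 1}.Finite :=
      hfin.subset fun U hU => ⟨hOS.trans_lt hU.1, hU.2⟩
    obtain ⟨T, hT, hmin⟩ := hfin'.exists_minimal hne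
    refine ⟨T, hT.1, fun U hU => (htot T U hT.1 hU).elim id fun hle => ?_⟩
    exact hmin ⟨hU, valuation_lt_one_of_le hle hT.2⟩ hle
  · have hunit : ∀ U, S < U → ¬ U.valuation (p : Ω) < 1 := fun U hU hlt => hne ⟨U, hU, hlt⟩
    have hp0 : (p : Ω) ≠ 0 := by
      intro h0
      refine hunit ⊤ (lt_top_iff_ne_top.mpr hS) ?_
      rw [h0, map_zero]
      exact zero_lt_one
    refine ⟨invertElement S (natCast_mem S p), ?_, fun U hU z hz => ?_⟩
    · refine lt_of_le_of_ne (fun z hz => ⟨0, by simpa using hz⟩) fun heq => ?_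
      refine (valuation_lt_one_iff_inv.mp hpS).elim hp0 fun h => h ?_
      rw [heq]
      exact ⟨1, by rw [pow_one, inv_mul_cancel₀ hp0]; exact one_mem S⟩
    · obtain ⟨n, hn⟩ := hz
      have h1 := hunit U hU
      rw [valuation_lt_one_iff_inv, not_or, not_not] at h1
      have h2 := mul_mem (hU.le hn) (pow_mem h1.2 n)
      rwa [inv_pow, mul_inv_cancel_right₀ (pow_ne_zero n hp0)] at h2

theorem noPInertia_of_finite [IsGalois K Ω] [IsAlgClosed Ω] {p : ℕ} (hp : p.Prime)
    (hK : NoPDegree K Ω p) (hfin : {U | O < U ∧ U.valuation (p : Ω) < 1}.Finite) :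
    NoPInertia K O p := by
  refine noPInertia_of_forall_normal hp fun σ hσ N hNfin hN hσp => ?_
  by_contra! hcon
  obtain ⟨x, hxN, hx⟩ := hcon
  -- The overrings at which the action of `σ` on N still comes from inertia. In each of them p is a
  -- non-unit, by the tame case, so there are finitely many; a maximal one is contradicted by
  -- `exists_inertia_of_lt`.
  let bad : Set (ValuationSubring Ω) := {U | O ≤ U ∧ ∃ τ ∈ inertia K U, ∀ x ∈ N, τ x = σ x}
  have hpow : ∀ τ : Ω ≃ₐ[K] Ω, (∀ x ∈ N, τ x = σ x) → ∀ n : ℕ, ∀ x ∈ N, (τ ^ n) x = (σ ^ n) x := by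
    intro τ hτ n
    induction n with
    | zero => simp
    | succ n ih =>
      intro x hx
      rw [pow_succ, AlgEquiv.mul_apply, pow_succ, AlgEquiv.mul_apply, hτ x hx,
        ih _ (apply_mem_of_normal N σ hx)]
  have hbadp : ∀ U ∈ bad, U.valuation (p : Ω) < 1 := by
    rintro U ⟨-, τ, hτ, hτσ⟩
    refine lt_of_le_of_ne ((U.valuation_le_one_iff _).mpr (natCast_mem U p)) fun h1 => hx ?_
    rw [← hτσ x hxN]
    exact apply_eq_of_valuation_eq_one hp h1 hK hτ N
      (fun y hy => by rw [hpow τ hτσ p y hy, hσp y hy]) x hxN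
  have hbadfin : bad.Finite := by
    refine (hfin.union (Set.finite_singleton O)).subset fun U hU => ?_
    rcases hU.1.eq_or_lt with h | h
    · exact Or.inr h.symm
    · exact Or.inl ⟨h, hbadp U hU⟩
  obtain ⟨S, hS, hmax⟩ := hbadfin.exists_maximal ⟨O, le_rfl, σ, hσ, fun _ _ => rfl⟩
  have hS' := hS
  obtain ⟨hOS, τ, hτ, hτσ⟩ := hS'
  have hStop : S ≠ ⊤ := by
    rintro rfl
    have h1 := hτ.2 x trivial
    rw [valuation_lt_one_iff_inv] at h1
    apply hx
    rw [← hτσ x hxN]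
    exact sub_eq_zero.mp (h1.resolve_right fun h => h trivial)
  obtain ⟨T, hST, hmin⟩ := exists_minimal_overring hfin hOS (hbadp S hS) hStop
  obtain ⟨ρ, hρ, hρτ⟩ := exists_inertia_of_lt hp (hbadp S hS) hK hST hmin hτ N
    (fun y hy => by rw [hpow τ hτσ p y hy, hσp y hy])
  exact absurd (hmax ⟨hOS.trans hST.le, ρ, hρ, fun y hy => by rw [hρτ y hy, hτσ y hy]⟩ hST.le)
    (not_le_of_gt hST)

end

/-! ### Descent to finite transcendence degree -/

section Descent

variable {K : Type u} {Ω : Type v} [Field K] [Field Ω] [Algebra K Ω] {O : ValuationSubring Ω}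

theorem valuation_comap_lt_one_iff {E : Type w} [Field E] [Algebra E Ω] {x : E} :
    (O.comap (algebraMap E Ω)).valuation x < 1 ↔ O.valuation (algebraMap E Ω x) < 1 := by
  rw [valuation_lt_one_iff_inv, valuation_lt_one_iff_inv, map_eq_zero, ← map_inv₀]
  rfl

variable (Ω) in
/-- The inclusion of relative algebraic closures. -/
@[reducible] def algebraicClosureAlgebra (F : Subfield K) :
    Algebra (algebraicClosure F K) (algebraicClosure F Ω) :=
  ((algebraMap K Ω).restrict (algebraicClosure F K).toSubfield (algebraicClosure F Ω).toSubfield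
    fun _ ha => mem_algebraicClosure_iff.mpr
      ((mem_algebraicClosure_iff.mp ha).algHom (IsScalarTower.toAlgHom F K Ω))).toAlgebra

theorem isAlgebraic_algebraicClosure (F : Subfield K) :
    letI := algebraicClosureAlgebra Ω F
    Algebra.IsAlgebraic (algebraicClosure F K) (algebraicClosure F Ω) := by
  let := algebraicClosureAlgebra Ω F
  have : IsScalarTower F (algebraicClosure F K) (algebraicClosure F Ω) :=
    IsScalarTower.of_algebraMap_eq fun a => rfl
  exact Algebra.IsAlgebraic.tower_top (K := F) (algebraicClosure F K)

/-- The minimal polynomial over K of an element algebraic over F divides one with coefficients in F,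
so its coefficients are algebraic over F and the degree over the relative algebraic closure is the
same. -/
theorem noPDegree_algebraicClosure [Algebra.IsAlgebraic K Ω] (F : Subfield K) {p : ℕ}
    (hK : NoPDegree K Ω p) :
    letI := algebraicClosureAlgebra Ω F
    NoPDegree (algebraicClosure F K) (algebraicClosure F Ω) p := by
  let := algebraicClosureAlgebra Ω F
  intro β n hn
  have hint : IsIntegral K (β : Ω) := Algebra.IsIntegral.isIntegral _
  have hintF : IsIntegral F (β : Ω) := (mem_algebraicClosure_iff.mp β.2).isIntegral
  have hdvd : minpoly K (β : Ω) ∣ (minpoly F (β : Ω)).map (algebraMap F K) := by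
    apply minpoly.dvd
    rw [Polynomial.aeval_map_algebraMap, minpoly.aeval]
  have hlift : minpoly K (β : Ω) ∈ Polynomial.lifts (algebraMap (algebraicClosure F K) K) := by
    rw [Polynomial.lifts_iff_coeff_lifts]
    intro i
    refine ⟨⟨_, ?_⟩, rfl⟩
    exact mem_algebraicClosure_iff'.mpr (Polynomial.isIntegral_coeff_of_dvd _ _
      (minpoly.monic hintF) (minpoly.monic hint) hdvd i)
  obtain ⟨g, hg, hdeg, hgm⟩ :=
    Polynomial.lifts_and_natDegree_eq_and_monic hlift (minpoly.monic hint)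
  have hirr : Irreducible g := by
    refine hgm.irreducible_of_irreducible_map (algebraMap (algebraicClosure F K) K) _ ?_
    rw [hg]
    exact minpoly.irreducible hint
  have hroot : Polynomial.aeval β g = 0 := by
    apply Subtype.ext
    have h1 : ((Polynomial.aeval β g : algebraicClosure F Ω) : Ω) =
        Polynomial.aeval (β : Ω) (g.map (algebraMap (algebraicClosure F K) K)) := by
      rw [Polynomial.aeval_def, Polynomial.aeval_def, Polynomial.eval₂_map]
      exact Polynomial.hom_eval₂ g (algebraMap (algebraicClosure F K) (algebraicClosure F Ω))
        (algebraMap (algebraicClosure F Ω) Ω) β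
    rw [h1, hg, minpoly.aeval]
    rfl
  have h2 := minpoly.eq_of_irreducible_of_monic hirr hroot hgm
  refine hK β n ?_
  rw [← hdeg, h2, hn]

theorem apply_mem_algebraicClosure (F : Subfield K) (σ : Ω ≃ₐ[K] Ω) {x : Ω}
    (hx : x ∈ algebraicClosure F Ω) : σ x ∈ algebraicClosure F Ω :=
  mem_algebraicClosure_iff.mpr ((mem_algebraicClosure_iff.mp hx).algHom
    (σ.restrictScalars F : Ω →ₐ[F] Ω))

/-- The restriction of an automorphism to a relative algebraic closure. -/
def restrictAlgebraicClosure (F : Subfield K) (σ : Ω ≃ₐ[K] Ω) :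
    letI := algebraicClosureAlgebra Ω F
    algebraicClosure F Ω ≃ₐ[algebraicClosure F K] algebraicClosure F Ω :=
  letI := algebraicClosureAlgebra Ω F
  { toFun := fun x => ⟨σ x, apply_mem_algebraicClosure F σ x.2⟩
    invFun := fun x => ⟨σ.symm x, apply_mem_algebraicClosure F σ.symm x.2⟩
    left_inv := fun _ => Subtype.ext (σ.symm_apply_apply _)
    right_inv := fun _ => Subtype.ext (σ.apply_symm_apply _)
    map_mul' := fun x y => Subtype.ext (map_mul σ (x : Ω) y)
    map_add' := fun x y => Subtype.ext (map_add σ (x : Ω) y)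
    commutes' := fun a => Subtype.ext (σ.commutes (a : K)) }

theorem coe_restrictAlgebraicClosure_pow (F : Subfield K) (σ : Ω ≃ₐ[K] Ω) (n : ℕ)
    (x : algebraicClosure F Ω) :
    letI := algebraicClosureAlgebra Ω F
    (((restrictAlgebraicClosure F σ ^ n) x : algebraicClosure F Ω) : Ω) = (σ ^ n) x := by
  let := algebraicClosureAlgebra Ω F
  induction n generalizing x with
  | zero => rfl
  | succ n ih =>
    rw [pow_succ, AlgEquiv.mul_apply, ih, pow_succ, AlgEquiv.mul_apply]
    rfl

theorem restrictAlgebraicClosure_mem_inertia (F : Subfield K) {σ : Ω ≃ₐ[K] Ω}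
    (hσ : σ ∈ inertia K O) :
    letI := algebraicClosureAlgebra Ω F
    restrictAlgebraicClosure F σ ∈
      inertia (algebraicClosure F K) (O.comap (algebraMap (algebraicClosure F Ω) Ω)) := by
  let := algebraicClosureAlgebra Ω F
  refine ⟨mem_decomposition_iff.mpr fun x => mem_decomposition_iff.mp hσ.1 x, fun x hx => ?_⟩
  rw [valuation_comap_lt_one_iff]
  exact hσ.2 x hx

theorem finTrdeg_algebraicClosure (s : Finset K) :
    FinTrdeg (⊥ : Subfield (algebraicClosure (Subfield.closure (s : Set K)) Ω))
      (algebraicClosure (Subfield.closure (s : Set K)) Ω) := by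
  let F := Subfield.closure (s : Set K)
  let Ω' := algebraicClosure F Ω
  let j : s → Ω' := fun a => algebraMap F Ω' ⟨a, Subfield.subset_closure a.2⟩
  let E := IntermediateField.adjoin (⊥ : Subfield Ω') (Set.range j)
  refine ⟨E, IntermediateField.fg_adjoin_of_finite (Set.finite_range j), ?_⟩
  have hle : F ≤ (E.toSubfield.map (algebraMap Ω' Ω)).comap (algebraMap K Ω) := by
    rw [Subfield.closure_le]
    intro a ha
    exact ⟨j ⟨a, ha⟩, IntermediateField.subset_adjoin _ _ ⟨⟨a, ha⟩, rfl⟩, rfl⟩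
  have hmem : ∀ a : F, algebraMap F Ω' a ∈ E := by
    intro a
    obtain ⟨e, he, hea⟩ := hle a.2
    have : e = algebraMap F Ω' a := Subtype.ext hea
    rwa [← this]
  let : Algebra F E := ((algebraMap F Ω').codRestrict E.toSubfield hmem).toAlgebra
  have : IsScalarTower F E Ω' := IsScalarTower.of_algebraMap_eq fun a => rfl
  exact Algebra.IsAlgebraic.tower_top (K := F) E

/-- If no element of `Ω` has as its degree over `K` a non-trivial power of the residue
characteristic, then the inertia group has no wild part. -/
theorem noPInertia [Algebra.IsAlgebraic K Ω] [IsAlgClosed Ω] {p : ℕ} (hp : p.Prime)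
    (hpO : O.valuation (p : Ω) < 1) (hK : NoPDegree K Ω p) : NoPInertia K O p := by
  classical
  intro σ hσ x hx
  let f := minpoly K x
  -- The coefficients of the minimal polynomial of `x` generate a subfield F over which `x` is
  -- algebraic. The statement is then proved over the relative algebraic closure of F.
  let s : Finset K := f.support.image f.coeff
  let F := Subfield.closure (s : Set K)
  have hlift : f ∈ Polynomial.lifts (algebraMap F K) := by
    rw [Polynomial.lifts_iff_coeff_lifts]
    intro i
    by_cases hi : f.coeff i = 0
    · exact ⟨0, by rw [hi, map_zero]⟩
    · exact ⟨⟨f.coeff i, Subfield.subset_closure (Finset.mem_image_of_mem _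
        (Polynomial.mem_support_iff.mpr hi))⟩, rfl⟩
  have hxF : x ∈ algebraicClosure F Ω := by
    obtain ⟨g, hg⟩ := hlift
    have hg' : g.map (algebraMap F K) = f := hg
    refine mem_algebraicClosure_iff.mpr ⟨g, ?_, ?_⟩
    · rintro rfl
      rw [Polynomial.map_zero] at hg'
      exact minpoly.ne_zero (Algebra.IsIntegral.isIntegral x) hg'.symm
    · rw [← Polynomial.aeval_map_algebraMap K, hg', minpoly.aeval]
  let := algebraicClosureAlgebra Ω F
  have := isAlgebraic_algebraicClosure (Ω := Ω) F
  have : IsAlgClosed (algebraicClosure F Ω) := IsAlgClosure.isAlgClosed F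
  let O' := O.comap (algebraMap (algebraicClosure F Ω) Ω)
  have hpO' : O'.valuation (p : algebraicClosure F Ω) < 1 := by
    rw [valuation_comap_lt_one_iff, map_natCast]
    exact hpO
  have hK' := noPDegree_algebraicClosure (Ω := Ω) F hK
  have := hK'.isGalois hp hpO'
  have := finTrdeg_algebraicClosure (Ω := Ω) s
  have hno := noPInertia_of_finite (O := O') hp hK' (finite_overrings (isPowUpToUnits_bot hp hpO'))
  have h1 := hno _ (restrictAlgebraicClosure_mem_inertia F hσ) ⟨x, hxF⟩
    (Subtype.ext ((coe_restrictAlgebraicClosure_pow F σ p ⟨x, hxF⟩).trans hx))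
  exact congrArg Subtype.val h1

end Descent

/-! ### Tameness over a henselian field -/

section LinearDisjoint

variable {K : Type u} {Ω : Type v} [Field K] [Field Ω] [Algebra K Ω]

/-- Linear disjointness is tested on finite subextensions. A finite part of A can be enlarged to its
normal closure, which stays in A, and for a finite Galois extension trivial intersection suffices.
-/
theorem linearDisjoint_of_inf_eq_bot [IsGalois K Ω] (A B : IntermediateField K Ω) [IsGalois K A]
    (h : A ⊓ B = ⊥) : A.LinearDisjoint B := by
  rw [IntermediateField.linearDisjoint_iff']
  have : Algebra.IsIntegral K A.toSubalgebra := inferInstanceAs (Algebra.IsIntegral K A)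
  have : Algebra.IsIntegral K B.toSubalgebra := inferInstanceAs (Algebra.IsIntegral K B)
  refine Subalgebra.LinearDisjoint.of_linearDisjoint_finite fun A' B' hA' hB' _ _ => ?_
  have hfield : ∀ C : Subalgebra K Ω, Module.Finite K C → ∀ x ∈ C, x⁻¹ ∈ C := fun C _ x hx =>
    C.inv_mem_of_algebraic (x := ⟨x, hx⟩)
      ((Algebra.IsAlgebraic.isAlgebraic (⟨x, hx⟩ : C)).algHom C.val)
  let A₁ : IntermediateField K Ω := A'.toIntermediateField (hfield A' inferInstance)
  let B₁ : IntermediateField K Ω := B'.toIntermediateField (hfield B' inferInstance)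
  have : FiniteDimensional K A₁ := inferInstanceAs (Module.Finite K A')
  have : FiniteDimensional K B₁ := inferInstanceAs (Module.Finite K B')
  have hA₁ : A₁ ≤ A := hA'
  let A₂ := IntermediateField.normalClosure K A₁ Ω
  have hA₂ : A₂ ≤ A := IntermediateField.normalClosure_le_iff_of_normal.mpr hA₁
  have hdisj : A₂.LinearDisjoint B₁ := IntermediateField.LinearDisjoint.of_inf_eq_bot
    (le_bot_iff.mp ((inf_le_inf hA₂ (show B₁ ≤ B from hB')).trans h.le))
  exact IntermediateField.linearDisjoint_iff'.mp (hdisj.of_le_left A₁.le_normalClosure)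

end LinearDisjoint

section Henselian

variable {K : Type u} {Ω : Type v} [Field K] [Field Ω] [Algebra K Ω] {O : ValuationSubring Ω}

theorem isClosed_decomposition [Algebra.IsAlgebraic K Ω] :
    IsClosed (O.decompositionSubgroup K : Set (Ω ≃ₐ[K] Ω)) := by
  rw [← closure_subset_iff_isClosed]
  intro σ hσ
  refine mem_decomposition_iff.mpr fun x => ?_
  have hopen : IsOpen {τ : Ω ≃ₐ[K] Ω | (σ⁻¹ * τ) x = x} :=
    (isOpen_stabilizer_apply x).preimage (continuous_const_mul σ⁻¹)
  obtain ⟨τ, hτ, hτD⟩ := mem_closure_iff.mp hσ _ hopen (by simp)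
  have h1 : τ x = σ x := σ.symm.injective (hτ.trans (σ.symm_apply_apply x).symm)
  rw [← h1]
  exact mem_decomposition_iff.mp hτD x

/-- D is closed, so by the Galois correspondence it is the full Galois group of Ω over its fixed
field K^h. -/
theorem mem_decomposition_of_henselization [IsGalois K Ω] [IsAlgClosed Ω]
    (σ : Ω ≃ₐ[henselization K O] Ω) : σ ∈ O.decompositionSubgroup (henselization K O) := by
  have h1 : σ.restrictScalars K ∈
      (IntermediateField.fixedField (O.decompositionSubgroup K)).fixingSubgroup := by
    rw [← henselization_eq]
    exact fun x => σ.commutes x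
  have h2 := InfiniteGalois.fixingSubgroup_fixedField (k := K) (K := Ω)
    ⟨O.decompositionSubgroup K, isClosed_decomposition⟩
  rw [show (IntermediateField.fixedField (O.decompositionSubgroup K)).fixingSubgroup =
    O.decompositionSubgroup K from h2] at h1
  exact mem_decomposition_iff.mpr (mem_decomposition_iff.mp h1)

theorem restrictScalars_mem_inertia (M : Type w) [Field M] [Algebra K M] [Algebra M Ω]
    [IsScalarTower K M Ω] {σ : Ω ≃ₐ[M] Ω} (hσ : σ ∈ inertia M O) :
    σ.restrictScalars K ∈ inertia K O :=
  ⟨mem_decomposition_iff.mpr (mem_decomposition_iff.mp hσ.1), hσ.2⟩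

theorem NoPInertia.tower_top (M : Type w) [Field M] [Algebra K M] [Algebra M Ω]
    [IsScalarTower K M Ω] {p : ℕ} (h : NoPInertia K O p) : NoPInertia M O p := by
  intro σ hσ x hx
  refine h _ (restrictScalars_mem_inertia (K := K) M hσ) x ?_
  rw [pow_apply_eq_iterate] at hx ⊢
  exact hx

theorem inertia_normal (hD : ∀ σ : Ω ≃ₐ[K] Ω, σ ∈ O.decompositionSubgroup K) :
    (inertia K O).Normal :=
  ⟨fun _ hσ τ => conj_mem_inertia hσ (hD τ)⟩

theorem isGalois_fixedField_inertia [IsGalois K Ω]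
    (hD : ∀ σ : Ω ≃ₐ[K] Ω, σ ∈ O.decompositionSubgroup K) :
    IsGalois K (IntermediateField.fixedField (inertia K O)) := by
  have : Normal K (IntermediateField.fixedField (inertia K O)) := by
    rw [IntermediateField.normal_iff_forall_map_le']
    rintro τ _ ⟨x, hx, rfl⟩ ⟨σ, hσ⟩
    have h1 : (τ⁻¹ * σ * τ) x = x := hx ⟨_, by
      have := conj_mem_inertia hσ (hD τ⁻¹)
      rwa [inv_inv] at this⟩
    change τ.symm (σ (τ x)) = x at h1
    exact (τ.symm_apply_eq).mp h1
  constructor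

/-- Let J be the image of inertia in Gal(N/K), N the normal closure of A, and B its fixed field,
Galois over K. Disjointness of A and B makes [A : K] divide [N : B] = |J|. If p divided |J|, Cauchy
would give an element of order p, contrary to `NoPInertia`. -/
theorem not_dvd_finrank_of_inf_eq_bot [IsGalois K Ω]
    (hD : ∀ σ : Ω ≃ₐ[K] Ω, σ ∈ O.decompositionSubgroup K) {p : ℕ} (hp : p.Prime)
    (hI : NoPInertia K O p) (A : IntermediateField K Ω) [FiniteDimensional K A]
    (hA : A ⊓ IntermediateField.fixedField (inertia K O) = ⊥) : ¬ p ∣ Module.finrank K A := by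
  classical
  intro hdvd
  have : Fact p.Prime := ⟨hp⟩
  let N := IntermediateField.normalClosure K A Ω
  have hAN : A ≤ N := A.le_normalClosure
  let r := AlgEquiv.restrictNormalHom (F := K) (K₁ := Ω) N
  have hr : ∀ (g : Ω ≃ₐ[K] Ω) (x : N), ((r g x : N) : Ω) = g x := fun g x =>
    AlgEquiv.restrictNormal_commutes g N x
  let J := (inertia K O).map r
  have hJ : J.Normal := (inertia_normal hD).map r (AlgEquiv.restrictNormalHom_surjective Ω)
  let B := IntermediateField.fixedField J
  have hB : IsGalois K B := IsGalois.of_fixedField_normal_subgroup J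
  let A₁ := IntermediateField.restrict hAN
  have hdisj : B.LinearDisjoint A₁ := by
    refine IntermediateField.LinearDisjoint.of_inf_eq_bot (le_bot_iff.mp ?_)
    rintro x ⟨hxB, hxA⟩
    have h1 : (x : Ω) ∈ A ⊓ IntermediateField.fixedField (inertia K O) := by
      refine ⟨(IntermediateField.mem_restrict hAN x).mp hxA, fun σ => ?_⟩
      change σ.1 (x : Ω) = x
      rw [← hr]
      exact congrArg Subtype.val (hxB ⟨r σ.1, σ.1, σ.2, rfl⟩)
    rw [hA] at h1
    obtain ⟨a, ha⟩ := IntermediateField.mem_bot.mp h1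
    exact IntermediateField.mem_bot.mpr ⟨a, Subtype.ext ha⟩
  have h1 : Module.finrank K A₁ = Module.finrank K A :=
    (IntermediateField.restrictAlgEquiv hAN).toLinearEquiv.finrank_eq.symm
  have h2 := hdisj.finrank_sup
  have h3 := Module.finrank_mul_finrank K ↥(B ⊔ A₁) N
  have h4 := Module.finrank_mul_finrank K B N
  rw [IntermediateField.finrank_fixedField_eq_card] at h4
  rw [h2, ← h4, mul_assoc] at h3
  have h5 := mul_left_cancel₀ (Module.finrank_pos (R := K) (M := B)).ne' h3
  have h6 : p ∣ Nat.card J := by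
    rw [← h5, h1]
    exact hdvd.mul_right _
  obtain ⟨⟨τ, σ, hσ, rfl⟩, hτ⟩ := exists_prime_orderOf_dvd_card' p h6
  have h7 : r σ ^ p = 1 := by
    have := pow_orderOf_eq_one (⟨r σ, σ, hσ, rfl⟩ : J)
    rw [hτ] at this
    exact congrArg Subtype.val this
  have h8 : ∀ x : N, σ x = x := by
    intro x
    refine hI σ hσ x ?_
    rw [← hr, map_pow, h7]
    rfl
  have h9 : (⟨r σ, σ, hσ, rfl⟩ : J) = 1 := by
    apply Subtype.ext
    ext x
    change ((r σ x : N) : Ω) = x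
    rw [hr, h8]
  rw [h9, orderOf_one] at hτ
  exact hp.one_lt.ne hτ

theorem isTameHenselian [IsGalois K Ω] [IsAlgClosed Ω]
    (hD : ∀ σ : Ω ≃ₐ[K] Ω, σ ∈ O.decompositionSubgroup K)
    (hI : ∀ q : ℕ, q.Prime → q ∣ ringExpChar (ResidueField (O.comap (algebraMap K Ω))) →
      NoPInertia K O q) (E : IntermediateField K Ω) : IsTameHenselian K O E := by
  let M := E ⊓ strictHenselization K O
  have hDM : ∀ σ : Ω ≃ₐ[M] Ω, σ ∈ O.decompositionSubgroup M := fun σ =>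
    mem_decomposition_iff.mpr (mem_decomposition_iff.mp (hD (σ.restrictScalars K)))
  let E' : IntermediateField M Ω := IntermediateField.extendScalars (inf_le_left : M ≤ E)
  -- The inertia group of K fixes M, as M lies in K^u, so it is contained in the inertia group of M.
  -- Hence E ∩ M^u lies in E ∩ K^u = M.
  have hinf : E' ⊓ IntermediateField.fixedField (inertia M O) = ⊥ := by
    refine le_bot_iff.mp fun x hx => ?_
    have h1 : x ∈ strictHenselization K O := by
      rw [strictHenselization_eq]
      intro σ
      have hσM : ∀ y : M, σ.1 y = y := fun y => by
        have h2 := y.2.2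
        rw [strictHenselization_eq] at h2
        exact h2 σ
      exact hx.2 ⟨IntermediateField.fixingSubgroupEquiv M ⟨σ.1, hσM⟩,
        mem_decomposition_iff.mpr (mem_decomposition_iff.mp σ.2.1), σ.2.2⟩
    exact IntermediateField.mem_bot.mpr ⟨⟨x, hx.1, h1⟩, rfl⟩
  have : IsGalois M (IntermediateField.fixedField (inertia M O)) :=
    isGalois_fixedField_inertia hDM
  refine ⟨M, inf_le_left, inf_le_right, ?_, inferInstance, fun F hF q hq hqF => ⟨hq, fun hqp => ?_⟩⟩
  · change E'.LinearDisjoint (strictHenselization M O)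
    rw [strictHenselization_eq]
    exact (linearDisjoint_of_inf_eq_bot _ _ (by rw [inf_comm]; exact hinf)).symm
  · have hfin : FiniteDimensional M (IntermediateField.lift F) :=
      Module.Finite.equiv (IntermediateField.liftAlgEquiv F).toLinearEquiv
    refine not_dvd_finrank_of_inf_eq_bot hDM hq ((hI q hq hqp.2).tower_top M)
      (IntermediateField.lift F) (le_bot_iff.mp ?_) ?_
    · rw [← hinf]
      exact inf_le_inf_right _ (IntermediateField.lift_le F)
    · rw [← (IntermediateField.liftAlgEquiv F).toLinearEquiv.finrank_eq]
      exact hqF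

end Henselian

/-! ### Fields without `p`-extensions -/

section Closed

variable {K : Type u} {Ω : Type v} [Field K] [Field Ω] [Algebra K Ω] {O : ValuationSubring Ω}

theorem noPDegree_of_isPClosed [Algebra.IsAlgebraic K Ω] {p : ℕ} (hp : p.Prime)
    (hK : IsPClosed (primesOf p) K) : NoPDegree K Ω p := by
  intro β n hn
  have hint : IsIntegral K β := Algebra.IsIntegral.isIntegral β
  have : Fact (Irreducible (minpoly K β)) := ⟨minpoly.irreducible hint⟩
  -- An abstract copy of K(β) in the universe of K, as p-closedness requires.
  let L := AdjoinRoot (minpoly K β)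
  let pb := AdjoinRoot.powerBasis (minpoly.ne_zero hint)
  have : FiniteDimensional K L := pb.finite
  have hrank : Module.finrank K L = p ^ n := by
    rw [pb.finrank, AdjoinRoot.powerBasis_dim, hn]
  have hsurj := hK L ⟨inferInstance, fun F _ q hq hqF => ⟨hq, ?_⟩⟩
  · have h1 : Module.finrank K L = 1 := by
      have h2 : (⊥ : Subalgebra K L) = ⊤ := by
        rw [eq_top_iff]
        intro x _
        exact Algebra.mem_bot.mpr (hsurj x)
      exact Subalgebra.bot_eq_top_iff_finrank_eq_one.mp h2
    rw [hrank] at h1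
    exact (pow_eq_one_iff.mp h1).resolve_left hp.ne_one
  · have h1 : Module.finrank K F ∣ p ^ n := by
      rw [← hrank, ← Module.finrank_mul_finrank K F L]
      exact dvd_mul_right _ _
    exact hq.dvd_of_dvd_pow (hqF.trans h1)

theorem expChar_residueField_iff (p : ℕ) :
    ExpChar (ResidueField (O.comap (algebraMap K Ω))) p ↔ ExpChar (ResidueField O) p :=
  RingHom.expChar_iff (ResidueField.map (comapHom K O)) (RingHom.injective _) p

theorem isTameHenselian_of_isPClosed [Algebra.IsAlgebraic K Ω] [IsAlgClosed Ω] {p : ℕ}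
    (hO : ExpChar (ResidueField (O.comap (algebraMap K Ω))) p) (hK : IsPClosed (primesOf p) K)
    (E : IntermediateField (henselization K O) Ω) : IsTameHenselian (henselization K O) O E := by
  rw [expChar_residueField_iff] at hO
  have hp : ringExpChar (ResidueField (O.comap (algebraMap (henselization K O) Ω))) = p := by
    have := (expChar_residueField_iff (K := henselization K O) p).mpr hO
    exact ringExpChar.eq _ p
  -- For residue characteristic exponent 1 the field K has characteristic zero and no prime divides
  -- the exponent, so the condition on inertia is vacuous.
  rcases hO with _ | hprime
  · have : CharZero K := by
      constructor
      intro m n hmn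
      have h1 : (m : Ω) = n := by
        simpa using congrArg (algebraMap K Ω) hmn
      have h2 : (m : O) = n := Subtype.ext h1
      have h3 := congrArg (residue O) h2
      rw [map_natCast, map_natCast] at h3
      exact_mod_cast h3
    have : IsGalois K Ω := by
      have : Normal K Ω := normal_iff.mpr fun x =>
        ⟨Algebra.IsIntegral.isIntegral x, IsAlgClosed.splits _⟩
      constructor
    refine isTameHenselian mem_decomposition_of_henselization (fun q hq hqp => ?_) E
    rw [hp, Nat.dvd_one] at hqp
    exact absurd hqp hq.ne_one
  · have hpO : O.valuation (p : Ω) < 1 :=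
      natCast_residue_eq_zero_iff.mp (CharP.cast_eq_zero _ p)
    have hK' := noPDegree_of_isPClosed (Ω := Ω) hprime hK
    have : IsGalois K Ω := hK'.isGalois hprime hpO
    refine isTameHenselian mem_decomposition_of_henselization (fun q hq hqp => ?_) E
    rw [hp, Nat.prime_dvd_prime_iff_eq hq hprime] at hqp
    rw [hqp]
    exact (noPInertia hprime hpO hK').tower_top _

end Closed

end ValuedTame

end

/-- Every intermediate field of Ω/K^h is tame over K^h. Both assertions are instances: Ω itself for
K^a = K^t, and L^h inside an algebraic closure of L. -/
theorem mainTheorem6 {K : Type u} [Field K] {Γ : Type v} [LinearOrderedCommGroupWithZero Γ]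
    (ν : Valuation K Γ) (p : ℕ) [ExpChar (IsLocalRing.ResidueField ν.valuationSubring) p]
    (hK : ValuedTame.IsPClosed (ValuedTame.primesOf p) K) :
    ValuedTame.IsTameField ν.valuationSubring ∧
    ∀ (L : Type w) [Field L] [Algebra K L] [Algebra.IsAlgebraic K L]
      (Γ' : Type x) [LinearOrderedCommGroupWithZero Γ'] (ω : Valuation L Γ'),
      ν.IsEquiv (ω.comap (algebraMap K L)) →
        ValuedTame.IsTameExtension K ω.valuationSubring := by
  refine ⟨fun O hO => ?_, fun L _ _ _ Γ' _ ω hνω O hO => ?_⟩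
  · have h := ValuedTame.isTameHenselian_of_isPClosed (O := O) (by rw [hO]; infer_instance) hK ⊤
    have htop : sSup {E | ValuedTame.IsTameHenselian (ValuedTame.henselization K O) O E} = ⊤ :=
      top_le_iff.mp (le_sSup h)
    rw [ValuedTame.tameClosure, htop, IntermediateField.restrictScalars_top]
  · have : Algebra.IsAlgebraic K (AlgebraicClosure L) := Algebra.IsAlgebraic.trans K L _
    refine ValuedTame.isTameHenselian_of_isPClosed (O := O) ?_ hK _
    have h : O.comap (algebraMap K (AlgebraicClosure L)) = ν.valuationSubring := by
      ext a
      rw [ValuationSubring.mem_comap, IsScalarTower.algebraMap_apply K L (AlgebraicClosure L),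
        ← ValuationSubring.mem_comap, hO, Valuation.mem_valuationSubring_iff,
        Valuation.mem_valuationSubring_iff]
      exact hνω.le_one_iff_le_one.symm
    rw [h]
    infer_instance
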